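/- Let $\mathbb D=\{z\in\mathbb C:|z|<1\}$, let $\mathbb T=\partial\mathbb D$, and let $dA=\frac{dx\,dy}{\pi}$ be normalized area measure on $\mathbb D$. A weight is a function $\omega:\mathbb D\to(0,\infty)$ that is integrable with respect to $dA$; it is radial if $\omega(z)=\omega(|z|)$ for all $z\in\mathbb D$. For a radial weight put $\psi_\omega(r)=\frac1{\omega(r)}\int_r^1\omega(s)\,ds$, $0\le r<1$. A continuous radial weight $\omega$ is regular ($\omega\in\mathcal R$) if there are constants $C_1,C_2>0$ with $C_1(1-r)\le\psi_\omega(r)\le C_2(1-r)$ for all $0\le r<1$, and rapidly increasing ($\omega\in\mathcal I$) if $\lim_{r\to1^-}\psi_\omega(r)/(1-r)=\infty$. For $0<p<\infty$, $A^p_\omega$ is the space of analytic functions $f$ in $\mathbb D$ with $\|f\|_{A^p_\omega}^p=\int_{\mathbb D}|f|^p\omega\,dA<\infty$. For an interval (arc) $I\subset\mathbb T$ of positive arc length $|I|\le2\pi$, the Carleson square is $S(I)=\{re^{it}\in\mathbb D: e^{it}\in I,\ r\ge0,\ 1-|I|\le r<1\}$; write $\omega(E)=\int_E\omega\,dA$.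 **Theorem.** Let $0<p\le q<\infty$, let $\omega\in\mathcal I\cup\mathcal R$, and let $\mu$ be a positive Borel measure on $\mathbb D$. (i) $\mu$ is a $q$-Carleson measure for $A^p_\omega$, i.e. the identity operator $I_d:A^p_\omega\to L^q(\mu)$ is well defined and bounded, if and only if $$\sup_{I\subset\mathbb T}\frac{\mu(S(I))}{\omega(S(I))^{q/p}}<\infty .$$ Moreover, there is a constant $C=C(p,q,\omega)>0$, independent of $\mu$, such that every $q$-Carleson measure $\mu$ for $A^p_\omega$ satisfies $$C^{-1}\sup_{I\subset\mathbb T}\frac{\mu(S(I))}{\omega(S(I))^{q/p}}\le\|I_d\|^q_{(A^p_\omega,L^q(\mu))}\le C\sup_{I\subset\mathbb T}\frac{\mu(S(I))}{\omega(S(I))^{q/p}},$$ where $\|I_d\|_{(A^p_\omega,L^q(\mu))}=\sup\{\|f\|_{L^q(\mu)}:\|f\|_{A^p_\omega}\le1\}$. (ii) If $I_d:A^p_\omega\to L^q(\mu)$ is compact, i.e. every bounded sequence in $A^p_\omega$ has a subsequence that converges in $L^q(\mu)$, then $$\lim_{|I|\to0}\frac{\mu(S(I))}{\omega(S(I))^{q/p}}=0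 .$$ Conversely, if this limit relation holds and $\mu$ is finite on the compact subsets of $\mathbb D$, then $I_d:A^p_\omega\to L^q(\mu)$ is compact. -/

import Mathlib

open MeasureTheory Filter Topology Set
open scoped ENNReal NNReal

namespace BergmanCarleson

noncomputable section

/-- The open unit disc of the complex plane. -/
def disc : Set ℂ := Metric.ball (0 : ℂ) 1

/-- The normalized area measure `dA = dx dy / π` on the unit disc (extended by zero to `ℂ`). -/
def areaMeasure : Measure ℂ := ENNReal.ofReal (Real.pi⁻¹) • (volume.restrict disc)

/-- A weight: a positive function on the unit disc, integrable with respect to area.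
Values outside the disc are irrelevant. -/
def IsWeight (ω : ℂ → ℝ) : Prop :=
  (∀ z ∈ disc, 0 < ω z) ∧ Integrable ω areaMeasure

/-- A radial weight: `ω z = ω |z|` on the disc. -/
def IsRadialWeight (ω : ℂ → ℝ) : Prop :=
  IsWeight ω ∧ ∀ z ∈ disc, ω z = ω ((‖z‖ : ℝ) : ℂ)

/-- The distortion function `ψ_ω(r) = (1 / ω(r)) ∫_r^1 ω(s) ds` of a radial weight. -/
def distortion (ω : ℂ → ℝ) (r : ℝ) : ℝ :=
  (1 / ω (r : ℂ)) * ∫ s in r..1, ω (s : ℂ)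

/-- Regular weights: continuous radial weights with `ψ_ω(r) ≍ 1 - r` on `[0,1)`. -/
def IsRegular (ω : ℂ → ℝ) : Prop :=
  IsRadialWeight ω ∧ ContinuousOn ω disc ∧
    ∃ C₁ C₂ : ℝ, 0 < C₁ ∧ 0 < C₂ ∧ ∀ r : ℝ, 0 ≤ r → r < 1 →
      C₁ * (1 - r) ≤ distortion ω r ∧ distortion ω r ≤ C₂ * (1 - r)

/-- Rapidly increasing weights: continuous radial weights with
`ψ_ω(r) / (1 - r) → ∞` as `r → 1⁻`. -/
def IsRapidlyIncreasing (ω : ℂ → ℝ) : Prop :=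
  IsRadialWeight ω ∧ ContinuousOn ω disc ∧
    Tendsto (fun r : ℝ => distortion ω r / (1 - r)) (𝓝[<] 1) atTop

/-- The (quasi-)norm `‖f‖ = (∫_𝔻 |f|^p ω dA)^(1/p)`, with value `∞` allowed. -/
def bergmanNorm (p : ℝ) (ω : ℂ → ℝ) (f : ℂ → ℂ) : ℝ≥0∞ :=
  (∫⁻ z, ‖f z‖ₑ ^ p * ENNReal.ofReal (ω z) ∂areaMeasure) ^ (1 / p)

/-- The weighted Bergman space `A^p_ω`: functions analytic in the disc with finite norm.
Values outside the disc are irrelevant. -/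
def bergmanSpace (p : ℝ) (ω : ℂ → ℝ) : Set (ℂ → ℂ) :=
  {f | DifferentiableOn ℂ f disc ∧ bergmanNorm p ω f < ∞}

/-- `J ⊆ ℝ` (open, closed or half-open) is an interval of positive length at most `2π`.
The intervals `I ⊆ 𝕋` are exactly the images `I = {e^{it} : t ∈ J}` of such `J`,
and then the Lebesgue measure `|I|` is the length of `J`. -/
def IsArc (J : Set ℝ) : Prop :=
  J.OrdConnected ∧ 0 < volume J ∧ volume J ≤ ENNReal.ofReal (2 * Real.pi)

/-- The length `|I|` of the interval `I = {e^{it} : t ∈ J}`. -/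
def arcLength (J : Set ℝ) : ℝ := (volume J).toReal

/-- The Carleson square `S(I) = {r e^{it} ∈ 𝔻 : e^{it} ∈ I, 1 - |I| ≤ r < 1}`
over the interval `I = {e^{it} : t ∈ J}`. -/
def carlesonSquare (J : Set ℝ) : Set ℂ :=
  {z | ∃ t ∈ J, ∃ r : ℝ, 0 ≤ r ∧ 1 - arcLength J ≤ r ∧ r < 1 ∧
    z = (r : ℂ) * Complex.exp (t * Complex.I)}

/-- `ω(E) = ∫_E ω dA`. -/
def weightMass (ω : ℂ → ℝ) (E : Set ℂ) : ℝ≥0∞ :=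
  ∫⁻ z in E, ENNReal.ofReal (ω z) ∂areaMeasure

/-- The ratio `μ(S(I)) / ω(S(I))^(q/p)`. -/
def carlesonRatio (p q : ℝ) (ω : ℂ → ℝ) (μ : Measure ℂ) (J : Set ℝ) : ℝ≥0∞ :=
  μ (carlesonSquare J) / weightMass ω (carlesonSquare J) ^ (q / p)

/-- The supremum of the ratio `μ(S(I)) / ω(S(I))^(q/p)` over all intervals `I ⊆ 𝕋`. -/
def carlesonSup (p q : ℝ) (ω : ℂ → ℝ) (μ : Measure ℂ) : ℝ≥0∞ :=
  ⨆ (J : Set ℝ) (_ : IsArc J), carlesonRatio p q ω μ J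

/-- `μ(S(I)) / ω(S(I))^(q/p) → 0` as `|I| → 0`. -/
def IsVanishing (p q : ℝ) (ω : ℂ → ℝ) (μ : Measure ℂ) : Prop :=
  ∀ ε : ℝ≥0∞, 0 < ε → ∃ δ : ℝ, 0 < δ ∧
    ∀ J : Set ℝ, IsArc J → arcLength J < δ → carlesonRatio p q ω μ J ≤ ε

/-- `μ` is a `q`-Carleson measure for `A^p_ω`: the identity operator
`A^p_ω → L^q(μ)` is well defined and bounded. -/
def IsCarlesonMeasure (p q : ℝ) (ω : ℂ → ℝ) (μ : Measure ℂ) : Prop :=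
  ∃ C : ℝ≥0, ∀ f ∈ bergmanSpace p ω,
    MemLp f (ENNReal.ofReal q) μ ∧ eLpNorm f (ENNReal.ofReal q) μ ≤ C * bergmanNorm p ω f

/-- The norm of the identity operator `A^p_ω → L^q(μ)`: the supremum of `‖f‖_{L^q(μ)}` over the
closed unit ball of `A^p_ω`. -/
def embeddingNorm (p q : ℝ) (ω : ℂ → ℝ) (μ : Measure ℂ) : ℝ≥0∞ :=
  ⨆ (f : ℂ → ℂ) (_ : f ∈ bergmanSpace p ω) (_ : bergmanNorm p ω f ≤ 1),
    eLpNorm f (ENNReal.ofReal q) μ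

/-- The identity operator `A^p_ω → L^q(μ)` is (well defined and) compact: every bounded sequence
of `A^p_ω` has a subsequence that converges in `L^q(μ)`. -/
def IsCompactEmbedding (p q : ℝ) (ω : ℂ → ℝ) (μ : Measure ℂ) : Prop :=
  (∀ f ∈ bergmanSpace p ω, MemLp f (ENNReal.ofReal q) μ) ∧
  ∀ f : ℕ → ℂ → ℂ, (∀ n, f n ∈ bergmanSpace p ω) →
    (∃ B : ℝ≥0, ∀ n, bergmanNorm p ω (f n) ≤ B) →
    ∃ (φ : ℕ → ℕ) (g : ℂ → ℂ), StrictMono φ ∧ MemLp g (ENNReal.ofReal q) μ ∧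
      Tendsto (fun k => eLpNorm (f (φ k) - g) (ENNReal.ofReal q) μ) atTop (𝓝 0)

end

end BergmanCarleson

namespace BergmanCarleson

/-! Both weight classes enter only through the bound `ψ_ω(s) ≥ c (1 - s)` near `s = 1`. It makes `(1
- s)^(-n) ∫_s^1 ω` nondecreasing there for large `n`, so the tail integrals are doubling
(`exists_tail_doubling`). Consequently the weighted mass of a Carleson square of side `ρ` is
comparable to `boxMass ω ρ`, and balls of radius `ρ` centred on the unit circle have at most a
multiple of that mass. The Carleson condition can thus be tested on boundary balls.

Sufficiency is a maximal function argument. For every `α > 0`, `|f|^α` lies below its Poisson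
integral; averaging this over circles against `ω` gives a global growth estimate. Applying it to `f`
times a high power of the analytic kernel `ℓ / (1 + ℓ - ζ/ξ)`, which has size about 1 near `ξ` and
decays geometrically over dyadic shells, localises it: `|f(z)|^α` is at most a constant times the
largest of the normalised integrals of `|f|^α` over the dyadic boundary balls through `z`
(`exists_enorm_rpow_le`). Vitali's covering lemma bounds the `μ`-measure of the level sets of this
maximal function; here `q/p ≥ 1` is needed to sum the powers `x^(q/p)` over disjoint balls. With `α
= p/2`, truncating at height comparable to the level and integrating in the level, as in
Marcinkiewicz interpolation, yields the strong estimate (`exists_lintegral_rpow_le`).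

Necessity comes from testing on normalised powers of the same kernel, which lie in the unit ball of
`A^p_ω` and are large on the square (`carlesonRatio_le_eLpNorm_testFun`).

For compactness, the test functions tend to zero pointwise as the arcs shrink, so a limit in
`L^q(μ)` along a subsequence must vanish, and the ratios vanish with it. Conversely, Montel's
theorem and Fatou's lemma supply a pointwise limit in `A^p_ω`. The differences are controlled near
the circle by the boundedness estimate with a small Carleson constant, and on a compact disc by
dominated convergence. -/

/-! ### Poisson–Jensen and the Poisson majorant of `|f|^α`. -/

open Complex in
theorem one_le_norm_canonicalFactor {R : ℝ} {u w : ℂ} (hR : 0 < R)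
    (hu : ‖u‖ < R) (hw : ‖w‖ < R) (huw : w ≠ u) : 1 ≤ ‖canonicalFactor R u w‖ := by
  have h0 : 0 < ‖w - u‖ := norm_pos_iff.2 (sub_ne_zero.2 huw)
  rw [canonicalFactor_apply, norm_div, norm_mul, Complex.norm_real, Real.norm_of_nonneg hR.le,
    one_le_div (by positivity)]
  refine le_of_sq_le_sq ?_ (norm_nonneg _)
  rw [mul_pow, Complex.sq_norm, Complex.sq_norm]
  have h1 : ‖u‖ ^ 2 = u.re * u.re + u.im * u.im := by rw [Complex.sq_norm, Complex.normSq_apply]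
  have h2 : ‖w‖ ^ 2 = w.re * w.re + w.im * w.im := by rw [Complex.sq_norm, Complex.normSq_apply]
  -- This product is exactly `|R² - ū w|² - R² |w - u|²`.
  have h3 : 0 ≤ (R ^ 2 - ‖u‖ ^ 2) * (R ^ 2 - ‖w‖ ^ 2) := by
    apply mul_nonneg <;> rw [sub_nonneg] <;> gcongr
  rw [h1, h2] at h3
  simp only [Complex.normSq_apply, Complex.sub_re, Complex.sub_im, Complex.mul_re, Complex.mul_im,
    Complex.conj_re, Complex.conj_im, ← Complex.ofReal_pow, Complex.ofReal_re, Complex.ofReal_im]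
  nlinarith [h3]

open Metric Real in
theorem circleIntegrable_poisson_smul {g : ℂ → ℝ} {R : ℝ} {w : ℂ} (hw : w ∈ ball (0 : ℂ) R)
    (hg : CircleIntegrable g 0 R) :
    CircleIntegrable ((Complex.re ∘ herglotzRieszKernel 0 w) • g) 0 R := by
  have hc : Continuous fun θ => (herglotzRieszKernel 0 w (circleMap 0 R θ)).re :=
    Complex.continuous_re.comp <| continuousOn_univ.1 <|
      (continuousOn_herglotzRieszKernel_sphere hw).comp (continuous_circleMap 0 R).continuousOn
        fun θ _ => circleMap_mem_sphere' 0 R θ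
  exact IntervalIntegrable.continuousOn_mul hg hc.continuousOn

open Metric Real in
/-- Poisson–Jensen inequality: `log ‖f‖` is dominated by its Poisson integral. -/
theorem log_norm_le_circleAverage_poisson {f : ℂ → ℂ} {R : ℝ} {w : ℂ}
    (hf : AnalyticOnNhd ℂ f (closedBall 0 R)) (hw : w ∈ ball (0 : ℂ) R) (hfw : f w ≠ 0) :
    Real.log ‖f w‖ ≤
      circleAverage ((Complex.re ∘ herglotzRieszKernel 0 w) • fun z => Real.log ‖f z‖) 0 R := by
  have hR : 0 < R := pos_of_mem_ball hw
  have hwc : w ∈ closedBall (0 : ℂ) R := ball_subset_closedBall hw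
  have hpre : IsPreconnected (closedBall (0 : ℂ) R) := (convex_closedBall 0 R).isPreconnected
  have hord0 : ∀ z ∈ closedBall (0 : ℂ) R, f z ≠ 0 → meromorphicOrderAt f z = 0 := by
    intro z hz hfz
    rw [(hf z hz).meromorphicOrderAt_eq, (hf z hz).analyticOrderAt_eq_zero.mpr hfz]; rfl
  have hord : ∀ u : closedBall (0 : ℂ) R, meromorphicOrderAt f u ≠ ⊤ :=
    (hf.meromorphicOn.exists_meromorphicOrderAt_ne_top_iff_forall
      ⟨⟨w, hwc⟩, hpre⟩).1 ⟨⟨w, hwc⟩, by simp [hord0 w hwc hfw]⟩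
  -- `h` is `f` with all zeros removed: interior ones by canonical factors, those on the circle by
  -- linear factors. Hence `log ‖h‖` is harmonic and reproduced by the Poisson kernel.
  obtain ⟨h, D⟩ := hf.meromorphicOn.exists_ecanonicalDecomp hord
  set P : ℂ → ℝ := Complex.re ∘ herglotzRieszKernel 0 w with hP
  set d := MeromorphicOn.divisor f (sphere 0 R) with hd
  set b := MeromorphicOn.divisor f (ball 0 R) with hb
  have hsph : sphere (0 : ℂ) R ⊆ closedBall 0 R := sphere_subset_closedBall
  have hdfin : (Function.support d).Finite := d.finiteSupport (isCompact_sphere 0 R)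
  have hkey : ∀ z ∈ closedBall (0 : ℂ) R, f z ≠ 0 → Real.log ‖h z‖ =
      ((∑ᶠ i, b i * Real.log ‖Complex.canonicalFactor R i z‖) - (∑ᶠ i, d i * Real.log ‖z - i‖))
        + Real.log ‖f z‖ := by
    intro z hz hfz
    have := D.log_norm_eq hz (hord0 z hz hfz) hR
    rwa [(hf z hz).meromorphicTrailingCoeffAt_of_ne_zero hfz] at this
  have hsum : ∀ z, (∑ᶠ i, (d i : ℝ) * Real.log ‖z - i‖) =
      ∑ i ∈ hdfin.toFinset, (d i : ℝ) * Real.log ‖z - i‖ := by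
    intro z
    refine finsum_eq_sum_of_support_subset _ fun i => ?_
    contrapose
    simp +contextual
  have hint1 : CircleIntegrable (fun z => Real.log ‖h z‖) 0 R :=
    ((D.analyticOnNhd.mono (by rw [abs_of_pos hR]; exact hsph)).meromorphicOn).circleIntegrable_log_norm
  have hint2 : ∀ i : ℂ, CircleIntegrable (fun z => Real.log ‖z - i‖) 0 R := fun i =>
    MeromorphicOn.circleIntegrable_log_norm (f := fun z => z - i) (by intro; fun_prop)
  have hcod : {z : ℂ | f z ≠ 0} ∈ codiscreteWithin (sphere (0 : ℂ) |R|) := by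
    rw [abs_of_pos hR]
    exact codiscreteWithin_mono hsph
      (hf.preimage_zero_mem_codiscreteWithin hfw hwc ⟨⟨w, hwc⟩, hpre⟩)
  have hcongr : (P • fun z => Real.log ‖f z‖) =ᶠ[codiscreteWithin (sphere (0 : ℂ) |R|)]
      ((P • fun z => Real.log ‖h z‖) +
        ∑ i ∈ hdfin.toFinset, (d i : ℝ) • (P • fun z => Real.log ‖z - i‖)) := by
    filter_upwards [hcod, self_mem_codiscreteWithin _] with z hz hzs
    rw [abs_of_pos hR] at hzs
    -- Interior zeros are invisible on the circle; at `w` they contribute with a favourable sign,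
    -- and this is the only loss in the inequality.
    have hz0 : (∑ᶠ i, (b i : ℝ) * Real.log ‖Complex.canonicalFactor R i z‖) = 0 := by
      refine finsum_eq_zero_of_forall_eq_zero fun i => ?_
      by_cases hi : i ∈ ball (0 : ℂ) R
      · rw [Complex.norm_canonicalFactor_eval_circle_eq_one hi hzs, Real.log_one, mul_zero]
      · rw [b.apply_eq_zero_of_notMem hi, Int.cast_zero, zero_mul]
    have h1 := hkey z (hsph hzs) hz
    rw [hz0, hsum] at h1
    simp only [Pi.add_apply, Finset.sum_apply, Pi.smul_apply', Pi.smul_apply, smul_eq_mul, Pi.mul_apply]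
    rw [h1]
    have : ∀ i, (d i : ℝ) * (P z * Real.log ‖z - i‖) = P z * (d i * Real.log ‖z - i‖) := by
      intro i; ring
    simp_rw [this, ← Finset.mul_sum]
    ring
  rw [circleAverage_congr_codiscreteWithin hcongr hR.ne', circleAverage_add
    (circleIntegrable_poisson_smul hw hint1)
    (CircleIntegrable.sum _ fun i _ => (circleIntegrable_poisson_smul hw (hint2 i)).const_smul),
    circleAverage_sum fun i _ => (circleIntegrable_poisson_smul hw (hint2 i)).const_smul]
  have hA : circleAverage (P • fun z => Real.log ‖h z‖) 0 R = Real.log ‖h w‖ :=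
    InnerProductSpace.HarmonicOnNhd.circleAverage_re_herglotzRieszKernel_smul
      (fun z hz => (D.analyticOnNhd z hz).harmonicAt_log_norm (D.ne_zero z hz)) hw
  have hB : ∀ i ∈ hdfin.toFinset, circleAverage ((d i : ℝ) • (P • fun z => Real.log ‖z - i‖)) 0 R =
      d i * Real.log ‖w - i‖ := by
    intro i hi
    rw [circleAverage_smul, smul_eq_mul]
    congr 1
    have : i ∈ sphere (0 : ℂ) R := d.supportWithinDomain (by simpa using hi)
    exact circleAverage_re_herglotzRieszKernel_mul_log this hw
  rw [hA, Finset.sum_congr rfl hB, hkey w hwc hfw, hsum]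
  have hnn : 0 ≤ ∑ᶠ i, (b i : ℝ) * Real.log ‖Complex.canonicalFactor R i w‖ := by
    refine finsum_nonneg fun i => ?_
    by_cases hi : i ∈ ball (0 : ℂ) R
    · have hb0 : (0 : ℝ) ≤ b i := by
        exact_mod_cast (MeromorphicOn.AnalyticOnNhd.divisor_nonneg
          (hf.mono ball_subset_closedBall)) i
      -- At its pole the canonical factor takes the value 0 by the division convention, and the
      -- logarithm of 0 is 0.
      by_cases hiw : w = i
      · subst hiw; simp
      · exact mul_nonneg hb0 (Real.log_nonneg (one_le_norm_canonicalFactor hR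
          (by simpa using hi) (by simpa using hw) hiw))
    · rw [b.apply_eq_zero_of_notMem hi, Int.cast_zero, zero_mul]
  linarith

open Metric Real in
/-- Poisson majorization of `‖f‖ ^ α`, with the Poisson kernel replaced by its supremum. -/
theorem norm_rpow_le_circleAverage {f : ℂ → ℂ} {R α : ℝ} {w : ℂ} (hα : 0 < α)
    (hf : AnalyticOnNhd ℂ f (closedBall 0 R)) (hw : w ∈ ball (0 : ℂ) R) :
    ‖f w‖ ^ α ≤ (R + ‖w‖) / (R - ‖w‖) * circleAverage (fun z => ‖f z‖ ^ α) 0 R := by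
  have hR : 0 < R := pos_of_mem_ball hw
  have hwR : ‖w‖ < R := by simpa using hw
  have hwc : w ∈ closedBall (0 : ℂ) R := ball_subset_closedBall hw
  have hpre : IsPreconnected (closedBall (0 : ℂ) R) := (convex_closedBall 0 R).isPreconnected
  have hsph : sphere (0 : ℂ) R ⊆ closedBall 0 R := sphere_subset_closedBall
  have hk0 : 0 ≤ (R + ‖w‖) / (R - ‖w‖) :=
    div_nonneg (by positivity) (by linarith)
  by_cases hfw : f w = 0
  · rw [hfw, norm_zero, Real.zero_rpow hα.ne']
    exact mul_nonneg hk0 (circleAverage_nonneg_of_nonneg fun z _ => by positivity)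
  set P : ℂ → ℝ := Complex.re ∘ herglotzRieszKernel 0 w with hP
  have hPle : ∀ z ∈ sphere (0 : ℂ) R, P z ≤ (R + ‖w‖) / (R - ‖w‖) := fun z hz => by
    simpa [hP, herglotzRieszKernel_def] using re_herglotzRieszKernel_le hz hw
  have hPpos : ∀ z ∈ sphere (0 : ℂ) R, 0 < P z := fun z hz => by
    refine lt_of_lt_of_le ?_ (le_re_herglotzRieszKernel hz hw)
    rw [sub_zero]
    exact div_pos (by linarith) (by positivity)
  have hg : CircleIntegrable (fun z => ‖f z‖ ^ α) 0 R := by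
    refine ContinuousOn.circleIntegrable hR.le ?_
    exact ((hf.continuousOn.mono hsph).norm).rpow_const fun _ _ => Or.inr hα.le
  have hPg := circleIntegrable_poisson_smul hw hg
  set A := circleAverage (P • fun z => ‖f z‖ ^ α) 0 R with hA
  have hAle : A ≤ (R + ‖w‖) / (R - ‖w‖) * circleAverage (fun z => ‖f z‖ ^ α) 0 R := by
    rw [← smul_eq_mul, ← circleAverage_smul]
    refine circleAverage_mono hPg hg.const_smul fun z hz => ?_
    rw [abs_of_pos hR] at hz
    exact mul_le_mul_of_nonneg_right (hPle z hz) (by positivity)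
  refine le_trans ?_ hAle
  have hlog := log_norm_le_circleAverage_poisson hf hw hfw
  have hcod : {z : ℂ | f z ≠ 0} ∈ codiscreteWithin (sphere (0 : ℂ) |R|) := by
    rw [abs_of_pos hR]
    exact codiscreteWithin_mono hsph
      (hf.preimage_zero_mem_codiscreteWithin hfw hwc ⟨⟨w, hwc⟩, hpre⟩)
  have hL : CircleIntegrable (fun z => Real.log ‖f z‖) 0 R :=
    ((hf.mono (by rw [abs_of_pos hR]; exact hsph)).meromorphicOn).circleIntegrable_log_norm
  have hone : CircleIntegrable (fun _ : ℂ => (1 : ℝ)) 0 R := circleIntegrable_const _ _ _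
  have hP1 : circleAverage (P • fun _ : ℂ => (1 : ℝ)) 0 R = 1 :=
    InnerProductSpace.HarmonicOnNhd.circleAverage_re_herglotzRieszKernel_smul
      (f := fun _ => (1 : ℝ)) (fun _ _ => InnerProductSpace.harmonicAt_const 1) hw
  have hc : 0 < ‖f w‖ ^ α := Real.rpow_pos_of_pos (norm_pos_iff.2 hfw) _
  set c := ‖f w‖ ^ α with hcdef
  have hlogc : Real.log c = α * Real.log ‖f w‖ := Real.log_rpow (norm_pos_iff.2 hfw) _
  -- Jensen's inequality by hand: `T` is `α⁻¹` times the tangent line of `log` at `c = ‖f w‖ ^ α`,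
  -- evaluated at `‖f z‖ ^ α`.
  set T : ℂ → ℝ := fun z => α⁻¹ * ((Real.log c - 1) + c⁻¹ * ‖f z‖ ^ α) with hT
  have hPT : P • T = (α⁻¹ * (Real.log c - 1)) • (P • fun _ : ℂ => (1 : ℝ)) +
      (α⁻¹ * c⁻¹) • (P • fun z => ‖f z‖ ^ α) := by
    funext z
    simp only [hT, Pi.add_apply, Pi.smul_apply', Pi.smul_apply, smul_eq_mul, Pi.mul_apply]
    ring
  have hi1 := (circleIntegrable_poisson_smul hw hone).const_smul (a := α⁻¹ * (Real.log c - 1))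
  have hi2 := hPg.const_smul (a := α⁻¹ * c⁻¹)
  have hTi : CircleIntegrable (P • T) 0 R := by
    rw [hPT]; exact hi1.add hi2
  have hTavg : circleAverage (P • T) 0 R = α⁻¹ * (Real.log c - 1) + α⁻¹ * c⁻¹ * A := by
    rw [hPT, circleAverage_add hi1 hi2, circleAverage_smul, circleAverage_smul, hP1, smul_eq_mul,
      smul_eq_mul, mul_one]
  have hlogT : ∀ z, f z ≠ 0 → Real.log ‖f z‖ ≤ T z := by
    intro z hz
    have h1 := Real.log_le_sub_one_of_pos (x := c⁻¹ * ‖f z‖ ^ α)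
      (mul_pos (inv_pos.2 hc) (Real.rpow_pos_of_pos (norm_pos_iff.2 hz) _))
    rw [Real.log_mul (inv_pos.2 hc).ne' (Real.rpow_pos_of_pos (norm_pos_iff.2 hz) _).ne',
      Real.log_inv, Real.log_rpow (norm_pos_iff.2 hz)] at h1
    simp only [hT]
    rw [← div_eq_inv_mul, le_div_iff₀ hα]
    linarith
  -- At zeros of `f` the convention `log 0 = 0` can break the bound by `T`; taking the minimum
  -- restores it everywhere and changes the function only on a discrete set.
  have hcongr : (P • fun z => Real.log ‖f z‖) =ᶠ[codiscreteWithin (sphere (0 : ℂ) |R|)]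
      (P • fun z => min (Real.log ‖f z‖) (T z)) := by
    filter_upwards [hcod] with z hz
    simp only [Pi.smul_apply', smul_eq_mul, min_eq_left (hlogT z hz)]
  rw [circleAverage_congr_codiscreteWithin hcongr hR.ne'] at hlog
  have hmono := circleAverage_mono
    ((circleIntegrable_poisson_smul hw hL).congr_codiscreteWithin hcongr) hTi fun z hz => by
      rw [abs_of_pos hR] at hz
      exact mul_le_mul_of_nonneg_left (min_le_right _ _) (hPpos z hz).le
  have hfin := hlog.trans hmono
  rw [hTavg, hlogc] at hfin
  have h2 : α * Real.log ‖f w‖ ≤ α * Real.log ‖f w‖ - 1 + c⁻¹ * A := by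
    have := mul_le_mul_of_nonneg_left hfin hα.le
    rw [mul_add, ← mul_assoc, ← mul_assoc, ← mul_assoc, mul_inv_cancel₀ hα.ne', one_mul, one_mul]
      at this
    exact this
  have h3 : 1 ≤ c⁻¹ * A := by linarith
  rwa [← div_eq_inv_mul, one_le_div hc] at h3

/-! ### The weighted measure in polar coordinates. -/

/-- The area measure weighted by `ω`. -/
noncomputable def weightedMeasure (ω : ℂ → ℝ) : Measure ℂ :=
  areaMeasure.withDensity fun z => ENNReal.ofReal (ω z)

/-- The radial profile of a weight, extended by zero. -/
noncomputable def profile (ω : ℂ → ℝ) (r : ℝ) : ℝ≥0∞ :=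
  (Ico (0 : ℝ) 1).indicator (fun r => ENNReal.ofReal (ω (r : ℂ))) r

/-- The mass of the annulus `1 - x ≤ |z| < 1`, up to a constant factor. -/
noncomputable def tailMass (ω : ℂ → ℝ) (x : ℝ) : ℝ≥0∞ :=
  ∫⁻ r in Ioo (0 : ℝ) 1 ∩ Ici (1 - x), profile ω r * ENNReal.ofReal r

theorem isOpen_disc : IsOpen disc := Metric.isOpen_ball

theorem mem_disc {z : ℂ} : z ∈ disc ↔ ‖z‖ < 1 := by simp [disc]

theorem measurableSet_disc : MeasurableSet disc := isOpen_disc.measurableSet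

theorem weightMass_eq (ω : ℂ → ℝ) (E : Set ℂ) : weightMass ω E = weightedMeasure ω E := by
  have : SFinite areaMeasure := by unfold areaMeasure; infer_instance
  rw [weightMass, weightedMeasure, withDensity_apply']

theorem measurable_profile {ω : ℂ → ℝ} (hc : ContinuousOn ω disc) : Measurable (profile ω) := by
  have : ContinuousOn (fun r : ℝ => ENNReal.ofReal (ω (r : ℂ))) (Ico (0 : ℝ) 1) := by
    refine ENNReal.continuous_ofReal.comp_continuousOn (hc.comp
      Complex.continuous_ofReal.continuousOn fun r hr => ?_)
    rw [mem_disc, Complex.norm_real, Real.norm_of_nonneg hr.1]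
    exact hr.2
  have h0 : Measurable ((Ico (0 : ℝ) 1).piecewise (fun r : ℝ => ENNReal.ofReal (ω (r : ℂ)))
      0) := this.measurable_piecewise continuousOn_const measurableSet_Ico
  rwa [piecewise_eq_indicator] at h0

theorem indicator_one_le_of_imp {α β : Type*} {s : Set α} {t : Set β} {x : α} {y : β}
    (h : x ∈ s → y ∈ t) :
    s.indicator (1 : α → ℝ≥0∞) x ≤ t.indicator (1 : β → ℝ≥0∞) y := by
  by_cases hx : x ∈ s
  · rw [indicator_of_mem hx, indicator_of_mem (h hx)]; rfl
  · rw [indicator_of_notMem hx]; exact zero_le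

/-- The density `profile ω ‖z‖` is globally measurable and finite, whereas `ω` is arbitrary off the
disc. Finiteness is what allows a non-measurable `G`. -/
theorem lintegral_weightedMeasure {ω : ℂ → ℝ} (hω : IsRadialWeight ω) (hc : ContinuousOn ω disc)
    (G : ℂ → ℝ≥0∞) :
    ∫⁻ z, G z ∂weightedMeasure ω =
      ENNReal.ofReal (Real.pi⁻¹) * ∫⁻ z : ℂ, profile ω ‖z‖ * G z := by
  have hm : Measurable fun z : ℂ => profile ω ‖z‖ := (measurable_profile hc).comp measurable_norm
  have hfin : ∀ z : ℂ, profile ω ‖z‖ < ∞ := fun z => by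
    unfold profile indicator
    split_ifs <;> simp
  have h1 : weightedMeasure ω =
      (ENNReal.ofReal (Real.pi⁻¹) • volume).withDensity fun z : ℂ => profile ω ‖z‖ := by
    have h2 : (fun z : ℂ => profile ω ‖z‖) =
        disc.indicator fun z => ENNReal.ofReal (ω z) := by
      funext z
      by_cases hz : z ∈ disc
      · have hmem : ‖z‖ ∈ Ico (0 : ℝ) 1 := ⟨norm_nonneg z, mem_disc.1 hz⟩
        rw [indicator_of_mem hz, profile, indicator_of_mem hmem, ← hω.2 z hz]
      · rw [indicator_of_notMem hz, profile, indicator_of_notMem]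
        exact fun h => hz (mem_disc.2 h.2)
    rw [h2, withDensity_indicator measurableSet_disc, weightedMeasure, areaMeasure,
      Measure.restrict_smul]
  rw [h1, lintegral_withDensity_eq_lintegral_mul_non_measurable _ hm (ae_of_all _ hfin),
    lintegral_smul_measure, smul_eq_mul]
  rfl

/-- Reduces estimates at a general boundary point to the point 1, where the angle range `(-π, π)` is
centred. -/
theorem lintegral_weightedMeasure_rotate {ω : ℂ → ℝ} (hω : IsRadialWeight ω)
    (hc : ContinuousOn ω disc) (G : ℂ → ℝ≥0∞) {u : ℂ} (hu : ‖u‖ = 1) :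
    ∫⁻ z, G (u * z) ∂weightedMeasure ω = ∫⁻ z, G z ∂weightedMeasure ω := by
  rw [lintegral_weightedMeasure hω hc, lintegral_weightedMeasure hω hc]
  congr 1
  obtain ⟨c, hcu⟩ : ∃ c : Circle, (c : ℂ) = u := by
    refine ⟨Circle.exp u.arg, ?_⟩
    have := Complex.norm_mul_exp_arg_mul_I u
    rwa [hu, Complex.ofReal_one, one_mul] at this
  have := (rotation c).measurePreserving.lintegral_comp_emb
    (rotation c).toHomeomorph.measurableEmbedding (fun z => profile ω ‖z‖ * G z)
  rw [← this]
  refine lintegral_congr fun z => ?_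
  have h1 : rotation c z = u * z := by rw [rotation_apply, hcu]
  rw [h1, norm_mul, hu, one_mul]

theorem lintegral_weightedMeasure_polar {ω : ℂ → ℝ} (hω : IsRadialWeight ω)
    (hc : ContinuousOn ω disc) {G : ℂ → ℝ≥0∞} (hG : Measurable G) :
    ∫⁻ z, G z ∂weightedMeasure ω =
      ENNReal.ofReal (Real.pi⁻¹) * ∫⁻ r in Ioo (0 : ℝ) 1, profile ω r * ENNReal.ofReal r *
        ∫⁻ θ in Ioo (-Real.pi) Real.pi, G (r * Complex.exp (θ * Complex.I)) := by
  rw [lintegral_weightedMeasure hω hc, ← Complex.lintegral_comp_polarCoord_symm]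
  congr 1
  have hsymm : ∀ p : ℝ × ℝ, Complex.polarCoord.symm p = p.1 * Complex.exp (p.2 * Complex.I) := by
    intro p
    rw [Complex.polarCoord_symm_apply, Complex.exp_mul_I]
    push_cast
    rfl
  have htarget : Complex.polarCoord.target = Ioi (0 : ℝ) ×ˢ Ioo (-Real.pi) Real.pi := rfl
  have hmeas : Measurable fun p : ℝ × ℝ => profile ω p.1 * ENNReal.ofReal p.1 *
      G (p.1 * Complex.exp (p.2 * Complex.I)) := by
    refine (((measurable_profile hc).comp measurable_fst).mul
      (ENNReal.measurable_ofReal.comp measurable_fst)).mul (hG.comp ?_)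
    fun_prop
  have hcongr : ∫⁻ p in Complex.polarCoord.target, ENNReal.ofReal p.1 •
      (profile ω ‖Complex.polarCoord.symm p‖ * G (Complex.polarCoord.symm p)) =
      ∫⁻ p in Ioi (0 : ℝ) ×ˢ Ioo (-Real.pi) Real.pi, profile ω p.1 * ENNReal.ofReal p.1 *
      G (p.1 * Complex.exp (p.2 * Complex.I)) := by
    rw [htarget]
    refine setLIntegral_congr_fun (measurableSet_Ioi.prod measurableSet_Ioo) fun p hp => ?_
    have hp1 : 0 < p.1 := hp.1
    have : ‖(p.1 : ℂ) * Complex.exp (p.2 * Complex.I)‖ = p.1 := by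
      rw [norm_mul, Complex.norm_exp_ofReal_mul_I, mul_one, Complex.norm_real,
        Real.norm_of_nonneg hp1.le]
    simp only [hsymm, this, smul_eq_mul]
    ring
  refine hcongr.trans ?_
  rw [Measure.volume_eq_prod, ← Measure.prod_restrict, lintegral_prod _ hmeas.aemeasurable]
  have h1 : ∀ r : ℝ, ∫⁻ θ in Ioo (-Real.pi) Real.pi, profile ω r * ENNReal.ofReal r *
      G (r * Complex.exp (θ * Complex.I)) = profile ω r * ENNReal.ofReal r *
      ∫⁻ θ in Ioo (-Real.pi) Real.pi, G (r * Complex.exp (θ * Complex.I)) := by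
    intro r
    rw [lintegral_const_mul]
    exact hG.comp (by fun_prop)
  simp only [h1]
  have hsub : Ioo (0 : ℝ) 1 ∩ Ioi 0 = Ioo 0 1 := inter_eq_left.2 fun r hr => hr.1
  rw [← hsub, ← setLIntegral_indicator measurableSet_Ioo]
  refine setLIntegral_congr_fun measurableSet_Ioi fun r hr => ?_
  by_cases hr1 : r ∈ Ioo (0 : ℝ) 1
  · rw [indicator_of_mem hr1]
  · have : profile ω r = 0 := indicator_of_notMem (fun h => hr1 ⟨hr, h.2⟩) _
    rw [indicator_of_notMem hr1, this, zero_mul, zero_mul]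

/-! ### Boundary balls versus Carleson squares. -/

/-- A chord of the closed disc dominates the angle it subtends. -/
theorem abs_angle_le_norm_one_sub {r δ : ℝ} (hr : 0 ≤ r) (hδ : |δ| ≤ Real.pi) :
    |δ| ≤ Real.pi * ‖1 - r * Complex.exp (δ * Complex.I)‖ := by
  set e := Complex.exp (δ * Complex.I) with he
  have hne : ‖e‖ = 1 := Complex.norm_exp_ofReal_mul_I δ
  have h1 : ‖e - 1‖ = 2 * |Real.sin (δ / 2)| := by
    rw [he, mul_comm, Complex.norm_exp_I_mul_ofReal_sub_one, norm_mul]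
    simp
  have h2 : 2 / Real.pi * |δ / 2| ≤ |Real.sin (δ / 2)| := by
    refine Real.mul_abs_le_abs_sin ?_
    rw [abs_div, abs_two]
    linarith
  -- Go from `e` to 1 through `r e`: the radial part `|1 - r|` is itself at most `‖1 - r e‖`.
  have h3 : ‖e - 1‖ ≤ 2 * ‖1 - r * e‖ := by
    have h4 : ‖e - 1‖ ≤ ‖r * e - 1‖ + ‖e - r * e‖ := by
      have : e - 1 = (r * e - 1) + (e - r * e) := by ring
      calc ‖e - 1‖ = ‖(r * e - 1) + (e - r * e)‖ := by rw [← this]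
        _ ≤ _ := norm_add_le _ _
    have h5 : ‖e - r * e‖ = |1 - r| := by
      have : e - r * e = ((1 - r : ℝ) : ℂ) * e := by push_cast; ring
      rw [this, norm_mul, hne, mul_one, Complex.norm_real, Real.norm_eq_abs]
    have h6 : |1 - r| ≤ ‖1 - r * e‖ := by
      have := abs_norm_sub_norm_le (1 : ℂ) (r * e)
      rwa [norm_one, norm_mul, hne, mul_one, Complex.norm_real, Real.norm_of_nonneg hr] at this
    rw [norm_sub_rev (r * e) 1] at h4
    linarith
  rw [abs_div, abs_two] at h2
  have hpi := Real.pi_pos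
  have h7 : 2 / Real.pi * (|δ| / 2) = |δ| / Real.pi := by ring
  rw [h7, div_le_iff₀ hpi] at h2
  nlinarith

theorem one_sub_norm_le_dist {ξ z : ℂ} (hξ : ‖ξ‖ = 1) : 1 - ‖z‖ ≤ ‖z - ξ‖ := by
  have := norm_sub_norm_le ξ z
  rw [hξ, norm_sub_rev] at this
  exact this

/-- Upper bound for the weighted mass of a ball centred on the unit circle. -/
theorem weightedMeasure_closedBall_le {ω : ℂ → ℝ} (hω : IsRadialWeight ω)
    (hc : ContinuousOn ω disc) {ξ : ℂ} (hξ : ‖ξ‖ = 1) {ρ : ℝ} (hρ : 0 < ρ) :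
    weightedMeasure ω (Metric.closedBall ξ ρ) ≤ ENNReal.ofReal (2 * ρ) * tailMass ω ρ := by
  have hpi := Real.pi_pos
  have hB : MeasurableSet (Metric.closedBall (1 : ℂ) ρ) := measurableSet_closedBall
  have h1 : weightedMeasure ω (Metric.closedBall ξ ρ) =
      ∫⁻ z, (Metric.closedBall (1 : ℂ) ρ).indicator 1 z ∂weightedMeasure ω := by
    rw [← lintegral_indicator_one measurableSet_closedBall, ← lintegral_weightedMeasure_rotate hω hc
      _ hξ]
    refine lintegral_congr fun z => ?_
    have : ξ * z ∈ Metric.closedBall ξ ρ ↔ z ∈ Metric.closedBall (1 : ℂ) ρ := by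
      rw [mem_closedBall_iff_norm, mem_closedBall_iff_norm]
      have : ξ * z - ξ = ξ * (z - 1) := by ring
      rw [this, norm_mul, hξ, one_mul]
    exact le_antisymm (indicator_one_le_of_imp this.1) (indicator_one_le_of_imp this.2)
  rw [h1, lintegral_weightedMeasure_polar hω hc (measurable_one.indicator hB)]
  -- A circle of radius below `1 - ρ` misses the ball; any other circle meets it only at angles in
  -- `[-πρ, πρ]`.
  have h2 : ∀ r ∈ Ioo (0 : ℝ) 1, profile ω r * ENNReal.ofReal r *
      ∫⁻ θ in Ioo (-Real.pi) Real.pi, (Metric.closedBall (1 : ℂ) ρ).indicator 1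
        (r * Complex.exp (θ * Complex.I)) ≤
      (Ici (1 - ρ)).indicator (fun r => profile ω r * ENNReal.ofReal r) r *
        ENNReal.ofReal (2 * Real.pi * ρ) := by
    intro r hr
    by_cases hrρ : 1 - ρ ≤ r
    · rw [indicator_of_mem (mem_Ici.2 hrρ)]
      gcongr
      calc _ ≤ ∫⁻ θ in Ioo (-Real.pi) Real.pi,
            (Icc (-(Real.pi * ρ)) (Real.pi * ρ)).indicator 1 θ := by
            refine setLIntegral_mono' measurableSet_Ioo fun θ hθ => ?_
            refine indicator_one_le_of_imp fun h => ?_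
            rw [mem_closedBall_iff_norm, norm_sub_rev] at h
            have := abs_angle_le_norm_one_sub hr.1.le (abs_le.2 ⟨hθ.1.le, hθ.2.le⟩)
            exact abs_le.1 (this.trans (by gcongr))
        _ ≤ ∫⁻ θ, (Icc (-(Real.pi * ρ)) (Real.pi * ρ)).indicator 1 θ := setLIntegral_le_lintegral _ _
        _ = ENNReal.ofReal (2 * Real.pi * ρ) := by
            rw [lintegral_indicator_one measurableSet_Icc, Real.volume_Icc]
            congr 1; ring
    · rw [indicator_of_notMem (by simpa using hrρ), zero_mul, nonpos_iff_eq_zero]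
      have : ∀ θ : ℝ, (Metric.closedBall (1 : ℂ) ρ).indicator (1 : ℂ → ℝ≥0∞)
          (r * Complex.exp (θ * Complex.I)) = 0 := by
        intro θ
        refine indicator_of_notMem (fun h => hrρ ?_) _
        rw [mem_closedBall_iff_norm] at h
        have h3 := one_sub_norm_le_dist (z := r * Complex.exp (θ * Complex.I)) (norm_one (α := ℂ))
        rw [norm_mul, Complex.norm_exp_ofReal_mul_I, mul_one, Complex.norm_real,
          Real.norm_of_nonneg hr.1.le] at h3
        linarith
      simp [this]
  refine (mul_le_mul_right (setLIntegral_mono' measurableSet_Ioo h2) _).trans ?_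
  have hm : Measurable fun r => profile ω r * ENNReal.ofReal r :=
    (measurable_profile hc).mul ENNReal.measurable_ofReal
  rw [lintegral_mul_const _ (hm.indicator measurableSet_Ici), setLIntegral_indicator
    measurableSet_Ici, inter_comm, ← tailMass, mul_comm (tailMass ω ρ), ← mul_assoc,
    ← ENNReal.ofReal_mul (by positivity)]
  have : Real.pi⁻¹ * (2 * Real.pi * ρ) = 2 * ρ := by field_simp
  rw [this]

/-- Endpoints may or may not belong to the arc; sandwiching it between open and closed intervals
treats all cases at once. -/
theorem IsArc.exists_endpoints {J : Set ℝ} (hJ : IsArc J) :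
    ∃ a b : ℝ, a < b ∧ Ioo a b ⊆ J ∧ J ⊆ Icc a b ∧ arcLength J = b - a ∧ b - a ≤ 2 * Real.pi := by
  obtain ⟨hoc, hpos, hle⟩ := hJ
  have hpi := Real.pi_pos
  have hne : J.Nonempty := nonempty_of_measure_ne_zero hpos.ne'
  have hdist : ∀ x ∈ J, ∀ y ∈ J, y - x ≤ 2 * Real.pi := by
    intro x hx y hy
    have h1 := (measure_mono (μ := volume) (hoc.out hx hy)).trans hle
    rw [Real.volume_Icc] at h1
    exact (ENNReal.ofReal_le_ofReal_iff (by positivity)).1 h1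
  obtain ⟨x₀, hx₀⟩ := hne
  have hba : BddAbove J := ⟨x₀ + 2 * Real.pi, fun y hy => by linarith [hdist x₀ hx₀ y hy]⟩
  have hbb : BddBelow J := ⟨x₀ - 2 * Real.pi, fun y hy => by linarith [hdist y hy x₀ hx₀]⟩
  have hIcc : J ⊆ Icc (sInf J) (sSup J) := fun y hy => ⟨csInf_le hbb hy, le_csSup hba hy⟩
  have hIoo : Ioo (sInf J) (sSup J) ⊆ J := fun y hy => by
    obtain ⟨x, hx, hxy⟩ := exists_lt_of_csInf_lt ⟨x₀, hx₀⟩ hy.1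
    obtain ⟨w, hw, hyw⟩ := exists_lt_of_lt_csSup ⟨x₀, hx₀⟩ hy.2
    exact hoc.out hx hw ⟨hxy.le, hyw.le⟩
  have hvol : volume J = ENNReal.ofReal (sSup J - sInf J) := by
    refine le_antisymm ?_ ?_
    · rw [← Real.volume_Icc]; exact measure_mono hIcc
    · rw [← Real.volume_Ioo]; exact measure_mono hIoo
  have hlt : 0 < sSup J - sInf J := by rwa [hvol, ENNReal.ofReal_pos] at hpos
  refine ⟨sInf J, sSup J, by linarith, hIoo, hIcc, ?_, ?_⟩
  · rw [arcLength, hvol, ENNReal.toReal_ofReal hlt.le]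
  · rw [hvol] at hle
    exact (ENNReal.ofReal_le_ofReal_iff (by positivity)).1 hle

theorem norm_exp_sub_exp_le (s t : ℝ) :
    ‖Complex.exp (s * Complex.I) - Complex.exp (t * Complex.I)‖ ≤ |s - t| := by
  have h1 : Complex.exp (s * Complex.I) - Complex.exp (t * Complex.I) =
      Complex.exp (t * Complex.I) * (Complex.exp (Complex.I * ((s - t : ℝ) : ℂ)) - 1) := by
    rw [mul_sub, ← Complex.exp_add, mul_one]
    congr 2
    push_cast; ring
  rw [h1, norm_mul, Complex.norm_exp_ofReal_mul_I, one_mul]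
  exact Real.norm_exp_I_mul_ofReal_sub_one_le

/-- Every Carleson square is contained in a comparable ball centred on the unit circle, and has at
least the expected mass. -/
theorem IsArc.exists_center {ω : ℂ → ℝ} (hω : IsRadialWeight ω)
    (hc : ContinuousOn ω disc) {J : Set ℝ} (hJ : IsArc J) :
    0 < arcLength J ∧ arcLength J ≤ 2 * Real.pi ∧
    ENNReal.ofReal (Real.pi⁻¹ * arcLength J) * tailMass ω (arcLength J) ≤
      weightedMeasure ω (carlesonSquare J) ∧
    ∃ ξ : ℂ, ‖ξ‖ = 1 ∧ carlesonSquare J ⊆ Metric.closedBall ξ (2 * arcLength J) := by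
  obtain ⟨a, b, hab, hIoo, hIcc, hlen, hle⟩ := hJ.exists_endpoints
  have hpi := Real.pi_pos
  set m := (a + b) / 2 with hm
  set ξ := Complex.exp (m * Complex.I) with hξ
  have hnξ : ‖ξ‖ = 1 := Complex.norm_exp_ofReal_mul_I m
  rw [hlen]
  refine ⟨by linarith, hle, ?_, ξ, hnξ, ?_⟩
  -- The polar formula needs a measurable set. The measurable hull has the same mass as the square,
  -- and a lower bound only needs it to contain the square.
  · set T := toMeasurable (weightedMeasure ω) (carlesonSquare J) with hT
    have hTm : MeasurableSet T := measurableSet_toMeasurable _ _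
    have hST : carlesonSquare J ⊆ T := subset_toMeasurable _ _
    rw [← measure_toMeasurable (carlesonSquare J), ← hT, ← lintegral_indicator_one hTm,
      ← lintegral_weightedMeasure_rotate hω hc _ hnξ,
      lintegral_weightedMeasure_polar hω hc (G := fun z => T.indicator 1 (ξ * z))
        ((measurable_one.indicator hTm).comp (measurable_const_mul ξ)),
      ENNReal.ofReal_mul (by positivity), mul_assoc]
    gcongr
    have hmm : Measurable fun r => profile ω r * ENNReal.ofReal r :=
      (measurable_profile hc).mul ENNReal.measurable_ofReal
    rw [tailMass, inter_comm, ← setLIntegral_indicator measurableSet_Ici, ← lintegral_const_mul _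
      (hmm.indicator measurableSet_Ici)]
    refine setLIntegral_mono' measurableSet_Ioo fun r hr => ?_
    by_cases hrρ : 1 - (b - a) ≤ r
    · rw [indicator_of_mem (mem_Ici.2 hrρ), mul_comm]
      gcongr
      calc ENNReal.ofReal (b - a) = ∫⁻ θ in Ioo (-Real.pi) Real.pi,
            (Ioo (a - m) (b - m)).indicator 1 θ := by
            rw [setLIntegral_indicator measurableSet_Ioo, inter_eq_left.2]
            · simp only [Pi.one_apply, setLIntegral_one, Real.volume_Ioo]
              congr 1; ring
            · exact Ioo_subset_Ioo (by rw [hm]; linarith) (by rw [hm]; linarith)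
        _ ≤ _ := by
            refine lintegral_mono fun θ => ?_
            refine indicator_one_le_of_imp fun h => ?_
            refine hST ⟨m + θ, hIoo ⟨by linarith [h.1], by linarith [h.2]⟩, r, hr.1.le, ?_, hr.2, ?_⟩
            · rw [hlen]; exact hrρ
            · rw [hξ, mul_left_comm, ← Complex.exp_add]
              push_cast
              ring_nf
    · rw [indicator_of_notMem (by simpa using hrρ), mul_zero]
      exact zero_le
  · rintro z ⟨t, ht, r, hr0, hr1, hr2, rfl⟩
    rw [hlen] at hr1
    rw [mem_closedBall_iff_norm]
    have h1 : (r : ℂ) * Complex.exp (t * Complex.I) - ξ =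
        (Complex.exp (t * Complex.I) - ξ) - ((1 - r : ℝ) : ℂ) * Complex.exp (t * Complex.I) := by
      push_cast; ring
    have h2 := norm_exp_sub_exp_le t m
    have h3 : |t - m| ≤ b - a := by
      have := hIcc ht
      rw [abs_le]
      constructor <;> rw [hm] <;> linarith [this.1, this.2]
    rw [h1]
    refine (norm_sub_le _ _).trans ?_
    rw [norm_mul, Complex.norm_exp_ofReal_mul_I, mul_one, Complex.norm_real,
      Real.norm_of_nonneg (by linarith)]
    linarith

/-- Every ball centred on the unit circle is covered by a comparable Carleson square. -/
theorem exists_arc_closedBall_subset {ξ : ℂ} (hξ : ‖ξ‖ = 1) {ρ : ℝ} (hρ : 0 < ρ) :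
    ∃ J : Set ℝ, IsArc J ∧ arcLength J ≤ 2 * Real.pi * ρ ∧
      Metric.closedBall ξ ρ ∩ disc ⊆ carlesonSquare J := by
  have hpi := Real.pi_pos
  -- Half the arc length: a chord at most `ρ` subtends an angle at most `πρ`, and the cap at `π`
  -- keeps the arc length within `2π`.
  set h := min (Real.pi * ρ) Real.pi with hh
  have hpos : 0 < h := lt_min (by positivity) hpi
  set m := ξ.arg
  have hξm : ξ = Complex.exp (m * Complex.I) := by
    have := Complex.norm_mul_exp_arg_mul_I ξ
    rw [hξ, Complex.ofReal_one, one_mul] at this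
    exact this.symm
  have hvol : volume (Icc (m - h) (m + h)) = ENNReal.ofReal (2 * h) := by
    rw [Real.volume_Icc]; congr 1; ring
  have hlen : arcLength (Icc (m - h) (m + h)) = 2 * h := by
    rw [arcLength, hvol, ENNReal.toReal_ofReal (by positivity)]
  refine ⟨Icc (m - h) (m + h), ⟨ordConnected_Icc, ?_, ?_⟩, ?_, ?_⟩
  · rw [hvol, ENNReal.ofReal_pos]; positivity
  · rw [hvol]
    exact ENNReal.ofReal_le_ofReal (by linarith [min_le_right (Real.pi * ρ) Real.pi])
  · rw [hlen]; linarith [min_le_left (Real.pi * ρ) Real.pi]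
  · rintro z ⟨hz, hzd⟩
    rw [mem_disc] at hzd
    rw [mem_closedBall_iff_norm] at hz
    have hξ0 : ξ ≠ 0 := norm_ne_zero_iff.1 (by rw [hξ]; exact one_ne_zero)
    set w := z / ξ with hw
    have hzw : z = ξ * w := by rw [hw, mul_div_cancel₀ _ hξ0]
    have hnw : ‖w‖ = ‖z‖ := by rw [hw, norm_div, hξ, div_one]
    have hwe : (‖w‖ : ℂ) * Complex.exp (w.arg * Complex.I) = w := Complex.norm_mul_exp_arg_mul_I w
    have harg : |w.arg| ≤ h := by
      refine le_min ?_ (Complex.abs_arg_le_pi w)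
      refine (abs_angle_le_norm_one_sub (norm_nonneg w) (Complex.abs_arg_le_pi w)).trans ?_
      rw [hwe]
      have : z - ξ = -(ξ * (1 - w)) := by rw [hzw]; ring
      rw [this, norm_neg, norm_mul, hξ, one_mul] at hz
      gcongr
    refine ⟨m + w.arg, ⟨by linarith [(abs_le.1 harg).1], by linarith [(abs_le.1 harg).2]⟩,
      ‖z‖, norm_nonneg z, ?_, hzd, ?_⟩
    · rw [hlen]
      have h1 := one_sub_norm_le_dist (z := z) hξ
      have hpi3 := Real.pi_gt_three
      rcases min_choice (Real.pi * ρ) Real.pi with h2 | h2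
      · rw [hh, h2]; nlinarith
      · rw [hh, h2]; linarith [norm_nonneg z]
    · rw [← hnw, Complex.ofReal_add, add_mul, Complex.exp_add, ← hξm]
      nth_rw 1 [hzw, ← hwe]
      ring

/-! ### Doubling of the tails of the weight. -/

/-- Continuous radial weights whose tails satisfy an upper doubling condition. -/
structure IsDoublingWeight (ω : ℂ → ℝ) (D : ℝ≥0) : Prop where
  radial : IsRadialWeight ω
  cont : ContinuousOn ω disc
  pos : ∀ x, 0 < x → tailMass ω x ≠ 0
  fin : tailMass ω 1 ≠ ∞
  doubling : ∀ x, 0 < x → tailMass ω (2 * x) ≤ D * tailMass ω x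

theorem tailMass_mono (ω : ℂ → ℝ) : Monotone (tailMass ω) := fun x y hxy =>
  lintegral_mono_set (inter_subset_inter_right _ (Ici_subset_Ici.2 (by linarith)))

theorem tailMass_le_tailMass_one (ω : ℂ → ℝ) (x : ℝ) : tailMass ω x ≤ tailMass ω 1 :=
  lintegral_mono_set fun r hr => ⟨hr.1, by simpa using hr.1.1.le⟩

/-- The single property common to both classes on which everything rests; in the rapidly increasing
case the ratio is eventually at least 1. -/
theorem exists_distortion_bound {ω : ℂ → ℝ} (hω : IsRapidlyIncreasing ω ∨ IsRegular ω) :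
    IsRadialWeight ω ∧ ContinuousOn ω disc ∧ ∃ r₀ c : ℝ, 0 ≤ r₀ ∧ r₀ < 1 ∧ 0 < c ∧
      ∀ s, r₀ ≤ s → s < 1 → c * (1 - s) ≤ distortion ω s := by
  rcases hω with ⟨h1, h2, h3⟩ | ⟨h1, h2, C₁, C₂, hC₁, -, h3⟩
  · refine ⟨h1, h2, ?_⟩
    have h4 := h3.eventually (eventually_ge_atTop (1 : ℝ))
    obtain ⟨a, ha, h5⟩ := (mem_nhdsLT_iff_exists_Ioo_subset' (zero_lt_one (α := ℝ))).1 h4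
    refine ⟨max 0 ((a + 1) / 2), 1, le_max_left _ _, max_lt one_pos (by linarith [mem_Iio.1 ha]),
      one_pos, fun s hs hs1 => ?_⟩
    have h6 : 1 ≤ distortion ω s / (1 - s) :=
      h5 ⟨by linarith [(le_max_right 0 ((a + 1) / 2)).trans hs, mem_Iio.1 ha], hs1⟩
    rwa [one_le_div (by linarith), ← one_mul (1 - s)] at h6
  · exact ⟨h1, h2, 0, C₁, le_rfl, one_pos, hC₁, fun s hs hs1 => (h3 s hs hs1).1⟩

theorem continuousOn_ofReal_of_disc {ω : ℂ → ℝ} (hc : ContinuousOn ω disc) :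
    ContinuousOn (fun s : ℝ => ω (s : ℂ)) (Ioo (-1) 1) :=
  hc.comp Complex.continuous_ofReal.continuousOn fun r hr => by
    rw [mem_disc, Complex.norm_real, Real.norm_eq_abs, abs_lt]
    exact hr

/-- Writing `N(s)` for the tail integral, the hypothesis says `-N'/N ≤ 1 / (c (1 - s))`, so `N`
decays no faster than a power of `1 - s`. Below `r₀` monotonicity of `N` suffices. -/
theorem exists_tail_doubling {g : ℝ → ℝ} (hg : ContinuousOn g (Ioo (-1) 1))
    (hpos : ∀ s ∈ Ioo (-1 : ℝ) 1, 0 < g s) {r₀ c : ℝ} (hr₀ : 0 ≤ r₀) (hr₁ : r₀ < 1) (hc : 0 < c)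
    (h : ∀ s, r₀ ≤ s → s < 1 → c * (1 - s) ≤ 1 / g s * ∫ t in s..1, g t) :
    IntervalIntegrable g volume 0 1 ∧ ∃ D : ℝ, 0 < D ∧ ∀ r, 0 ≤ r → r < 1 →
      ∫ t in r..1, g t ≤ D * ∫ t in ((1 + r) / 2)..1, g t := by
  -- Integrability up to 1 is forced: otherwise the integral has the default value 0, contradicting
  -- the positive lower bound.
  have hI1 : IntervalIntegrable g volume r₀ 1 := by
    by_contra hcon
    have h1 := h r₀ le_rfl hr₁
    rw [intervalIntegral.integral_undef hcon, mul_zero] at h1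
    nlinarith
  have hI0 : ∀ r, 0 ≤ r → r < 1 → IntervalIntegrable g volume 0 r := fun r h0 h1 =>
    (hg.mono (by
      rw [uIcc_of_le h0]
      exact Icc_subset_Ioo (by norm_num) h1)).intervalIntegrable
  have hI : IntervalIntegrable g volume 0 1 := (hI0 r₀ hr₀ hr₁).trans hI1
  have hIr : ∀ r, 0 ≤ r → r ≤ 1 → IntervalIntegrable g volume r 1 := fun r h0 h1 =>
    hI.mono_set (by rw [uIcc_of_le h1, uIcc_of_le zero_le_one]; exact Icc_subset_Icc_left h0)
  refine ⟨hI, ?_⟩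
  set N : ℝ → ℝ := fun r => ∫ t in r..1, g t with hN
  have hNpos : ∀ r, 0 ≤ r → r < 1 → 0 < N r := fun r h0 h1 =>
    intervalIntegral.intervalIntegral_pos_of_pos_on (hIr r h0 h1.le)
      (fun s hs => hpos s ⟨by linarith [hs.1], hs.2⟩) h1
  have hNanti : ∀ r s, 0 ≤ r → r ≤ s → s < 1 → N s ≤ N r := by
    intro r s h0 hrs h1
    have hsplit := intervalIntegral.integral_add_adjacent_intervals
      ((hI0 r h0 (by linarith)).symm.trans (hI0 s (by linarith) h1)) (hIr s (by linarith) h1.le)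
    have : 0 ≤ ∫ t in r..s, g t := intervalIntegral.integral_nonneg hrs fun t ht =>
      (hpos t ⟨by linarith [ht.1], by linarith [ht.2]⟩).le
    simp only [hN]
    linarith
  have hder : ∀ s, 0 ≤ s → s < 1 → HasDerivAt N (-g s) s := by
    intro s h0 h1
    have hcs : ContinuousAt g s := hg.continuousAt (Ioo_mem_nhds (by linarith) h1)
    refine intervalIntegral.integral_hasDerivAt_left (hIr s h0 h1.le) ?_ hcs
    exact hg.stronglyMeasurableAtFilter isOpen_Ioo s ⟨by linarith, h1⟩
  obtain ⟨n, hn⟩ := exists_nat_ge (1 / c)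
  have hbound : ∀ s, r₀ ≤ s → s < 1 → g s * (1 - s) ≤ n * N s := by
    intro s hs hs1
    have h1 := h s hs hs1
    have h2 := hpos s ⟨by linarith, hs1⟩
    rw [one_div, ← div_eq_inv_mul, le_div_iff₀ h2] at h1
    have h3 : 1 ≤ n * c := by rwa [div_le_iff₀ hc] at hn
    have h4 : 0 ≤ g s * (1 - s) := mul_nonneg h2.le (by linarith)
    calc g s * (1 - s) ≤ n * c * (g s * (1 - s)) := by nlinarith
      _ = n * (c * (1 - s) * g s) := by ring
      _ ≤ n * N s := by gcongr
  -- The derivative is `(n N(s) - g(s)(1 - s)) / (1 - s)^(n+1)`, nonnegative by `hbound`; a natural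
  -- exponent `n ≥ 1/c` avoids real powers.
  have hmono : MonotoneOn (fun s => N s * ((1 - s) ^ n)⁻¹) (Ico r₀ 1) := by
    have hd : ∀ s ∈ Ico r₀ 1, HasDerivAt (fun s => N s * ((1 - s) ^ n)⁻¹)
        (-g s * ((1 - s) ^ n)⁻¹ +
          N s * (-(n * (1 - s) ^ (n - 1) * (-1)) / ((1 - s) ^ n) ^ 2)) s := by
      intro s hs
      have h1 : (1 - s) ^ n ≠ 0 := pow_ne_zero _ (by linarith [hs.2])
      have h2 : HasDerivAt (fun s : ℝ => (1 - s) ^ n) (n * (1 - s) ^ (n - 1) * (-1)) s :=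
        ((hasDerivAt_id s).const_sub 1).pow n
      exact (hder s (by linarith [hs.1]) hs.2).mul (h2.fun_inv h1)
    refine monotoneOn_of_deriv_nonneg (convex_Ico _ _)
      (fun s hs => (hd s hs).continuousAt.continuousWithinAt)
      (fun s hs => (hd s (interior_subset hs)).differentiableAt.differentiableWithinAt)
      fun s hs => ?_
    have hs' := interior_subset hs
    rw [(hd s hs').deriv]
    have hx : 0 < 1 - s := by linarith [hs'.2]
    have h3 : -g s * ((1 - s) ^ n)⁻¹ +
          N s * (-(n * (1 - s) ^ (n - 1) * (-1)) / ((1 - s) ^ n) ^ 2) =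
        (n * N s - g s * (1 - s)) * ((1 - s) ^ (n + 1))⁻¹ := by
      rcases n with _ | n
      · field_simp
        simp
      · rw [Nat.add_sub_cancel]
        field_simp
        ring
    rw [h3]
    exact mul_nonneg (by linarith [hbound s hs'.1 hs'.2]) (by positivity)
  have hm0 : 0 < N ((1 + r₀) / 2) := hNpos _ (by linarith) (by linarith)
  refine ⟨2 ^ n + N 0 / N ((1 + r₀) / 2), ?_, fun r h0 h1 => ?_⟩
  · have := hNpos 0 le_rfl one_pos
    positivity
  have hmid := hNpos ((1 + r) / 2) (by linarith) (by linarith)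
  have hN0 := hNpos 0 le_rfl one_pos
  change N r ≤ _ * N ((1 + r) / 2)
  rw [add_mul]
  rcases le_or_gt r₀ r with hr | hr
  · have h2 := hmono ⟨hr, h1⟩ (b := (1 + r) / 2) ⟨by linarith, by linarith⟩ (by linarith)
    have hx : 0 < 1 - r := by linarith
    have h3 : 1 - (1 + r) / 2 = (1 - r) / 2 := by ring
    simp only [h3, div_pow, inv_div] at h2
    have h4 : N r ≤ 2 ^ n * N ((1 + r) / 2) := by
      have hxn : 0 < (1 - r) ^ n := by positivity
      rw [← div_eq_mul_inv, mul_div_assoc', div_le_div_iff_of_pos_right hxn] at h2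
      linarith
    have : 0 ≤ N 0 / N ((1 + r₀) / 2) * N ((1 + r) / 2) := by positivity
    linarith
  · have h2 : N r ≤ N 0 := hNanti 0 r le_rfl h0 h1
    have h3 : N ((1 + r₀) / 2) ≤ N ((1 + r) / 2) :=
      hNanti _ _ (by linarith) (by linarith) (by linarith)
    have h4 : N 0 ≤ N 0 / N ((1 + r₀) / 2) * N ((1 + r) / 2) := by
      rw [div_mul_eq_mul_div, le_div_iff₀ hm0]
      gcongr
    have : 0 ≤ 2 ^ n * N ((1 + r) / 2) := by positivity
    linarith

/-- Regular and rapidly increasing weights have doubling tails. -/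
theorem exists_isDoublingWeight {ω : ℂ → ℝ} (hω : IsRapidlyIncreasing ω ∨ IsRegular ω) :
    ∃ D : ℝ≥0, IsDoublingWeight ω D := by
  obtain ⟨hrad, hcont, r₀, c, hr₀, hr₁, hc, h⟩ := exists_distortion_bound hω
  have hg := continuousOn_ofReal_of_disc hcont
  have hpos : ∀ s ∈ Ioo (-1 : ℝ) 1, 0 < ω (s : ℂ) := fun s hs => hrad.1.1 s (by
    rw [mem_disc, Complex.norm_real, Real.norm_eq_abs, abs_lt]
    exact hs)
  obtain ⟨hI, D, hD, hdoub⟩ := exists_tail_doubling hg hpos hr₀ hr₁ hc h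
  set N : ℝ → ℝ := fun r => ∫ t in r..1, ω (t : ℂ) with hN
  have hIr : ∀ r, 0 ≤ r → r ≤ 1 → IntervalIntegrable (fun t : ℝ => ω (t : ℂ)) volume r 1 :=
    fun r h0 h1 => hI.mono_set (by
      rw [uIcc_of_le h1, uIcc_of_le zero_le_one]; exact Icc_subset_Icc_left h0)
  have hNpos : ∀ r, 0 ≤ r → r < 1 → 0 < N r := fun r h0 h1 =>
    intervalIntegral.intervalIntegral_pos_of_pos_on (hIr r h0 h1.le)
      (fun s hs => hpos s ⟨by linarith [hs.1], hs.2⟩) h1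
  have hNlin : ∀ a, 0 ≤ a → a < 1 → ENNReal.ofReal (N a) =
      ∫⁻ r in Ioo a 1, ENNReal.ofReal (ω (r : ℂ)) := by
    intro a h0 h1
    have hi := hIr a h0 h1.le
    rw [intervalIntegrable_iff_integrableOn_Ioo_of_le h1.le] at hi
    simp only [hN]
    rw [intervalIntegral.integral_of_le h1.le, integral_Ioc_eq_integral_Ioo,
      ofReal_integral_eq_lintegral_ofReal hi]
    refine (ae_restrict_iff' measurableSet_Ioo).2 (ae_of_all _ fun s hs => ?_)
    exact (hpos s ⟨by linarith [hs.1], hs.2⟩).le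
  have hset : ∀ x, 0 < x → x ≤ 1 →
      (Ioo (0 : ℝ) 1 ∩ Ici (1 - x) : Set ℝ) =ᵐ[volume] Ioo (1 - x) 1 := by
    intro x h0 h1
    rcases eq_or_lt_of_le h1 with rfl | h1
    · have : (Ioo (0 : ℝ) 1 ∩ Ici (1 - 1) : Set ℝ) = Ioo (1 - 1) 1 := by
        ext r
        simp only [sub_self, mem_inter_iff, mem_Ioo, mem_Ici, and_iff_left_iff_imp]
        exact fun h => h.1.le
      rw [this]
      exact EventuallyEq.rfl
    · have : (Ioo (0 : ℝ) 1 ∩ Ici (1 - x) : Set ℝ) = Ico (1 - x) 1 := by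
        ext r
        simp only [mem_inter_iff, mem_Ioo, mem_Ici, mem_Ico]
        constructor
        · rintro ⟨⟨h2, h3⟩, h4⟩; exact ⟨h4, h3⟩
        · rintro ⟨h2, h3⟩; exact ⟨⟨by linarith, h3⟩, h2⟩
      rw [this]
      exact Ioo_ae_eq_Ico.symm
  have hup : ∀ x, 0 < x → x ≤ 1 → tailMass ω x ≤ ENNReal.ofReal (N (1 - x)) := by
    intro x h0 h1
    rw [tailMass, setLIntegral_congr (hset x h0 h1), hNlin _ (by linarith) (by linarith)]
    refine setLIntegral_mono' measurableSet_Ioo fun r hr => ?_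
    have hr0 : 0 ≤ r := by linarith [hr.1]
    rw [profile, indicator_of_mem (show r ∈ Ico (0 : ℝ) 1 from ⟨hr0, hr.2⟩)]
    exact mul_le_of_le_one_right' (ENNReal.ofReal_le_one.2 hr.2.le)
  -- The Jacobian factor `r` is at least `1/2` on this range, so inserting it costs a factor 2.
  have hlow : ∀ x, 0 < x → x ≤ 1 / 2 → ENNReal.ofReal (N (1 - x)) ≤ 2 * tailMass ω x := by
    intro x h0 h1
    rw [tailMass, setLIntegral_congr (hset x h0 (by linarith)), hNlin _ (by linarith) (by linarith),
      ← lintegral_const_mul (f := fun r => profile ω r * ENNReal.ofReal r) _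
        ((measurable_profile hcont).mul ENNReal.measurable_ofReal)]
    refine setLIntegral_mono' measurableSet_Ioo fun r hr => ?_
    have hr0 : 1 / 2 ≤ r := by linarith [hr.1]
    rw [profile, indicator_of_mem (show r ∈ Ico (0 : ℝ) 1 from ⟨by linarith, hr.2⟩), mul_left_comm]
    refine le_mul_of_one_le_right' ?_
    have h2 : (2 : ℝ≥0∞) = ENNReal.ofReal 2 := by simp
    rw [h2, ← ENNReal.ofReal_mul (by norm_num), ENNReal.one_le_ofReal]
    linarith
  have hpos' : ∀ x, 0 < x → tailMass ω x ≠ 0 := by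
    intro x h0 hcon
    have h1 : 0 < min x (1 / 2) := lt_min h0 (by norm_num)
    have h2 := hlow _ h1 (min_le_right _ _)
    have h3 : tailMass ω (min x (1 / 2)) = 0 :=
      le_antisymm ((tailMass_mono ω (min_le_left _ _)).trans hcon.le) zero_le
    rw [h3, mul_zero, nonpos_iff_eq_zero, ENNReal.ofReal_eq_zero] at h2
    have := min_le_right x (1 / 2)
    linarith [hNpos (1 - min x (1 / 2)) (by linarith) (by linarith)]
  refine ⟨(2 * D).toNNReal, hrad, hcont, hpos', ?_, ?_⟩
  · exact ne_top_of_le_ne_top ENNReal.ofReal_ne_top (hup 1 one_pos le_rfl)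
  · have hcoe : ((2 * D).toNNReal : ℝ≥0∞) = 2 * ENNReal.ofReal D := by
      rw [← ENNReal.ofReal, ENNReal.ofReal_mul (by norm_num)]
      simp
    have hkey : ∀ x, 0 < x → x ≤ 1 / 2 →
        tailMass ω (2 * x) ≤ 2 * ENNReal.ofReal D * tailMass ω x := by
      intro x h0 h1
      have h2 := hdoub (1 - 2 * x) (by linarith) (by linarith)
      have h3 : (1 + (1 - 2 * x)) / 2 = 1 - x := by ring
      rw [h3] at h2
      calc tailMass ω (2 * x) ≤ ENNReal.ofReal (N (1 - 2 * x)) := hup _ (by linarith) (by linarith)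
        _ ≤ ENNReal.ofReal (D * N (1 - x)) := ENNReal.ofReal_le_ofReal h2
        _ = ENNReal.ofReal D * ENNReal.ofReal (N (1 - x)) := ENNReal.ofReal_mul hD.le
        _ ≤ ENNReal.ofReal D * (2 * tailMass ω x) := by gcongr; exact hlow x h0 h1
        _ = _ := by ring
    intro x h0
    rw [hcoe]
    rcases le_or_gt x (1 / 2) with h1 | h1
    · exact hkey x h0 h1
    · calc tailMass ω (2 * x) ≤ tailMass ω (2 * (1 / 2)) := by
            rw [mul_one_div_cancel two_ne_zero]; exact tailMass_le_tailMass_one ω _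
        _ ≤ 2 * ENNReal.ofReal D * tailMass ω (1 / 2) := hkey _ (by norm_num) le_rfl
        _ ≤ _ := by gcongr; exact tailMass_mono ω h1.le

/-! ### The boundary bump kernel and its integrals. -/

/-- The size `ρ ω̂(1 - ρ)` of the weighted mass of a Carleson box of side `ρ`. -/
noncomputable def boxMass (ω : ℂ → ℝ) (ρ : ℝ) : ℝ≥0∞ := ENNReal.ofReal ρ * tailMass ω ρ

/-- The kernel `ℓ / (1 + ℓ - ζ / ξ)`, an analytic bump of width `ℓ` at the boundary point `ξ`. -/
noncomputable def bumpKernel (ξ : ℂ) (ℓ : ℝ) (ζ : ℂ) : ℂ := ℓ / (1 + ℓ - ζ / ξ)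

section Kernel

variable {ξ ζ : ℂ} {ℓ : ℝ}

theorem norm_one_sub_div (hξ : ‖ξ‖ = 1) : ‖1 - ζ / ξ‖ = ‖ζ - ξ‖ := by
  have hξ0 : ξ ≠ 0 := norm_ne_zero_iff.1 (by rw [hξ]; exact one_ne_zero)
  have : 1 - ζ / ξ = -((ζ - ξ) / ξ) := by field_simp; ring
  rw [this, norm_neg, norm_div, hξ, div_one]

theorem re_div_le (hξ : ‖ξ‖ = 1) (hζ : ‖ζ‖ ≤ 1) : (ζ / ξ).re ≤ 1 := by
  refine (Complex.re_le_norm _).trans ?_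
  rwa [norm_div, hξ, div_one]

theorem le_norm_denom (hξ : ‖ξ‖ = 1) (hζ : ‖ζ‖ ≤ 1) : ℓ ≤ ‖1 + ℓ - ζ / ξ‖ := by
  refine le_trans ?_ (Complex.re_le_norm _)
  simp only [Complex.sub_re, Complex.add_re, Complex.one_re, Complex.ofReal_re]
  linarith [re_div_le hξ hζ]

/-- Adding `ℓ ≥ 0` to a number with nonnegative real part, here `1 - ζ/ξ`, cannot decrease its
modulus. -/
theorem dist_le_norm_denom (hξ : ‖ξ‖ = 1) (hζ : ‖ζ‖ ≤ 1) (hℓ : 0 ≤ ℓ) :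
    ‖ζ - ξ‖ ≤ ‖1 + ℓ - ζ / ξ‖ := by
  rw [← norm_one_sub_div hξ]
  refine le_of_sq_le_sq ?_ (norm_nonneg _)
  rw [Complex.sq_norm, Complex.sq_norm, Complex.normSq_apply, Complex.normSq_apply]
  simp only [Complex.sub_re, Complex.add_re, Complex.one_re, Complex.ofReal_re, Complex.sub_im,
    Complex.add_im, Complex.one_im, Complex.ofReal_im]
  nlinarith [re_div_le hξ hζ]

theorem denom_ne_zero (hξ : ‖ξ‖ = 1) (hζ : ‖ζ‖ ≤ 1) (hℓ : 0 < ℓ) : 1 + ℓ - ζ / ξ ≠ 0 :=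
  norm_pos_iff.1 (hℓ.trans_le (le_norm_denom hξ hζ))

theorem norm_bumpKernel (hℓ : 0 < ℓ) : ‖bumpKernel ξ ℓ ζ‖ = ℓ / ‖1 + ℓ - ζ / ξ‖ := by
  rw [bumpKernel, norm_div, Complex.norm_real, Real.norm_of_nonneg hℓ.le]

theorem norm_bumpKernel_le_one (hξ : ‖ξ‖ = 1) (hζ : ‖ζ‖ ≤ 1) (hℓ : 0 < ℓ) :
    ‖bumpKernel ξ ℓ ζ‖ ≤ 1 := by
  rw [norm_bumpKernel hℓ]
  exact div_le_one_of_le₀ (le_norm_denom hξ hζ) (norm_nonneg _)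

theorem norm_bumpKernel_le (hξ : ‖ξ‖ = 1) (hζ : ‖ζ‖ ≤ 1) (hℓ : 0 < ℓ) {d : ℝ} (hd : 0 < d)
    (h : d ≤ ‖ζ - ξ‖) : ‖bumpKernel ξ ℓ ζ‖ ≤ ℓ / d := by
  rw [norm_bumpKernel hℓ]
  exact div_le_div_of_nonneg_left hℓ.le hd (h.trans (dist_le_norm_denom hξ hζ hℓ.le))

theorem one_third_le_norm_bumpKernel (hξ : ‖ξ‖ = 1) (hζ : ‖ζ‖ ≤ 1) (hℓ : 0 < ℓ)
    (h : ‖ζ - ξ‖ ≤ 2 * ℓ) : 3⁻¹ ≤ ‖bumpKernel ξ ℓ ζ‖ := by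
  have h1 := hℓ.trans_le (le_norm_denom (ℓ := ℓ) hξ hζ)
  have h2 : ‖1 + ℓ - ζ / ξ‖ ≤ 3 * ℓ := by
    have : 1 + (ℓ : ℂ) - ζ / ξ = (1 - ζ / ξ) + ℓ := by ring
    rw [this]
    refine (norm_add_le _ _).trans ?_
    rw [norm_one_sub_div hξ, Complex.norm_real, Real.norm_of_nonneg hℓ.le]
    linarith
  rw [norm_bumpKernel hℓ, le_div_iff₀ h1]
  linarith

theorem differentiableOn_bumpKernel (hξ : ‖ξ‖ = 1) (hℓ : 0 < ℓ) :
    DifferentiableOn ℂ (bumpKernel ξ ℓ) disc := by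
  intro z hz
  refine DifferentiableAt.differentiableWithinAt ?_
  unfold bumpKernel
  have := denom_ne_zero hξ (mem_disc.1 hz).le hℓ
  fun_prop (disch := assumption)

end Kernel

theorem weightedMeasure_disc_compl (ω : ℂ → ℝ) : weightedMeasure ω discᶜ = 0 := by
  refine withDensity_absolutelyContinuous _ _ ?_
  rw [areaMeasure, Measure.smul_apply, Measure.restrict_apply measurableSet_disc.compl]
  simp

theorem ae_mem_disc {μ : Measure ℂ} (hμ : μ discᶜ = 0) : ∀ᵐ z ∂μ, z ∈ disc := hμ

theorem restrict_disc {μ : Measure ℂ} (hμ : μ discᶜ = 0) : μ.restrict disc = μ :=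
  Measure.restrict_eq_self_of_ae_mem (ae_mem_disc hμ)

theorem aemeasurable_of_continuousOn_disc {μ : Measure ℂ} (hμ : μ discᶜ = 0) {β : Type*}
    [TopologicalSpace β] [MeasurableSpace β] [BorelSpace β] {f : ℂ → β}
    (hf : ContinuousOn f disc) : AEMeasurable f μ := by
  rw [← restrict_disc hμ]
  exact hf.aemeasurable measurableSet_disc

theorem aemeasurable_enorm_rpow {μ : Measure ℂ} (hμ : μ discᶜ = 0) {f : ℂ → ℂ}
    (hf : ContinuousOn f disc) (α : ℝ) : AEMeasurable (fun z => ‖f z‖ₑ ^ α) μ :=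
  (aemeasurable_of_continuousOn_disc hμ hf).enorm.pow_const α

variable {ω : ℂ → ℝ} {D : ℝ≥0}

namespace IsDoublingWeight

theorem tailMass_ne_top (h : IsDoublingWeight ω D) (x : ℝ) : tailMass ω x ≠ ∞ :=
  ne_top_of_le_ne_top h.fin (tailMass_le_tailMass_one ω x)

theorem boxMass_ne_top (h : IsDoublingWeight ω D) (x : ℝ) : boxMass ω x ≠ ∞ :=
  ENNReal.mul_ne_top ENNReal.ofReal_ne_top (h.tailMass_ne_top x)

theorem boxMass_ne_zero (h : IsDoublingWeight ω D) {x : ℝ} (hx : 0 < x) : boxMass ω x ≠ 0 :=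
  mul_ne_zero (ENNReal.ofReal_pos.2 hx).ne' (h.pos x hx)

/-- Each doubling costs 2 from the length and `D` from the tail. -/
theorem boxMass_two_pow (h : IsDoublingWeight ω D) {x : ℝ} (hx : 0 < x) (k : ℕ) :
    boxMass ω (2 ^ k * x) ≤ (2 * D) ^ k * boxMass ω x := by
  induction k with
  | zero => simp
  | succ k ih =>
    have hpos : 0 < 2 ^ k * x := by positivity
    calc boxMass ω (2 ^ (k + 1) * x) = boxMass ω (2 * (2 ^ k * x)) := by congr 1; ring
      _ ≤ ENNReal.ofReal (2 * (2 ^ k * x)) * (D * tailMass ω (2 ^ k * x)) := by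
          unfold boxMass; gcongr; exact h.doubling _ hpos
      _ = 2 * D * boxMass ω (2 ^ k * x) := by
          rw [ENNReal.ofReal_mul (by norm_num), boxMass]
          simp only [ENNReal.ofReal_ofNat]
          ring
      _ ≤ 2 * D * ((2 * D) ^ k * boxMass ω x) := by gcongr
      _ = _ := by ring

end IsDoublingWeight

theorem boxMass_mono (ω : ℂ → ℝ) : Monotone (boxMass ω) := fun _ _ hxy =>
  mul_le_mul' (ENNReal.ofReal_le_ofReal hxy) (tailMass_mono ω hxy)

/-- A power of the bump kernel integrates to at most a multiple of the mass of its box, provided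
all dilated boxes have controlled mass. -/
theorem lintegral_bumpKernel_mul_le (h : IsDoublingWeight ω D) {γ : ℝ} (hγ0 : 0 < γ)
    (hγ : 4 * (D : ℝ≥0∞) ≤ 2 ^ γ) {ν : Measure ℂ} (hν : ν discᶜ = 0) {F : ℂ → ℝ≥0∞}
    (hF : AEMeasurable F ν) {ξ : ℂ} (hξ : ‖ξ‖ = 1) {ℓ : ℝ} (hℓ : 0 < ℓ) (hℓ8 : ℓ ≤ 8)
    {Λ : ℝ≥0∞} (hΛ : ∀ k : ℕ, 2 ^ k * ℓ ≤ 8 →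
      ∫⁻ ζ in Metric.closedBall ξ (2 ^ k * ℓ), F ζ ∂ν ≤ Λ * boxMass ω (2 ^ k * ℓ)) :
    ∫⁻ ζ, ‖bumpKernel ξ ℓ ζ‖ₑ ^ γ * F ζ ∂ν ≤ 2 ^ γ * 2 * (Λ * boxMass ω ℓ) := by
  -- Radii up to 8 suffice: arc lengths are at most `2π < 8`, and for `k ≥ 1` the first dyadic ball
  -- containing a point of the disc has radius below 4, since the point is within 2 of `ξ`.
  set B : ℕ → Set ℂ := fun k => if 2 ^ k * ℓ ≤ 8 then Metric.closedBall ξ (2 ^ k * ℓ) else ∅ with hB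
  have hBm : ∀ k, MeasurableSet (B k) := fun k => by
    simp only [hB]; split_ifs <;> measurability
  set c : ℕ → ℝ≥0∞ := fun k => 2 ^ γ * ((2 ^ γ)⁻¹) ^ k with hc
  have h2γ0 : (2 : ℝ≥0∞) ^ γ ≠ 0 := (ENNReal.rpow_pos (by norm_num) (by norm_num)).ne'
  have h2γt : (2 : ℝ≥0∞) ^ γ ≠ ∞ := ENNReal.rpow_ne_top_of_nonneg hγ0.le (by norm_num)
  have hpt : ∀ ζ ∈ disc, ‖bumpKernel ξ ℓ ζ‖ₑ ^ γ * F ζ ≤ ∑' k, (B k).indicator (fun ζ => c k * F ζ) ζ := by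
    intro ζ hζ
    have hζ1 : ‖ζ‖ < 1 := mem_disc.1 hζ
    have hdist : ‖ζ - ξ‖ < 2 := by
      have := norm_sub_le ζ ξ
      linarith
    have hex : ∃ k : ℕ, ‖ζ - ξ‖ ≤ 2 ^ k * ℓ := by
      obtain ⟨k, hk⟩ := pow_unbounded_of_one_lt (2 / ℓ) (one_lt_two (α := ℝ))
      refine ⟨k, ?_⟩
      rw [div_lt_iff₀ hℓ] at hk
      linarith
    classical
    set k := Nat.find hex with hk
    have hk1 : ‖ζ - ξ‖ ≤ 2 ^ k * ℓ := Nat.find_spec hex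
    have hmain : ζ ∈ B k ∧ ‖bumpKernel ξ ℓ ζ‖ₑ ≤ 2 * 2⁻¹ ^ k := by
      rcases Nat.eq_zero_or_pos k with h0 | h0
      · rw [h0] at hk1 ⊢
        refine ⟨?_, ?_⟩
        · simp only [hB, pow_zero, one_mul, hℓ8, if_true, mem_closedBall_iff_norm]
          simpa using hk1
        · rw [pow_zero, mul_one, ← ofReal_norm]
          refine (ENNReal.ofReal_le_ofReal (norm_bumpKernel_le_one hξ hζ1.le hℓ)).trans ?_
          norm_num
      · obtain ⟨j, hj⟩ : ∃ j, k = j + 1 := ⟨k - 1, by omega⟩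
        have hj1 : 2 ^ j * ℓ < ‖ζ - ξ‖ := not_le.1 (Nat.find_min hex (m := j) (by omega))
        rw [hj] at hk1 ⊢
        refine ⟨?_, ?_⟩
        · have : 2 ^ (j + 1) * ℓ ≤ 8 := by rw [pow_succ]; linarith
          simp only [hB, this, if_true, mem_closedBall_iff_norm]
          exact hk1
        · have h3 := norm_bumpKernel_le hξ hζ1.le hℓ (by positivity) hj1.le
          have h4 : ℓ / (2 ^ j * ℓ) = 2⁻¹ ^ j := by field_simp; simp
          rw [h4] at h3
          rw [← ofReal_norm]
          refine (ENNReal.ofReal_le_ofReal h3).trans (le_of_eq ?_)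
          rw [ENNReal.ofReal_pow (by norm_num), ENNReal.ofReal_inv_of_pos two_pos, pow_succ',
            ← mul_assoc, ENNReal.ofReal_ofNat, ENNReal.mul_inv_cancel two_ne_zero ENNReal.ofNat_ne_top,
            one_mul]
    refine le_trans ?_ (ENNReal.le_tsum k)
    rw [indicator_of_mem hmain.1]
    gcongr
    calc ‖bumpKernel ξ ℓ ζ‖ₑ ^ γ ≤ (2 * 2⁻¹ ^ k) ^ γ := by gcongr; exact hmain.2
      _ = c k := by
        rw [ENNReal.mul_rpow_of_nonneg _ _ hγ0.le, ← ENNReal.rpow_natCast, ← ENNReal.rpow_mul,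
          mul_comm (k : ℝ), ENNReal.rpow_mul, ENNReal.rpow_natCast, ENNReal.inv_rpow]
  have hterm : ∀ k, ∫⁻ ζ, (B k).indicator (fun ζ => c k * F ζ) ζ ∂ν ≤
      2 ^ γ * (Λ * boxMass ω ℓ) * 2⁻¹ ^ k := by
    intro k
    rw [lintegral_indicator (hBm k), lintegral_const_mul'' _ hF.restrict]
    by_cases hk : 2 ^ k * ℓ ≤ 8
    · have hBk : B k = Metric.closedBall ξ (2 ^ k * ℓ) := by simp only [hB, hk, if_true]
      rw [hBk]
      -- Kernel decay `2^(-γ)` per shell beats mass growth `2 D`; this is where the size of `γ` is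
      -- used, and it makes the series geometric with ratio at most `1/2`.
      have hq : (2 ^ γ)⁻¹ * (2 * (D : ℝ≥0∞)) ≤ 2⁻¹ := by
        rw [mul_comm, ← div_eq_mul_inv]
        refine ENNReal.div_le_of_le_mul ?_
        calc (2 : ℝ≥0∞) * D = 2⁻¹ * (4 * D) := by
              rw [← mul_assoc]
              congr 1
              rw [show (4 : ℝ≥0∞) = 2 * 2 by norm_num, ← mul_assoc,
                ENNReal.inv_mul_cancel two_ne_zero ENNReal.ofNat_ne_top, one_mul]
          _ ≤ 2⁻¹ * 2 ^ γ := by gcongr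
      calc c k * ∫⁻ ζ in Metric.closedBall ξ (2 ^ k * ℓ), F ζ ∂ν
          ≤ c k * (Λ * ((2 * D) ^ k * boxMass ω ℓ)) := by
            gcongr
            exact (hΛ k hk).trans (mul_le_mul_right (h.boxMass_two_pow hℓ k) _)
        _ = 2 ^ γ * (Λ * boxMass ω ℓ) * ((2 ^ γ)⁻¹ * (2 * D)) ^ k := by
            simp only [hc, mul_pow]; ring
        _ ≤ _ := by gcongr
    · have hBk : B k = ∅ := by simp only [hB, hk, if_false]
      rw [hBk]
      simp
  calc ∫⁻ ζ, ‖bumpKernel ξ ℓ ζ‖ₑ ^ γ * F ζ ∂ν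
      ≤ ∫⁻ ζ, ∑' k, (B k).indicator (fun ζ => c k * F ζ) ζ ∂ν :=
        lintegral_mono_ae ((ae_mem_disc hν).mono hpt)
    _ = ∑' k, ∫⁻ ζ, (B k).indicator (fun ζ => c k * F ζ) ζ ∂ν :=
        lintegral_tsum fun k => (hF.const_mul _).indicator (hBm k)
    _ ≤ ∑' k, 2 ^ γ * (Λ * boxMass ω ℓ) * 2⁻¹ ^ k := ENNReal.tsum_le_tsum hterm
    _ = 2 ^ γ * 2 * (Λ * boxMass ω ℓ) := by
        rw [ENNReal.tsum_mul_left, ENNReal.tsum_geometric, ENNReal.one_sub_inv_two, inv_inv]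
        ring

/-! ### Global growth and its localisation. -/

/-- Growth of an analytic function in terms of its weighted integral means. -/
theorem enorm_rpow_mul_tailMass_le (h : IsDoublingWeight ω D) {α : ℝ} (hα : 0 < α) {g : ℂ → ℂ}
    (hg : DifferentiableOn ℂ g disc) {z : ℂ} (hz : z ∈ disc) :
    ‖g z‖ₑ ^ α * tailMass ω ((1 - ‖z‖) / 2) ≤
      ENNReal.ofReal (2 / (1 - ‖z‖)) * ∫⁻ ζ, ‖g ζ‖ₑ ^ α ∂weightedMeasure ω := by
  have hpi := Real.pi_pos
  set ℓ := 1 - ‖z‖ with hℓ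
  have hz1 := mem_disc.1 hz
  have hℓ0 : 0 < ℓ := by linarith
  have hgc := hg.continuousOn
  set G : ℂ → ℝ≥0∞ := disc.indicator fun ζ => ‖g ζ‖ₑ ^ α with hG
  have hGm : Measurable G := by
    classical
    have h1 : ContinuousOn (fun ζ => ‖g ζ‖ₑ ^ α) disc :=
      (ENNReal.continuous_rpow_const.comp_continuousOn hgc.enorm)
    have h2 := h1.measurable_piecewise (g := 0) continuousOn_const measurableSet_disc
    rwa [piecewise_eq_indicator] at h2
  have hcircle : ∀ r ∈ Ioo (0 : ℝ) 1 ∩ Ici (1 - ℓ / 2), ‖g z‖ₑ ^ α ≤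
      ENNReal.ofReal (2 / (ℓ * Real.pi)) *
        ∫⁻ θ in Ioo (-Real.pi) Real.pi, G (r * Complex.exp (θ * Complex.I)) := by
    rintro r ⟨⟨hr0, hr1⟩, hr2⟩
    rw [mem_Ici] at hr2
    have hsub : Metric.closedBall (0 : ℂ) r ⊆ disc := Metric.closedBall_subset_ball hr1
    have h1 := norm_rpow_le_circleAverage (w := z) (R := r) hα
      ((hg.analyticOnNhd isOpen_disc).mono hsub) (by
        rw [Metric.mem_ball, dist_zero_right]; linarith)
    have hcont : Continuous fun θ : ℝ => ‖g (circleMap 0 r θ)‖ ^ α := by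
      refine Continuous.rpow_const (Continuous.norm (continuousOn_univ.1 ?_)) fun _ => Or.inr hα.le
      exact hgc.comp (continuous_circleMap 0 r).continuousOn fun θ _ =>
        hsub (circleMap_mem_closedBall 0 hr0.le θ)
    have h2 : Real.circleAverage (fun z => ‖g z‖ ^ α) 0 r =
        (2 * Real.pi)⁻¹ * ∫ θ in Ioo (-Real.pi) Real.pi, ‖g (circleMap 0 r θ)‖ ^ α := by
      rw [Real.circleAverage_def, smul_eq_mul, ← integral_Ioc_eq_integral_Ioo,
        ← intervalIntegral.integral_of_le (by linarith)]
      have hper : Function.Periodic (fun θ => ‖g (circleMap 0 r θ)‖ ^ α) (2 * Real.pi) :=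
        fun θ => by simp only [periodic_circleMap 0 r θ]
      have := hper.intervalIntegral_add_eq 0 (-Real.pi)
      rw [zero_add, show -Real.pi + 2 * Real.pi = Real.pi by ring] at this
      rw [this]
    -- Since `r ≥ 1 - ℓ/2` while `‖z‖ = 1 - ℓ`, the denominator is at least `ℓ/2`.
    have h3 : (r + ‖z‖) / (r - ‖z‖) ≤ 4 / ℓ := by
      rw [div_le_div_iff₀ (by linarith) hℓ0]
      nlinarith
    have hint : IntegrableOn (fun θ : ℝ => ‖g (circleMap 0 r θ)‖ ^ α) (Ioo (-Real.pi) Real.pi) :=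
      (hcont.integrableOn_Icc).mono_set Ioo_subset_Icc_self
    have hnn : 0 ≤ ∫ θ in Ioo (-Real.pi) Real.pi, ‖g (circleMap 0 r θ)‖ ^ α :=
      integral_nonneg fun θ => by positivity
    have h4 : ‖g z‖ ^ α ≤ 2 / (ℓ * Real.pi) *
        ∫ θ in Ioo (-Real.pi) Real.pi, ‖g (circleMap 0 r θ)‖ ^ α := by
      refine h1.trans ?_
      rw [h2, ← mul_assoc]
      refine mul_le_mul_of_nonneg_right ?_ hnn
      calc (r + ‖z‖) / (r - ‖z‖) * (2 * Real.pi)⁻¹ ≤ 4 / ℓ * (2 * Real.pi)⁻¹ := by gcongr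
        _ = 2 / (ℓ * Real.pi) := by field_simp; norm_num
    rw [← ofReal_norm, ENNReal.ofReal_rpow_of_nonneg (norm_nonneg _) hα.le]
    refine (ENNReal.ofReal_le_ofReal h4).trans (le_of_eq ?_)
    rw [ENNReal.ofReal_mul (by positivity), ofReal_integral_eq_lintegral_ofReal hint
      (ae_of_all _ fun θ => by positivity)]
    congr 1
    refine lintegral_congr fun θ => ?_
    have hmem : (r : ℂ) * Complex.exp (θ * Complex.I) ∈ disc := by
      rw [← circleMap_zero]
      exact hsub (circleMap_mem_closedBall 0 hr0.le θ)
    rw [hG, indicator_of_mem hmem, ← ofReal_norm, ENNReal.ofReal_rpow_of_nonneg (norm_nonneg _) hα.le,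
      circleMap_zero]
  have hGW : ∫⁻ ζ, ‖g ζ‖ₑ ^ α ∂weightedMeasure ω = ∫⁻ ζ, G ζ ∂weightedMeasure ω :=
    lintegral_congr_ae ((ae_mem_disc (weightedMeasure_disc_compl ω)).mono fun ζ hζ => by
      simp only [hG, indicator_of_mem hζ])
  have hmm : Measurable fun r => profile ω r * ENNReal.ofReal r :=
    (measurable_profile h.cont).mul ENNReal.measurable_ofReal
  rw [hGW, lintegral_weightedMeasure_polar h.radial h.cont hGm, tailMass,
    ← lintegral_const_mul _ hmm, ← mul_assoc, ← ENNReal.ofReal_mul (by positivity)]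
  have hconst : 2 / ℓ * Real.pi⁻¹ = 2 / (ℓ * Real.pi) := by field_simp
  rw [hconst]
  set S := Ioo (0 : ℝ) 1 ∩ Ici (1 - ℓ / 2) with hS
  have hSm : MeasurableSet S := measurableSet_Ioo.inter measurableSet_Ici
  calc ∫⁻ r in S, ‖g z‖ₑ ^ α * (profile ω r * ENNReal.ofReal r)
      ≤ ∫⁻ r in S, ENNReal.ofReal (2 / (ℓ * Real.pi)) * (profile ω r * ENNReal.ofReal r *
          ∫⁻ θ in Ioo (-Real.pi) Real.pi, G (r * Complex.exp (θ * Complex.I))) := by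
        refine setLIntegral_mono' hSm fun r hr => ?_
        calc _ ≤ ENNReal.ofReal (2 / (ℓ * Real.pi)) *
              (∫⁻ θ in Ioo (-Real.pi) Real.pi, G (r * Complex.exp (θ * Complex.I))) *
              (profile ω r * ENNReal.ofReal r) := by gcongr; exact hcircle r hr
          _ = _ := by ring
    _ = ENNReal.ofReal (2 / (ℓ * Real.pi)) * ∫⁻ r in S, (profile ω r * ENNReal.ofReal r *
          ∫⁻ θ in Ioo (-Real.pi) Real.pi, G (r * Complex.exp (θ * Complex.I))) := by
        rw [lintegral_const_mul']
        exact ENNReal.ofReal_ne_top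
    _ ≤ _ := by gcongr; exact inter_subset_left

/-- The kernel is raised to an integer power `N`, so that it stays analytic whatever `α` is. -/
theorem exists_natCast_le_two_rpow {α : ℝ} (hα : 0 < α) (K : ℝ≥0) :
    ∃ N : ℕ, 0 < N ∧ (K : ℝ≥0∞) ≤ 2 ^ (α * N) := by
  have h1 : 1 < (2 : ℝ≥0) ^ α := NNReal.one_lt_rpow one_lt_two hα
  obtain ⟨n, hn⟩ := pow_unbounded_of_one_lt K h1
  refine ⟨n + 1, n.succ_pos, ?_⟩
  have h2 : K ≤ ((2 : ℝ≥0) ^ α) ^ (n + 1) := hn.le.trans (pow_le_pow_right₀ h1.le n.le_succ)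
  rw [← NNReal.rpow_mul_natCast] at h2
  have h3 : ((2 : ℝ≥0∞)) ^ (α * ((n + 1 : ℕ) : ℝ)) = (((2 : ℝ≥0) ^ (α * ((n + 1 : ℕ) : ℝ)) : ℝ≥0) : ℝ≥0∞) := by
    rw [ENNReal.coe_rpow_of_ne_zero two_ne_zero]; rfl
  rw [h3]
  exact_mod_cast h2

theorem inv_three_le_enorm_bumpKernel {ξ ζ : ℂ} {ℓ : ℝ} (hξ : ‖ξ‖ = 1) (hζ : ‖ζ‖ ≤ 1) (hℓ : 0 < ℓ)
    (h : ‖ζ - ξ‖ ≤ 2 * ℓ) : (3 : ℝ≥0∞)⁻¹ ≤ ‖bumpKernel ξ ℓ ζ‖ₑ := by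
  rw [← ofReal_norm]
  refine le_trans (le_of_eq ?_) (ENNReal.ofReal_le_ofReal (one_third_le_norm_bumpKernel hξ hζ hℓ h))
  rw [ENNReal.ofReal_inv_of_pos three_pos, ENNReal.ofReal_ofNat]

/-- Pointwise bound for `|f|^α` by weighted means over balls centred at the nearest boundary
point. -/
theorem exists_enorm_rpow_le (h : IsDoublingWeight ω D) {α : ℝ} (hα : 0 < α) :
    ∃ C : ℝ≥0, 0 < C ∧ ∀ f : ℂ → ℂ, DifferentiableOn ℂ f disc → ∀ z ∈ disc, ∀ ξ : ℂ, ‖ξ‖ = 1 →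
      ‖z - ξ‖ = 1 - ‖z‖ → ∀ Λ : ℝ≥0∞, (∀ k : ℕ, 2 ^ k * (1 - ‖z‖) ≤ 8 →
        ∫⁻ ζ in Metric.closedBall ξ (2 ^ k * (1 - ‖z‖)), ‖f ζ‖ₑ ^ α ∂weightedMeasure ω ≤
          Λ * boxMass ω (2 ^ k * (1 - ‖z‖))) → ‖f z‖ₑ ^ α ≤ C * Λ := by
  obtain ⟨N, hN0, hN⟩ := exists_natCast_le_two_rpow hα (4 * D)
  set γ := α * N with hγ
  have hγ0 : 0 < γ := by positivity
  -- The summand 1 only guarantees positivity, as the constant is later inverted.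
  refine ⟨3 ^ γ * (2 ^ γ * 4 * D + 1), by positivity, fun f hf z hz ξ hξ hzξ Λ hΛ => ?_⟩
  have hz1 := mem_disc.1 hz
  set ℓ := 1 - ‖z‖ with hℓ
  have hℓ0 : 0 < ℓ := by linarith
  have hℓ1 : ℓ ≤ 1 := by linarith [norm_nonneg z]
  have hW := weightedMeasure_disc_compl ω
  have hF := aemeasurable_enorm_rpow hW hf.continuousOn α
  have hK := lintegral_bumpKernel_mul_le h hγ0 (by simpa using hN) hW hF hξ hℓ0 (by linarith) hΛ
  -- The localisation: the kernel is at least `1/3` in modulus at `z`, while its decay lets the ball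
  -- bounds `hΛ` control the full integral of `|g|^α`.
  set g : ℂ → ℂ := fun ζ => bumpKernel ξ ℓ ζ ^ N * f ζ with hg
  have hgd : DifferentiableOn ℂ g disc := ((differentiableOn_bumpKernel hξ hℓ0).pow N).mul hf
  have hgn : ∀ ζ, ‖g ζ‖ₑ ^ α = ‖bumpKernel ξ ℓ ζ‖ₑ ^ γ * ‖f ζ‖ₑ ^ α := by
    intro ζ
    simp only [hg]
    rw [enorm_mul, ENNReal.mul_rpow_of_nonneg _ _ hα.le, enorm_pow, ← ENNReal.rpow_natCast,
      ← ENNReal.rpow_mul, hγ, mul_comm (N : ℝ)]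
  have hgrow := enorm_rpow_mul_tailMass_le h hα hgd hz
  simp only [hgn] at hgrow
  have hdoub : boxMass ω ℓ ≤ ENNReal.ofReal ℓ * (D * tailMass ω (ℓ / 2)) := by
    unfold boxMass
    gcongr
    have := h.doubling (ℓ / 2) (by linarith)
    rwa [mul_div_cancel₀ _ two_ne_zero] at this
  have hT0 := h.pos (ℓ / 2) (by linarith)
  have hTt := h.tailMass_ne_top (ℓ / 2)
  have hmain : (3 : ℝ≥0∞)⁻¹ ^ γ * ‖f z‖ₑ ^ α * tailMass ω (ℓ / 2) ≤
      (2 ^ γ * 4 * D * Λ) * tailMass ω (ℓ / 2) := by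
    calc (3 : ℝ≥0∞)⁻¹ ^ γ * ‖f z‖ₑ ^ α * tailMass ω (ℓ / 2)
        ≤ ‖bumpKernel ξ ℓ z‖ₑ ^ γ * ‖f z‖ₑ ^ α * tailMass ω (ℓ / 2) := by
          gcongr
          exact inv_three_le_enorm_bumpKernel hξ hz1.le hℓ0 (by rw [hzξ]; linarith)
      _ ≤ _ := hgrow
      _ ≤ ENNReal.ofReal (2 / ℓ) *
          (2 ^ γ * 2 * (Λ * (ENNReal.ofReal ℓ * (D * tailMass ω (ℓ / 2))))) := by
          gcongr
          exact hK.trans (by gcongr)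
      _ = (ENNReal.ofReal (2 / ℓ) * ENNReal.ofReal ℓ) *
          (2 ^ γ * 2 * D * Λ) * tailMass ω (ℓ / 2) := by ring
      _ = _ := by
          rw [← ENNReal.ofReal_mul (by positivity), div_mul_cancel₀ _ hℓ0.ne', ENNReal.ofReal_ofNat]
          ring
  have h1 := (ENNReal.mul_le_mul_iff_left hT0 hTt).1 hmain
  have h3 : ((3 : ℝ≥0∞)⁻¹) ^ γ = (3 ^ γ)⁻¹ := ENNReal.inv_rpow _ _
  have h30 : (3 : ℝ≥0∞) ^ γ ≠ 0 := (ENNReal.rpow_pos (by norm_num) (by norm_num)).ne'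
  have h3t : (3 : ℝ≥0∞) ^ γ ≠ ∞ := ENNReal.rpow_ne_top_of_nonneg hγ0.le (by norm_num)
  rw [h3, mul_comm, ← div_eq_mul_inv, ENNReal.div_le_iff h30 h3t] at h1
  refine h1.trans ?_
  have hcoe : ((3 ^ γ * (2 ^ γ * 4 * D + 1) : ℝ≥0) : ℝ≥0∞) = 3 ^ γ * (2 ^ γ * 4 * D + 1) := by
    push_cast
    rw [ENNReal.coe_rpow_of_ne_zero three_ne_zero, ENNReal.coe_rpow_of_ne_zero two_ne_zero]
    rfl
  rw [hcoe]
  calc 2 ^ γ * 4 * ↑D * Λ * 3 ^ γ = 3 ^ γ * (2 ^ γ * 4 * ↑D) * Λ := by ring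
    _ ≤ _ := by gcongr; exact le_self_add

/-! ### Covering argument and the sufficiency estimate. -/

/-- This is where `p ≤ q` matters: with `τ = q/p ≥ 1`, estimates on disjoint balls add up. -/
theorem tsum_rpow_le {ι : Type*} (x : ι → ℝ≥0∞) {τ : ℝ} (hτ : 1 ≤ τ) :
    ∑' i, x i ^ τ ≤ (∑' i, x i) ^ τ := by
  have hsplit : ∀ y : ℝ≥0∞, y ^ τ = y ^ (τ - 1) * y := fun y => by
    conv_lhs => rw [show τ = (τ - 1) + 1 by ring,
      ENNReal.rpow_add_of_nonneg _ _ (by linarith) zero_le_one, ENNReal.rpow_one]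
  rw [hsplit (∑' i, x i), ← ENNReal.tsum_mul_left]
  refine ENNReal.tsum_le_tsum fun i => ?_
  rw [hsplit]
  gcongr
  exact ENNReal.le_tsum i

/-- `μ` obeys the Carleson condition on balls centred on the unit circle. -/
def BallCondition (ω : ℂ → ℝ) (τ : ℝ) (μ : Measure ℂ) (K : ℝ≥0∞) : Prop :=
  ∀ ξ : ℂ, ‖ξ‖ = 1 → ∀ ρ : ℝ, 0 < ρ → ρ ≤ 8 →
    μ (Metric.closedBall ξ (5 * ρ)) ≤ K * boxMass ω ρ ^ τ

/-- Covering estimate: a set covered by boundary balls on which `φ` has a large mean. -/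
theorem BallCondition.measure_le {τ : ℝ} {μ : Measure ℂ} {K : ℝ≥0∞} (hμ : BallCondition ω τ μ K)
    (hτ : 1 ≤ τ) (φ : ℂ → ℝ≥0∞) (s : ℝ≥0∞) {E : Set ℂ}
    (hE : ∀ z ∈ E, ∃ ξ : ℂ, ∃ ρ : ℝ, ‖ξ‖ = 1 ∧ 0 < ρ ∧ ρ ≤ 8 ∧ z ∈ Metric.closedBall ξ ρ ∧
      boxMass ω ρ ≤ s * ∫⁻ ζ in Metric.closedBall ξ ρ, φ ζ ∂weightedMeasure ω) :
    μ E ≤ K * (s * ∫⁻ ζ, φ ζ ∂weightedMeasure ω) ^ τ := by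
  set T : Set (ℂ × ℝ) := {a | ‖a.1‖ = 1 ∧ 0 < a.2 ∧ a.2 ≤ 8 ∧
    boxMass ω a.2 ≤ s * ∫⁻ ζ in Metric.closedBall a.1 a.2, φ ζ ∂weightedMeasure ω} with hT
  -- The enlargement factor 5 is the one built into `BallCondition`.
  obtain ⟨u, huT, hdisj, hcov⟩ := Vitali.exists_disjoint_subfamily_covering_enlargement_closedBall
    T (fun a => a.1) (fun a => a.2) 8 (fun a ha => ha.2.2.1) 5 (by norm_num)
  have hcount : u.Countable := hdisj.countable_of_nonempty_interior fun a ha =>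
    (Metric.nonempty_ball.2 (huT ha).2.1).mono Metric.ball_subset_interior_closedBall
  have hsub : E ⊆ ⋃ a ∈ u, Metric.closedBall a.1 (5 * a.2) := by
    intro z hz
    obtain ⟨ξ, ρ, h1, h2, h3, h4, h5⟩ := hE z hz
    obtain ⟨b, hb, hsub⟩ := hcov (ξ, ρ) ⟨h1, h2, h3, h5⟩
    exact mem_biUnion hb (hsub h4)
  calc μ E ≤ ∑' a : u, μ (Metric.closedBall (a : ℂ × ℝ).1 (5 * (a : ℂ × ℝ).2)) :=
        (measure_mono hsub).trans (measure_biUnion_le μ hcount _)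
    _ ≤ ∑' a : u, K * (s * ∫⁻ ζ in Metric.closedBall (a : ℂ × ℝ).1 (a : ℂ × ℝ).2, φ ζ
          ∂weightedMeasure ω) ^ τ := by
        refine ENNReal.tsum_le_tsum fun a => ?_
        obtain ⟨h1, h2, h3, h4⟩ := huT a.2
        refine (hμ _ h1 _ h2 h3).trans ?_
        gcongr
    _ ≤ K * (∑' a : u, s * ∫⁻ ζ in Metric.closedBall (a : ℂ × ℝ).1 (a : ℂ × ℝ).2, φ ζ
          ∂weightedMeasure ω) ^ τ := by
        rw [ENNReal.tsum_mul_left]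
        gcongr
        exact tsum_rpow_le _ hτ
    _ ≤ _ := by
        rw [ENNReal.tsum_mul_left, ← lintegral_biUnion hcount (fun _ _ => measurableSet_closedBall)
          hdisj]
        gcongr
        exact Measure.restrict_le_self

/-- The boundary ball through a point of the disc. -/
theorem exists_nearest_boundary_point (z : ℂ) (hz : z ∈ disc) :
    ∃ ξ : ℂ, ‖ξ‖ = 1 ∧ ‖z - ξ‖ = 1 - ‖z‖ := by
  have hz1 := mem_disc.1 hz
  rcases eq_or_ne z 0 with rfl | h0
  · exact ⟨1, norm_one, by simp⟩
  · have hn : ‖z‖ ≠ 0 := norm_ne_zero_iff.2 h0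
    refine ⟨z / ‖z‖, ?_, ?_⟩
    · rw [norm_div, Complex.norm_real, norm_norm, div_self hn]
    · have hnc : (‖z‖ : ℂ) ≠ 0 := Complex.ofReal_ne_zero.2 hn
      have : z - z / ‖z‖ = -(((1 - ‖z‖ : ℝ) : ℂ) * (z / ‖z‖)) := by
        push_cast; field_simp; ring
      rw [this, norm_neg, norm_mul, norm_div, Complex.norm_real, Complex.norm_real, norm_norm,
        div_self hn, mul_one, Real.norm_of_nonneg (by linarith)]

/-- The sufficiency estimate for Carleson measures. -/
theorem exists_lintegral_rpow_le (h : IsDoublingWeight ω D) {p q : ℝ} (hp : 0 < p) (hpq : p ≤ q) :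
    ∃ C : ℝ≥0, ∀ (μ : Measure ℂ) (K : ℝ≥0∞), μ discᶜ = 0 → BallCondition ω (q / p) μ K →
      ∀ f : ℂ → ℂ, DifferentiableOn ℂ f disc →
        ∫⁻ z, ‖f z‖ₑ ^ q ∂μ ≤ C * K * (∫⁻ z, ‖f z‖ₑ ^ p ∂weightedMeasure ω) ^ (q / p) := by
  set τ := q / p with hτdef
  have hτ : 1 ≤ τ := (one_le_div hp).2 hpq
  -- Any `α < p` would leave room for a maximal inequality; `p/2` turns `|f|^p` into the square of
  -- `G = |f|^α`.
  set α := p / 2 with hα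
  have hα0 : 0 < α := by positivity
  obtain ⟨C₀, hC₀, hpt⟩ := exists_enorm_rpow_le h hα0
  refine ⟨C₀ ^ (2 * τ) * (Real.toNNReal (2 * τ) * (2 ^ τ * 4 ^ τ)), fun μ K hμ hK f hf => ?_⟩
  have hW := weightedMeasure_disc_compl ω
  set G : ℂ → ℝ := disc.indicator fun z => ‖f z‖ ^ α with hG
  have hG0 : ∀ z, 0 ≤ G z := fun z => indicator_nonneg (fun z _ => by positivity) z
  have hGm : Measurable G := by
    classical
    have h1 : ContinuousOn (fun ζ => ‖f ζ‖ ^ α) disc :=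
      hf.continuousOn.norm.rpow_const fun _ _ => Or.inr hα0.le
    have h2 := h1.measurable_piecewise (g := 0) continuousOn_const measurableSet_disc
    rwa [piecewise_eq_indicator] at h2
  have hGe : ∀ z ∈ disc, ENNReal.ofReal (G z) = ‖f z‖ₑ ^ α := fun z hz => by
    rw [hG, indicator_of_mem hz, ← ofReal_norm, ENNReal.ofReal_rpow_of_nonneg (norm_nonneg _) hα0.le]
  set A := ∫⁻ z, ‖f z‖ₑ ^ p ∂weightedMeasure ω with hA
  have hAG : A = ∫⁻ z, ENNReal.ofReal (G z) ^ 2 ∂weightedMeasure ω :=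
    lintegral_congr_ae ((ae_mem_disc hW).mono fun z hz => by
      simp only [hGe z hz]
      rw [← ENNReal.rpow_mul_natCast, hα]
      congr 1; push_cast; ring)
  -- Truncation at `t/4`: a boundary ball has mass at most `2 * boxMass`, so the discarded part
  -- contributes at most `(t/2) * boxMass`, half of the integral available.
  set φ : ℝ → ℂ → ℝ≥0∞ := fun t => {z | t / 4 < G z}.indicator fun z => ENNReal.ofReal (G z) with hφ
  have hset : ∀ t, MeasurableSet {z | t / 4 < G z} := fun t => measurableSet_lt measurable_const hGm
  have hφm : ∀ t, Measurable (φ t) := fun t => (ENNReal.measurable_ofReal.comp hGm).indicator (hset t)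
  set I : ℝ → ℝ≥0∞ := fun t => ∫⁻ z, φ t z ∂weightedMeasure ω with hI
  have hlevel : ∀ t, 0 < t → μ {z | t < (C₀ : ℝ)⁻¹ * G z} ≤ K * (ENNReal.ofReal (2 / t) * I t) ^ τ := by
    intro t ht
    refine hK.measure_le hτ (φ t) _ fun z hz => ?_
    have hz1 : t < (C₀ : ℝ)⁻¹ * G z := hz
    have hC₀' : (0 : ℝ) < C₀ := hC₀
    have hzd : z ∈ disc := by
      by_contra hcon
      rw [hG, indicator_of_notMem hcon, mul_zero] at hz1
      linarith
    obtain ⟨ξ, hξ, hzξ⟩ := exists_nearest_boundary_point z hzd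
    have hfz : ¬ ‖f z‖ₑ ^ α ≤ C₀ * ENNReal.ofReal t := by
      rw [← hGe z hzd, not_le, ← ENNReal.ofReal_coe_nnreal, ← ENNReal.ofReal_mul hC₀'.le]
      refine ENNReal.ofReal_lt_ofReal_iff_of_nonneg (by positivity) |>.2 ?_
      rwa [← div_eq_inv_mul, lt_div_iff₀ hC₀', mul_comm] at hz1
    -- Contrapositive of the maximal bound with `Λ = t`: some dyadic ball through `z` carries an
    -- integral of `|f|^α` above `t * boxMass`.
    have hex := mt (hpt f hf z hzd ξ hξ hzξ (ENNReal.ofReal t)) hfz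
    push Not at hex
    obtain ⟨k, hk8, hk⟩ := hex
    have hzl := mem_disc.1 hzd
    set ρ := 2 ^ k * (1 - ‖z‖) with hρ
    have hρ0 : 0 < ρ := mul_pos (by positivity) (by linarith)
    refine ⟨ξ, ρ, hξ, hρ0, hk8, ?_, ?_⟩
    · rw [mem_closedBall_iff_norm, hzξ, hρ]
      exact le_mul_of_one_le_left (by linarith) (one_le_pow₀ one_le_two)
    · have hball := weightedMeasure_closedBall_le h.radial h.cont hξ hρ0
      have hsplit : ∫⁻ ζ in Metric.closedBall ξ ρ, ‖f ζ‖ₑ ^ α ∂weightedMeasure ω ≤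
          ∫⁻ ζ in Metric.closedBall ξ ρ, φ t ζ ∂weightedMeasure ω +
            ENNReal.ofReal (t / 2) * boxMass ω ρ := by
        calc ∫⁻ ζ in Metric.closedBall ξ ρ, ‖f ζ‖ₑ ^ α ∂weightedMeasure ω
            ≤ ∫⁻ ζ in Metric.closedBall ξ ρ, (φ t ζ + ENNReal.ofReal (t / 4)) ∂weightedMeasure ω := by
              refine lintegral_mono_ae (ae_restrict_of_ae ((ae_mem_disc hW).mono fun ζ hζ => ?_))
              rw [← hGe ζ hζ]
              by_cases hc : t / 4 < G ζ
              · simp only [hφ]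
                rw [indicator_of_mem (show ζ ∈ {z | t / 4 < G z} from hc)]
                exact le_self_add
              · exact (ENNReal.ofReal_le_ofReal (not_lt.1 hc)).trans le_add_self
          _ = ∫⁻ ζ in Metric.closedBall ξ ρ, φ t ζ ∂weightedMeasure ω +
                ENNReal.ofReal (t / 4) * weightedMeasure ω (Metric.closedBall ξ ρ) := by
              rw [lintegral_add_left (hφm t), setLIntegral_const]
          _ ≤ ∫⁻ ζ in Metric.closedBall ξ ρ, φ t ζ ∂weightedMeasure ω +
                ENNReal.ofReal (t / 4) * (ENNReal.ofReal (2 * ρ) * tailMass ω ρ) := by gcongr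
          _ = _ := by
              clear_value ρ
              rw [boxMass, ← mul_assoc, ← mul_assoc, ← ENNReal.ofReal_mul (by positivity),
                ← ENNReal.ofReal_mul (by positivity)]
              congr 3
              ring
      have hVt : ENNReal.ofReal (t / 2) * boxMass ω ρ ≠ ∞ :=
        ENNReal.mul_ne_top ENNReal.ofReal_ne_top (h.boxMass_ne_top ρ)
      have hdouble : ENNReal.ofReal t * boxMass ω ρ =
          ENNReal.ofReal (t / 2) * boxMass ω ρ + ENNReal.ofReal (t / 2) * boxMass ω ρ := by
        rw [← add_mul, ← ENNReal.ofReal_add (by positivity) (by positivity), add_halves]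
      have hlt := hk.trans_le hsplit
      rw [hdouble] at hlt
      have hle := (ENNReal.add_lt_add_iff_right hVt).1 hlt
      calc boxMass ω ρ = ENNReal.ofReal (2 / t) * (ENNReal.ofReal (t / 2) * boxMass ω ρ) := by
            rw [← mul_assoc, ← ENNReal.ofReal_mul (by positivity)]
            have : 2 / t * (t / 2) = 1 := by field_simp
            rw [this, ENNReal.ofReal_one, one_mul]
        _ ≤ _ := by gcongr
  have hcheb : ∀ t, 0 < t → I t ≤ ENNReal.ofReal (4 / t) * A := by
    intro t ht
    rw [hAG, ← lintegral_const_mul (f := fun z => ENNReal.ofReal (G z) ^ 2) _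
      ((ENNReal.measurable_ofReal.comp hGm).pow_const 2)]
    refine lintegral_mono fun z => ?_
    by_cases hc : t / 4 < G z
    · simp only [hφ]
      rw [indicator_of_mem (show z ∈ {z | t / 4 < G z} from hc), sq, ← mul_assoc,
        ← ENNReal.ofReal_mul (by positivity)]
      refine le_mul_of_one_le_left' ?_
      rw [ENNReal.one_le_ofReal, div_mul_eq_mul_div, one_le_div ht]
      linarith
    · simp only [hφ]
      rw [indicator_of_notMem (show z ∉ {z | t / 4 < G z} from hc)]
      exact zero_le
  have htau : ∀ y : ℝ≥0∞, y ^ τ = y ^ (τ - 1) * y := fun y => by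
    conv_lhs => rw [show τ = (τ - 1) + 1 by ring,
      ENNReal.rpow_add_of_nonneg _ _ (by linarith) zero_le_one, ENNReal.rpow_one]
  -- Of the `τ` powers of `I t`, `τ - 1` are bounded by the Chebyshev estimate. The powers of `t`
  -- then cancel exactly, and the one remaining factor `I t` is integrable in `t`.
  have hweak : ∀ t, 0 < t → μ {z | t < (C₀ : ℝ)⁻¹ * G z} * ENNReal.ofReal (t ^ (2 * τ - 1)) ≤
      K * (2 ^ τ * 4 ^ (τ - 1) * A ^ (τ - 1)) * I t := by
    intro t ht
    have hpow : ENNReal.ofReal (2 / t) ^ τ * (ENNReal.ofReal (4 / t) ^ (τ - 1)) *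
        ENNReal.ofReal (t ^ (2 * τ - 1)) = 2 ^ τ * 4 ^ (τ - 1) := by
      rw [ENNReal.ofReal_rpow_of_nonneg (by positivity) (by linarith),
        ENNReal.ofReal_rpow_of_nonneg (by positivity) (by linarith),
        ← ENNReal.ofReal_mul (by positivity), ← ENNReal.ofReal_mul (by positivity),
        Real.div_rpow two_pos.le ht.le, Real.div_rpow (by norm_num) ht.le]
      have h1 : t ^ (2 * τ - 1) = t ^ τ * t ^ (τ - 1) := by
        rw [← Real.rpow_add ht]; congr 1; ring
      have h2 : 0 < t ^ τ := Real.rpow_pos_of_pos ht _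
      have h3 : 0 < t ^ (τ - 1) := Real.rpow_pos_of_pos ht _
      have h4 : (2 : ℝ) ^ τ / t ^ τ * (4 ^ (τ - 1) / t ^ (τ - 1)) * t ^ (2 * τ - 1) =
          2 ^ τ * 4 ^ (τ - 1) := by
        rw [h1]; field_simp
      rw [h4, ENNReal.ofReal_mul (by positivity),
        ← ENNReal.ofReal_rpow_of_nonneg two_pos.le (by linarith),
        ← ENNReal.ofReal_rpow_of_nonneg (by norm_num) (by linarith), ENNReal.ofReal_ofNat,
        ENNReal.ofReal_ofNat]
    calc μ {z | t < (C₀ : ℝ)⁻¹ * G z} * ENNReal.ofReal (t ^ (2 * τ - 1))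
        ≤ K * (ENNReal.ofReal (2 / t) * I t) ^ τ * ENNReal.ofReal (t ^ (2 * τ - 1)) := by
          gcongr; exact hlevel t ht
      _ = K * (ENNReal.ofReal (2 / t) ^ τ * (I t ^ (τ - 1) * I t)) *
            ENNReal.ofReal (t ^ (2 * τ - 1)) := by
          rw [ENNReal.mul_rpow_of_nonneg _ _ (by linarith), htau (I t)]
      _ ≤ K * (ENNReal.ofReal (2 / t) ^ τ * ((ENNReal.ofReal (4 / t) * A) ^ (τ - 1) * I t)) *
            ENNReal.ofReal (t ^ (2 * τ - 1)) := by
          gcongr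
          exact hcheb t ht
      _ = K * ((ENNReal.ofReal (2 / t) ^ τ * (ENNReal.ofReal (4 / t) ^ (τ - 1)) *
            ENNReal.ofReal (t ^ (2 * τ - 1))) * A ^ (τ - 1)) * I t := by
          rw [ENNReal.mul_rpow_of_nonneg _ _ (by linarith)]; ring
      _ = _ := by rw [hpow]
  have hjoint : Measurable (Function.uncurry fun (t : ℝ) (z : ℂ) => φ t z) := by
    have h1 : MeasurableSet {x : ℝ × ℂ | x.1 / 4 < G x.2} :=
      measurableSet_lt (by fun_prop) (hGm.comp measurable_snd)
    exact (ENNReal.measurable_ofReal.comp (hGm.comp measurable_snd)).indicator h1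
  have : SFinite (weightedMeasure ω) := by
    unfold weightedMeasure areaMeasure; infer_instance
  have hIm : Measurable I := hjoint.lintegral_prod_right'
  -- By Tonelli: for fixed `z` the truncation is active precisely for `t < 4 G(z)`, giving `4
  -- G(z)²`.
  have hIint : ∫⁻ t in Ioi (0 : ℝ), I t = 4 * A := by
    simp only [hI]
    rw [lintegral_lintegral_swap hjoint.aemeasurable, hAG,
      ← lintegral_const_mul (f := fun z => ENNReal.ofReal (G z) ^ 2) _
      ((ENNReal.measurable_ofReal.comp hGm).pow_const 2)]
    refine lintegral_congr fun z => ?_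
    have h1 : ∀ t, φ t z = (Iio (4 * G z)).indicator (fun _ => ENNReal.ofReal (G z)) t := by
      intro t
      simp only [hφ, indicator, mem_ofPred_eq, mem_Iio]
      congr 1
      rw [div_lt_iff₀ (by norm_num), mul_comm]
    simp only [h1]
    rw [setLIntegral_indicator measurableSet_Iio, setLIntegral_const, inter_comm, Ioi_inter_Iio,
      Real.volume_Ioo, sub_zero, ENNReal.ofReal_mul (by norm_num), ENNReal.ofReal_ofNat]
    ring
  have hlayer := lintegral_rpow_eq_lintegral_meas_lt_mul μ (f := fun z => (C₀ : ℝ)⁻¹ * G z)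
    (ae_of_all _ fun z => mul_nonneg (by positivity) (hG0 z))
    (hGm.const_mul _).aemeasurable (p := 2 * τ) (by linarith)
  have hq : ∫⁻ z, ‖f z‖ₑ ^ q ∂μ =
      C₀ ^ (2 * τ) * ∫⁻ z, ENNReal.ofReal (((C₀ : ℝ)⁻¹ * G z) ^ (2 * τ)) ∂μ := by
    have hC₀e : (C₀ : ℝ≥0∞) = ENNReal.ofReal C₀ := (ENNReal.ofReal_coe_nnreal).symm
    have hCt : ((C₀ : ℝ≥0∞)) ^ (2 * τ) ≠ ∞ :=
      ENNReal.rpow_ne_top_of_nonneg (by linarith) ENNReal.coe_ne_top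
    rw [← lintegral_const_mul' _ _ hCt]
    refine lintegral_congr_ae ((ae_mem_disc hμ).mono fun z hz => ?_)
    have h2 : (0 : ℝ) ≤ (C₀ : ℝ)⁻¹ * G z := mul_nonneg (by positivity) (hG0 z)
    simp only
    rw [← ENNReal.ofReal_rpow_of_nonneg h2 (by linarith),
      ← ENNReal.mul_rpow_of_nonneg _ _ (by linarith), hC₀e,
      ← ENNReal.ofReal_mul (NNReal.coe_nonneg C₀), ← mul_assoc, mul_inv_cancel₀ (by exact_mod_cast hC₀.ne'), one_mul,
      hGe z hz, ← ENNReal.rpow_mul]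
    congr 1
    rw [hα, hτdef]; field_simp
  rw [hq, hlayer]
  have hcoe : ((C₀ ^ (2 * τ) * (Real.toNNReal (2 * τ) * (2 ^ τ * 4 ^ τ)) : ℝ≥0) : ℝ≥0∞) =
      C₀ ^ (2 * τ) * (ENNReal.ofReal (2 * τ) * (2 ^ τ * 4 ^ τ)) := by
    push_cast
    rw [ENNReal.coe_rpow_of_nonneg _ (by linarith), ENNReal.coe_rpow_of_nonneg _ (by linarith),
      ENNReal.coe_rpow_of_nonneg _ (by linarith)]
    rfl
  rw [hcoe]
  calc (C₀ : ℝ≥0∞) ^ (2 * τ) * (ENNReal.ofReal (2 * τ) *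
        ∫⁻ t in Ioi 0, μ {z | t < (C₀ : ℝ)⁻¹ * G z} * ENNReal.ofReal (t ^ (2 * τ - 1)))
      ≤ (C₀ : ℝ≥0∞) ^ (2 * τ) * (ENNReal.ofReal (2 * τ) *
        ∫⁻ t in Ioi 0, K * (2 ^ τ * 4 ^ (τ - 1) * A ^ (τ - 1)) * I t) := by
        refine mul_le_mul_right (mul_le_mul_right ?_ _) _
        exact setLIntegral_mono' measurableSet_Ioi fun t ht => hweak t ht
    _ = C₀ ^ (2 * τ) * (ENNReal.ofReal (2 * τ) *
          (K * (2 ^ τ * 4 ^ (τ - 1) * A ^ (τ - 1)) * (4 * A))) := by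
        rw [lintegral_const_mul _ hIm, hIint]
    _ = C₀ ^ (2 * τ) * (ENNReal.ofReal (2 * τ) * (2 ^ τ * (4 ^ (τ - 1) * 4))) * K *
          (A ^ (τ - 1) * A) := by ring
    _ = _ := by rw [← htau, ← htau]

/-! ### Norm identities and transfer from squares to balls. -/

theorem bergmanNorm_eq (hω : IsRadialWeight ω) (p : ℝ) (f : ℂ → ℂ) :
    bergmanNorm p ω f = (∫⁻ z, ‖f z‖ₑ ^ p ∂weightedMeasure ω) ^ (1 / p) := by
  rw [bergmanNorm, weightedMeasure, lintegral_withDensity_eq_lintegral_mul_non_measurable₀ _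
    hω.1.2.1.aemeasurable.ennreal_ofReal (ae_of_all _ fun z => ENNReal.ofReal_lt_top)]
  congr 1
  exact lintegral_congr fun z => mul_comm _ _

theorem bergmanNorm_rpow (hω : IsRadialWeight ω) {p : ℝ} (hp : 0 < p) (f : ℂ → ℂ) :
    bergmanNorm p ω f ^ p = ∫⁻ z, ‖f z‖ₑ ^ p ∂weightedMeasure ω := by
  rw [bergmanNorm_eq hω, ← ENNReal.rpow_mul, one_div_mul_cancel hp.ne', ENNReal.rpow_one]

theorem eLpNorm_ofReal_rpow {q : ℝ} (hq : 0 < q) (f : ℂ → ℂ) (μ : Measure ℂ) :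
    eLpNorm f (ENNReal.ofReal q) μ ^ q = ∫⁻ z, ‖f z‖ₑ ^ q ∂μ := by
  rw [eLpNorm_eq_lintegral_rpow_enorm_toReal (ENNReal.ofReal_pos.2 hq).ne' ENNReal.ofReal_ne_top,
    ENNReal.toReal_ofReal hq.le, ← ENNReal.rpow_mul, one_div_mul_cancel hq.ne', ENNReal.rpow_one]

namespace IsDoublingWeight

theorem boxMass_le_weightMass (h : IsDoublingWeight ω D) {J : Set ℝ} (hJ : IsArc J) :
    boxMass ω (arcLength J) ≤ ENNReal.ofReal Real.pi * weightMass ω (carlesonSquare J) := by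
  obtain ⟨h0, -, h1, -⟩ := hJ.exists_center h.radial h.cont
  have hpi := Real.pi_pos
  rw [weightMass_eq]
  refine le_trans (le_of_eq ?_) (mul_le_mul_right h1 _)
  rw [← mul_assoc, ← ENNReal.ofReal_mul hpi.le, mul_inv_cancel_left₀ hpi.ne', boxMass]

theorem weightMass_le_boxMass (h : IsDoublingWeight ω D) {J : Set ℝ} (hJ : IsArc J) :
    weightMass ω (carlesonSquare J) ≤ 4 * D * boxMass ω (arcLength J) := by
  obtain ⟨h0, -, -, ξ, hξ, hsub⟩ := hJ.exists_center h.radial h.cont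
  rw [weightMass_eq]
  calc weightedMeasure ω (carlesonSquare J)
      ≤ weightedMeasure ω (Metric.closedBall ξ (2 * arcLength J)) := measure_mono hsub
    _ ≤ ENNReal.ofReal (2 * (2 * arcLength J)) * tailMass ω (2 * arcLength J) :=
        weightedMeasure_closedBall_le h.radial h.cont hξ (by positivity)
    _ ≤ ENNReal.ofReal (2 * (2 * arcLength J)) * (D * tailMass ω (arcLength J)) := by
        gcongr; exact h.doubling _ h0
    _ = _ := by
        rw [boxMass, ← mul_assoc 2 2 (arcLength J), ENNReal.ofReal_mul (by norm_num)]
        have : ENNReal.ofReal (2 * 2) = 4 := by norm_num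
        rw [this]; ring

theorem weightMass_ne_zero (h : IsDoublingWeight ω D) {J : Set ℝ} (hJ : IsArc J) :
    weightMass ω (carlesonSquare J) ≠ 0 := by
  intro hcon
  have := h.boxMass_le_weightMass hJ
  rw [hcon, mul_zero, nonpos_iff_eq_zero] at this
  exact h.boxMass_ne_zero (hJ.exists_center h.radial h.cont).1 this

theorem weightMass_ne_top (h : IsDoublingWeight ω D) {J : Set ℝ} (hJ : IsArc J) :
    weightMass ω (carlesonSquare J) ≠ ∞ :=
  ne_top_of_le_ne_top (ENNReal.mul_ne_top (ENNReal.mul_ne_top ENNReal.ofNat_ne_top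
    ENNReal.coe_ne_top) (h.boxMass_ne_top _)) (h.weightMass_le_boxMass hJ)

/-- Squares have positive finite weighted mass, so the extended-real division has no degenerate
cases. -/
theorem carlesonRatio_le_iff (h : IsDoublingWeight ω D) {p q : ℝ} (hp : 0 < p) (hpq : p ≤ q)
    (μ : Measure ℂ) {J : Set ℝ} (hJ : IsArc J) {K : ℝ≥0∞} :
    carlesonRatio p q ω μ J ≤ K ↔
      μ (carlesonSquare J) ≤ K * weightMass ω (carlesonSquare J) ^ (q / p) := by
  have hτ : 0 ≤ q / p := div_nonneg (hp.le.trans hpq) hp.le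
  exact ENNReal.div_le_iff
    (ENNReal.rpow_pos (pos_iff_ne_zero.2 (h.weightMass_ne_zero hJ)) (h.weightMass_ne_top hJ)).ne'
    (ENNReal.rpow_ne_top_of_nonneg hτ (h.weightMass_ne_top hJ))

/-- Bounds on Carleson squares transfer to boundary balls. -/
theorem measure_closedBall_le (h : IsDoublingWeight ω D) {p q : ℝ} (hp : 0 < p) (hpq : p ≤ q)
    {μ : Measure ℂ} (hμ : μ discᶜ = 0) {K : ℝ≥0∞} {ξ : ℂ} (hξ : ‖ξ‖ = 1) {ρ : ℝ} (hρ : 0 < ρ)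
    (hK : ∀ J, IsArc J → arcLength J ≤ 10 * Real.pi * ρ → carlesonRatio p q ω μ J ≤ K) :
    μ (Metric.closedBall ξ (5 * ρ)) ≤
      (4 * D * (2 * D) ^ 5) ^ (q / p) * K * boxMass ω ρ ^ (q / p) := by
  have hτ : 0 ≤ q / p := div_nonneg (hp.le.trans hpq) hp.le
  obtain ⟨J, hJ, hlen, hsub⟩ := exists_arc_closedBall_subset hξ (ρ := 5 * ρ) (by positivity)
  have hlen' : arcLength J ≤ 10 * Real.pi * ρ := hlen.trans (le_of_eq (by ring))
  have h1 := (h.carlesonRatio_le_iff hp hpq μ hJ).1 (hK J hJ hlen')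
  have h2 : μ (Metric.closedBall ξ (5 * ρ)) ≤ μ (carlesonSquare J) := by
    rw [← restrict_disc hμ, Measure.restrict_apply measurableSet_closedBall, restrict_disc hμ]
    exact measure_mono hsub
  -- Five doublings are enough because `10π < 32`.
  have h3 : boxMass ω (arcLength J) ≤ (2 * D) ^ 5 * boxMass ω ρ := by
    refine le_trans (boxMass_mono ω ?_) (h.boxMass_two_pow hρ 5)
    have := Real.pi_lt_d2
    nlinarith
  calc μ (Metric.closedBall ξ (5 * ρ)) ≤ K * weightMass ω (carlesonSquare J) ^ (q / p) := h2.trans h1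
    _ ≤ K * (4 * D * ((2 * D) ^ 5 * boxMass ω ρ)) ^ (q / p) := by
        gcongr
        exact (h.weightMass_le_boxMass hJ).trans (by gcongr)
    _ = _ := by
        rw [← mul_assoc, ENNReal.mul_rpow_of_nonneg _ _ hτ]; ring

theorem ballCondition_carlesonSup (h : IsDoublingWeight ω D) {p q : ℝ} (hp : 0 < p) (hpq : p ≤ q)
    {μ : Measure ℂ} (hμ : μ discᶜ = 0) :
    BallCondition ω (q / p) μ ((4 * D * (2 * D) ^ 5) ^ (q / p) * carlesonSup p q ω μ) :=
  fun _ hξ _ hρ _ => h.measure_closedBall_le hp hpq hμ hξ hρ fun J hJ _ =>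
    le_iSup₂ (f := fun J (_ : IsArc J) => carlesonRatio p q ω μ J) J hJ

/-- Sufficiency, in terms of norms. -/
theorem exists_eLpNorm_rpow_le (h : IsDoublingWeight ω D) {p q : ℝ} (hp : 0 < p) (hpq : p ≤ q) :
    ∃ C : ℝ≥0, ∀ (μ : Measure ℂ) (K : ℝ≥0∞), μ discᶜ = 0 → BallCondition ω (q / p) μ K →
      ∀ f : ℂ → ℂ, DifferentiableOn ℂ f disc →
        eLpNorm f (ENNReal.ofReal q) μ ^ q ≤ C * K * bergmanNorm p ω f ^ q := by
  have hq := hp.trans_le hpq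
  obtain ⟨C, hC⟩ := exists_lintegral_rpow_le h hp hpq
  refine ⟨C, fun μ K hμ hK f hf => ?_⟩
  rw [eLpNorm_ofReal_rpow hq]
  refine (hC μ K hμ hK f hf).trans (le_of_eq ?_)
  rw [← bergmanNorm_rpow h.radial hp, ← ENNReal.rpow_mul, mul_div_cancel₀ _ hp.ne']

end IsDoublingWeight

/-! ### Test functions and the boundedness criterion. -/

/-- Normalized powers of the bump kernel. -/
noncomputable def testFun (ω : ℂ → ℝ) (p : ℝ) (N : ℕ) (ξ : ℂ) (ℓ : ℝ) (ζ : ℂ) : ℂ :=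
  (((4 * 2 ^ (p * N) * boxMass ω ℓ) ^ (-(1 / p))).toReal : ℂ) * bumpKernel ξ ℓ ζ ^ N

section TestFun

variable {p : ℝ} {N : ℕ} {ξ : ℂ} {ℓ : ℝ}

theorem differentiableOn_testFun (hξ : ‖ξ‖ = 1) (hℓ : 0 < ℓ) :
    DifferentiableOn ℂ (testFun ω p N ξ ℓ) disc :=
  ((differentiableOn_bumpKernel hξ hℓ).pow N).const_mul _

theorem testFun_const_ne_zero (h : IsDoublingWeight ω D) (hℓ : 0 < ℓ) :
    4 * 2 ^ (p * N) * boxMass ω ℓ ≠ 0 :=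
  mul_ne_zero (mul_ne_zero (by norm_num) (ENNReal.rpow_pos (by norm_num) (by norm_num)).ne')
    (h.boxMass_ne_zero hℓ)

theorem testFun_const_ne_top (h : IsDoublingWeight ω D) (hp : 0 < p) :
    4 * 2 ^ (p * N) * boxMass ω ℓ ≠ ∞ :=
  ENNReal.mul_ne_top (ENNReal.mul_ne_top ENNReal.ofNat_ne_top
    (ENNReal.rpow_ne_top_of_nonneg (by positivity) ENNReal.ofNat_ne_top)) (h.boxMass_ne_top _)

theorem enorm_testFun_rpow (h : IsDoublingWeight ω D) (hp : 0 < p) (hℓ : 0 < ℓ) {s : ℝ}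
    (hs : 0 ≤ s) (ζ : ℂ) :
    ‖testFun ω p N ξ ℓ ζ‖ₑ ^ s =
      ((4 * 2 ^ (p * N) * boxMass ω ℓ) ^ (s / p))⁻¹ * ‖bumpKernel ξ ℓ ζ‖ₑ ^ (s * N) := by
  have h0 := testFun_const_ne_zero (p := p) (N := N) h hℓ
  have ht := testFun_const_ne_top (N := N) (ℓ := ℓ) h hp
  have hc : (4 * 2 ^ (p * N) * boxMass ω ℓ) ^ (-(1 / p)) ≠ ∞ := by
    rw [ENNReal.rpow_neg]
    exact ENNReal.inv_ne_top.2 (ENNReal.rpow_pos (pos_iff_ne_zero.2 h0) ht).ne'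
  rw [testFun, enorm_mul, ENNReal.mul_rpow_of_nonneg _ _ hs, enorm_pow, ← ENNReal.rpow_natCast,
    ← ENNReal.rpow_mul, mul_comm (N : ℝ) s]
  congr 1
  rw [← ofReal_norm, Complex.norm_real, Real.norm_of_nonneg ENNReal.toReal_nonneg,
    ENNReal.ofReal_toReal hc, ← ENNReal.rpow_mul, ← ENNReal.rpow_neg]
  congr 1
  ring

/-- The kernel estimate with `F = 1` and `Λ = 2`, the constant in the mass bound for boundary balls;
this explains the factor 4 in the normalisation. -/
theorem bergmanNorm_testFun_le_one (h : IsDoublingWeight ω D) (hp : 0 < p) (hN0 : 0 < N)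
    (hN : 4 * (D : ℝ≥0∞) ≤ 2 ^ (p * N)) (hξ : ‖ξ‖ = 1) (hℓ : 0 < ℓ) (hℓ8 : ℓ ≤ 8) :
    bergmanNorm p ω (testFun ω p N ξ ℓ) ≤ 1 := by
  have h0 := testFun_const_ne_zero (p := p) (N := N) h hℓ
  have ht := testFun_const_ne_top (N := N) (ℓ := ℓ) h hp
  rw [bergmanNorm_eq h.radial]
  refine ENNReal.rpow_le_one ?_ (by positivity)
  simp only [enorm_testFun_rpow h hp hℓ hp.le]
  rw [div_self hp.ne', ENNReal.rpow_one, lintegral_const_mul' _ _ (ENNReal.inv_ne_top.2 h0)]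
  have hK := lintegral_bumpKernel_mul_le h (γ := p * N) (by positivity) hN
    (weightedMeasure_disc_compl ω) (F := fun _ => 1) aemeasurable_const hξ hℓ hℓ8 (Λ := 2)
    fun k _ => by
      rw [setLIntegral_one]
      refine (weightedMeasure_closedBall_le h.radial h.cont hξ (by positivity)).trans (le_of_eq ?_)
      rw [boxMass, ENNReal.ofReal_mul (by norm_num), ENNReal.ofReal_ofNat, mul_assoc]
  simp only [mul_one] at hK
  rw [mul_comm, ← div_eq_mul_inv]
  refine ENNReal.div_le_of_le_mul (hK.trans (le_of_eq ?_))
  rw [one_mul, ← mul_assoc, mul_assoc _ 2 2, mul_comm ((2 : ℝ≥0∞) ^ _)]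
  norm_num

/-- Chebyshev: the kernel is at least `1/3` in modulus on the part of the ball inside the disc. -/
theorem measure_le_eLpNorm_testFun (h : IsDoublingWeight ω D) (hp : 0 < p) {q : ℝ} (hq : 0 < q)
    (hξ : ‖ξ‖ = 1) (hℓ : 0 < ℓ) {μ : Measure ℂ} (hμ : μ discᶜ = 0) {S : Set ℂ}
    (hS : S ⊆ Metric.closedBall ξ (2 * ℓ)) :
    μ S ≤ (4 * 2 ^ (p * N) * boxMass ω ℓ) ^ (q / p) * 3 ^ (q * N) *
      eLpNorm (testFun ω p N ξ ℓ) (ENNReal.ofReal q) μ ^ q := by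
  have h0 := testFun_const_ne_zero (p := p) (N := N) h hℓ
  have ht := testFun_const_ne_top (N := N) (ℓ := ℓ) h hp
  have hτ : 0 < q / p := by positivity
  set c := (4 * 2 ^ (p * N) * boxMass ω ℓ) ^ (q / p) with hc
  have hc0 : c ≠ 0 := (ENNReal.rpow_pos (pos_iff_ne_zero.2 h0) ht).ne'
  have hct : c ≠ ∞ := ENNReal.rpow_ne_top_of_nonneg hτ.le ht
  have h30 : (3 : ℝ≥0∞) ^ (q * N) ≠ 0 := (ENNReal.rpow_pos (by norm_num) (by norm_num)).ne'
  have h3t : (3 : ℝ≥0∞) ^ (q * N) ≠ ∞ :=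
    ENNReal.rpow_ne_top_of_nonneg (by positivity) (by norm_num)
  set B := Metric.closedBall ξ (2 * ℓ) with hB
  have hlow : c⁻¹ * (3 ^ (q * N))⁻¹ * μ B ≤ ∫⁻ ζ, ‖testFun ω p N ξ ℓ ζ‖ₑ ^ q ∂μ := by
    rw [← setLIntegral_const]
    refine le_trans ?_ (setLIntegral_le_lintegral B _)
    refine setLIntegral_mono_ae' measurableSet_closedBall ((ae_mem_disc hμ).mono fun ζ hζ hζB => ?_)
    rw [enorm_testFun_rpow h hp hℓ hq.le, ← ENNReal.inv_rpow 3]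
    gcongr
    exact inv_three_le_enorm_bumpKernel hξ (mem_disc.1 hζ).le hℓ (mem_closedBall_iff_norm.1 hζB)
  rw [eLpNorm_ofReal_rpow hq]
  calc μ S ≤ μ B := measure_mono hS
    _ = (c * c⁻¹) * (3 ^ (q * N) * (3 ^ (q * N))⁻¹) * μ B := by
        rw [ENNReal.mul_inv_cancel hc0 hct, ENNReal.mul_inv_cancel h30 h3t, one_mul, one_mul]
    _ = c * 3 ^ (q * N) * (c⁻¹ * (3 ^ (q * N))⁻¹ * μ B) := by ring
    _ ≤ _ := by gcongr

end TestFun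

/-- Test functions adapted to Carleson squares. -/
theorem carlesonRatio_le_eLpNorm_testFun (h : IsDoublingWeight ω D) {p q : ℝ} (hp : 0 < p)
    (hpq : p ≤ q) (N : ℕ) {J : Set ℝ} (hJ : IsArc J) {ξ : ℂ} (hξ : ‖ξ‖ = 1)
    (hsub : carlesonSquare J ⊆ Metric.closedBall ξ (2 * arcLength J)) {μ : Measure ℂ}
    (hμ : μ discᶜ = 0) :
    carlesonRatio p q ω μ J ≤
      (4 * 2 ^ (p * N) * ENNReal.ofReal Real.pi) ^ (q / p) * 3 ^ (q * N) *
        eLpNorm (testFun ω p N ξ (arcLength J)) (ENNReal.ofReal q) μ ^ q := by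
  have hq := hp.trans_le hpq
  have hτ : 0 < q / p := by positivity
  have hℓ := (hJ.exists_center h.radial h.cont).1
  rw [h.carlesonRatio_le_iff hp hpq μ hJ]
  refine (measure_le_eLpNorm_testFun (N := N) h hp hq hξ hℓ hμ hsub).trans ?_
  calc _ ≤ (4 * 2 ^ (p * N) * (ENNReal.ofReal Real.pi * weightMass ω (carlesonSquare J))) ^ (q / p) *
        3 ^ (q * N) * eLpNorm (testFun ω p N ξ (arcLength J)) (ENNReal.ofReal q) μ ^ q := by
        gcongr; exact h.boxMass_le_weightMass hJ
    _ = _ := by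
        rw [← mul_assoc, ENNReal.mul_rpow_of_nonneg _ _ hτ.le]; ring

theorem embeddingNorm_rpow_le {p q : ℝ} (hp : 0 < p) (hpq : p ≤ q)
    {μ : Measure ℂ} {M : ℝ≥0∞} (hM : ∀ f ∈ bergmanSpace p ω,
      eLpNorm f (ENNReal.ofReal q) μ ^ q ≤ M * bergmanNorm p ω f ^ q) :
    embeddingNorm p q ω μ ^ q ≤ M := by
  have hq := hp.trans_le hpq
  rw [← ENNReal.le_rpow_inv_iff hq]
  refine iSup_le fun f => iSup₂_le fun hf hf1 => ?_
  rw [ENNReal.le_rpow_inv_iff hq]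
  refine (hM f hf).trans (mul_le_of_le_one_right' (ENNReal.rpow_le_one hf1 hq.le))

theorem memLp_of_lt_top {q : ℝ} {μ : Measure ℂ} (hμ : μ discᶜ = 0) {f : ℂ → ℂ}
    (hf : ContinuousOn f disc) (hlt : eLpNorm f (ENNReal.ofReal q) μ < ∞) :
    MemLp f (ENNReal.ofReal q) μ :=
  ⟨(aemeasurable_of_continuousOn_disc hμ hf).aestronglyMeasurable, hlt⟩

namespace IsDoublingWeight

/-- Necessity of the Carleson condition. -/
theorem exists_carlesonSup_le (h : IsDoublingWeight ω D) {p q : ℝ} (hp : 0 < p) (hpq : p ≤ q) :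
    ∃ C : ℝ≥0, ∀ μ : Measure ℂ, μ discᶜ = 0 →
      carlesonSup p q ω μ ≤ C * embeddingNorm p q ω μ ^ q := by
  have hq := hp.trans_le hpq
  have hpi := Real.pi_pos
  obtain ⟨N, hN0, hN⟩ := exists_natCast_le_two_rpow hp (4 * D)
  set C : ℝ≥0∞ := (4 * 2 ^ (p * N) * ENNReal.ofReal Real.pi) ^ (q / p) * 3 ^ (q * N) with hC
  have hCt : C ≠ ∞ := by
    refine ENNReal.mul_ne_top (ENNReal.rpow_ne_top_of_nonneg (by positivity)
      (ENNReal.mul_ne_top (ENNReal.mul_ne_top ENNReal.ofNat_ne_top ?_) ENNReal.ofReal_ne_top)) ?_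
    · exact ENNReal.rpow_ne_top_of_nonneg (by positivity) ENNReal.ofNat_ne_top
    · exact ENNReal.rpow_ne_top_of_nonneg (by positivity) ENNReal.ofNat_ne_top
  refine ⟨C.toNNReal, fun μ hμ => ?_⟩
  rw [ENNReal.coe_toNNReal hCt]
  refine iSup₂_le fun J hJ => ?_
  obtain ⟨hℓ, hℓ2, -, ξ, hξ, hsub⟩ := hJ.exists_center h.radial h.cont
  refine (carlesonRatio_le_eLpNorm_testFun h hp hpq N hJ hξ hsub hμ).trans ?_
  have hle := bergmanNorm_testFun_le_one h hp hN0 (by simpa using hN) hξ hℓ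
    (by linarith [Real.pi_lt_d2])
  gcongr
  exact le_iSup_of_le (testFun ω p N ξ (arcLength J)) (le_iSup_of_le
    ⟨differentiableOn_testFun hξ hℓ, hle.trans_lt ENNReal.one_lt_top⟩ (le_iSup_of_le hle le_rfl))

theorem exists_embeddingNorm_le (h : IsDoublingWeight ω D) {p q : ℝ} (hp : 0 < p) (hpq : p ≤ q) :
    ∃ C : ℝ≥0, ∀ μ : Measure ℂ, μ discᶜ = 0 → ∀ f ∈ bergmanSpace p ω,
      eLpNorm f (ENNReal.ofReal q) μ ^ q ≤ C * carlesonSup p q ω μ * bergmanNorm p ω f ^ q := by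
  have hτ : 0 ≤ q / p := div_nonneg (hp.le.trans hpq) hp.le
  obtain ⟨C, hC⟩ := h.exists_eLpNorm_rpow_le hp hpq
  refine ⟨C * (4 * D * (2 * D) ^ 5) ^ (q / p), fun μ hμ f hf => ?_⟩
  refine (hC μ _ hμ (h.ballCondition_carlesonSup hp hpq hμ) f hf.1).trans (le_of_eq ?_)
  rw [ENNReal.coe_mul, ENNReal.coe_rpow_of_nonneg _ hτ]
  push_cast
  ring

theorem isCarlesonMeasure_of_carlesonSup_lt_top (h : IsDoublingWeight ω D) {p q : ℝ} (hp : 0 < p)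
    (hpq : p ≤ q) {μ : Measure ℂ} (hμ : μ discᶜ = 0) (hsup : carlesonSup p q ω μ < ∞) :
    IsCarlesonMeasure p q ω μ := by
  have hq := hp.trans_le hpq
  obtain ⟨C, hC⟩ := h.exists_embeddingNorm_le hp hpq
  set M := (C * carlesonSup p q ω μ) ^ q⁻¹ with hM
  have hMt : M ≠ ∞ := ENNReal.rpow_ne_top_of_nonneg (by positivity)
    (ENNReal.mul_ne_top ENNReal.coe_ne_top hsup.ne)
  have hle : ∀ f ∈ bergmanSpace p ω, eLpNorm f (ENNReal.ofReal q) μ ≤ M * bergmanNorm p ω f := by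
    intro f hf
    have h1 := ENNReal.rpow_le_rpow (hC μ hμ f hf) (inv_nonneg.2 hq.le)
    rwa [ENNReal.rpow_rpow_inv hq.ne', ENNReal.mul_rpow_of_nonneg _ _ (inv_nonneg.2 hq.le),
      ENNReal.rpow_rpow_inv hq.ne'] at h1
  refine ⟨M.toNNReal, fun f hf => ⟨memLp_of_lt_top hμ hf.1.continuousOn ?_, ?_⟩⟩
  · exact (hle f hf).trans_lt (ENNReal.mul_lt_top hMt.lt_top hf.2)
  · rw [ENNReal.coe_toNNReal hMt]; exact hle f hf

theorem carlesonSup_lt_top_of_isCarlesonMeasure (h : IsDoublingWeight ω D) {p q : ℝ} (hp : 0 < p)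
    (hpq : p ≤ q) {μ : Measure ℂ} (hμ : μ discᶜ = 0) (hC : IsCarlesonMeasure p q ω μ) :
    carlesonSup p q ω μ < ∞ := by
  have hq := hp.trans_le hpq
  obtain ⟨M, hM⟩ := hC
  obtain ⟨C, hC⟩ := h.exists_carlesonSup_le hp hpq
  have h1 : embeddingNorm p q ω μ ^ q ≤ (M : ℝ≥0∞) ^ q :=
    embeddingNorm_rpow_le hp hpq fun f hf => by
      rw [← ENNReal.mul_rpow_of_nonneg _ _ hq.le]
      exact ENNReal.rpow_le_rpow (hM f hf).2 hq.le
  refine (hC μ hμ).trans_lt (ENNReal.mul_lt_top ENNReal.coe_lt_top (h1.trans_lt ?_))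
  exact (ENNReal.rpow_ne_top_of_nonneg hq.le ENNReal.coe_ne_top).lt_top

end IsDoublingWeight

/-! ### Compactness forces the vanishing condition. -/

/-- Requiring `4 D ≤ 2^γ` rather than `2 D ≤ 2^γ` gains the extra factor `ℓ`: with `1 ≤ 2^k ℓ ≤ 2`,
multiplying by `2^k ℓ` turns `(2D)^k` into `(4D)^k ℓ`. This gain makes the test functions tend to
zero pointwise. -/
theorem IsDoublingWeight.boxMass_one_mul_le (h : IsDoublingWeight ω D) {γ : ℝ} (hγ0 : 0 < γ)
    (hγ : 4 * (D : ℝ≥0∞) ≤ 2 ^ γ) {ℓ : ℝ} (hℓ : 0 < ℓ) (hℓ1 : ℓ ≤ 1) :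
    boxMass ω 1 * ENNReal.ofReal ℓ ^ γ ≤ 2 ^ γ * ENNReal.ofReal ℓ * boxMass ω ℓ := by
  have hex : ∃ k : ℕ, 1 ≤ 2 ^ k * ℓ ∧ 2 ^ k * ℓ ≤ 2 := by
    obtain ⟨k, hk1, hk2⟩ := exists_nat_pow_near (one_le_inv_iff₀.2 ⟨hℓ, hℓ1⟩) one_lt_two
    rw [inv_eq_one_div] at hk1 hk2
    rw [le_div_iff₀ hℓ] at hk1
    rw [div_lt_iff₀ hℓ] at hk2
    refine ⟨k + 1, hk2.le, ?_⟩
    rw [pow_succ]; linarith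
  obtain ⟨k, hk1, hk2⟩ := hex
  have h2k : (2 : ℝ≥0∞) ^ k * ENNReal.ofReal ℓ = ENNReal.ofReal (2 ^ k * ℓ) := by
    rw [ENNReal.ofReal_mul (by positivity), ENNReal.ofReal_pow two_pos.le, ENNReal.ofReal_ofNat]
  have hbox : boxMass ω 1 ≤ (2 * D) ^ k * boxMass ω ℓ :=
    (boxMass_mono ω hk1).trans (h.boxMass_two_pow hℓ k)
  calc boxMass ω 1 * ENNReal.ofReal ℓ ^ γ
      ≤ (2 ^ k * ENNReal.ofReal ℓ) * (boxMass ω 1 * ENNReal.ofReal ℓ ^ γ) := by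
        refine le_mul_of_one_le_left' ?_
        rwa [h2k, ENNReal.one_le_ofReal]
    _ ≤ (2 ^ k * ENNReal.ofReal ℓ) * ((2 * D) ^ k * boxMass ω ℓ * ENNReal.ofReal ℓ ^ γ) := by
        gcongr
    _ = ENNReal.ofReal ℓ * boxMass ω ℓ * ((4 * D) ^ k * ENNReal.ofReal ℓ ^ γ) := by
        rw [show (4 : ℝ≥0∞) * D = 2 * (2 * D) by rw [← mul_assoc]; norm_num, mul_pow 2 (2 * (D : ℝ≥0∞))]
        ring
    _ ≤ ENNReal.ofReal ℓ * boxMass ω ℓ * ((2 ^ γ) ^ k * ENNReal.ofReal ℓ ^ γ) := by gcongr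
    _ = ENNReal.ofReal ℓ * boxMass ω ℓ * ENNReal.ofReal (2 ^ k * ℓ) ^ γ := by
        rw [← h2k, ENNReal.mul_rpow_of_nonneg _ _ hγ0.le, ← ENNReal.rpow_natCast,
          ← ENNReal.rpow_natCast, ← ENNReal.rpow_mul, ← ENNReal.rpow_mul, mul_comm γ]
    _ ≤ ENNReal.ofReal ℓ * boxMass ω ℓ * 2 ^ γ := by
        gcongr
        exact (ENNReal.ofReal_le_ofReal hk2).trans (le_of_eq (ENNReal.ofReal_ofNat 2))
    _ = _ := by ring

theorem enorm_testFun_rpow_le (h : IsDoublingWeight ω D) {p : ℝ} (hp : 0 < p) {N : ℕ} (hN0 : 0 < N)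
    (hN : 4 * (D : ℝ≥0∞) ≤ 2 ^ (p * N)) {ξ : ℂ} (hξ : ‖ξ‖ = 1) {ℓ : ℝ} (hℓ : 0 < ℓ) (hℓ1 : ℓ ≤ 1)
    {z : ℂ} (hz : z ∈ disc) :
    ‖testFun ω p N ξ ℓ z‖ₑ ^ p ≤
      (2 ^ (p * N) * (boxMass ω 1)⁻¹ * (ENNReal.ofReal (1 - ‖z‖) ^ (p * N))⁻¹) *
        ENNReal.ofReal ℓ := by
  have hz1 := mem_disc.1 hz
  have hd : 0 < 1 - ‖z‖ := by linarith
  have hγ0 : 0 < p * N := by positivity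
  have hV0 := h.boxMass_ne_zero hℓ
  have hVt := h.boxMass_ne_top ℓ
  have h10 := h.boxMass_ne_zero one_pos
  have h1t := h.boxMass_ne_top 1
  have hb : ‖bumpKernel ξ ℓ z‖ₑ ≤ ENNReal.ofReal ℓ * (ENNReal.ofReal (1 - ‖z‖))⁻¹ := by
    rw [← ofReal_norm, ← ENNReal.ofReal_inv_of_pos hd, ← ENNReal.ofReal_mul hℓ.le, ← div_eq_mul_inv]
    exact ENNReal.ofReal_le_ofReal (norm_bumpKernel_le hξ hz1.le hℓ hd (one_sub_norm_le_dist hξ))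
  have hk := h.boxMass_one_mul_le hγ0 hN hℓ hℓ1
  have hVle : (4 * 2 ^ (p * N) * boxMass ω ℓ)⁻¹ ≤ (boxMass ω ℓ)⁻¹ := by
    refine ENNReal.inv_le_inv.2 (le_mul_of_one_le_left' ?_)
    exact one_le_mul (by norm_num) (ENNReal.one_le_rpow (by norm_num) hγ0)
  rw [enorm_testFun_rpow h hp hℓ hp.le, div_self hp.ne', ENNReal.rpow_one]
  calc (4 * 2 ^ (p * N) * boxMass ω ℓ)⁻¹ * ‖bumpKernel ξ ℓ z‖ₑ ^ (p * N)
      ≤ (boxMass ω ℓ)⁻¹ * (ENNReal.ofReal ℓ * (ENNReal.ofReal (1 - ‖z‖))⁻¹) ^ (p * N) := by gcongr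
    _ = (boxMass ω ℓ)⁻¹ * ((boxMass ω 1)⁻¹ * (boxMass ω 1 * ENNReal.ofReal ℓ ^ (p * N))) *
          (ENNReal.ofReal (1 - ‖z‖) ^ (p * N))⁻¹ := by
        rw [ENNReal.mul_rpow_of_nonneg _ _ hγ0.le, ENNReal.inv_rpow, ← mul_assoc _ (boxMass ω 1),
          ENNReal.inv_mul_cancel h10 h1t, one_mul, mul_assoc]
    _ ≤ (boxMass ω ℓ)⁻¹ * ((boxMass ω 1)⁻¹ * (2 ^ (p * N) * ENNReal.ofReal ℓ * boxMass ω ℓ)) *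
          (ENNReal.ofReal (1 - ‖z‖) ^ (p * N))⁻¹ := by gcongr
    _ = ((boxMass ω ℓ)⁻¹ * boxMass ω ℓ) * ((2 ^ (p * N) * (boxMass ω 1)⁻¹ *
          (ENNReal.ofReal (1 - ‖z‖) ^ (p * N))⁻¹) * ENNReal.ofReal ℓ) := by ring
    _ = _ := by rw [ENNReal.inv_mul_cancel hV0 hVt, one_mul]

/-- Normalized bumps of shrinking width converge to zero pointwise. -/
theorem tendsto_testFun (h : IsDoublingWeight ω D) {p : ℝ} (hp : 0 < p) {N : ℕ} (hN0 : 0 < N)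
    (hN : 4 * (D : ℝ≥0∞) ≤ 2 ^ (p * N)) {ξ : ℕ → ℂ} (hξ : ∀ n, ‖ξ n‖ = 1) {ℓ : ℕ → ℝ}
    (hℓ : ∀ n, 0 < ℓ n) (hℓ0 : Tendsto ℓ atTop (𝓝 0)) {z : ℂ} (hz : z ∈ disc) :
    Tendsto (fun n => testFun ω p N (ξ n) (ℓ n) z) atTop (𝓝 0) := by
  have hz1 := mem_disc.1 hz
  have hd : 0 < 1 - ‖z‖ := by linarith
  have hC : 2 ^ (p * N) * (boxMass ω 1)⁻¹ * (ENNReal.ofReal (1 - ‖z‖) ^ (p * N))⁻¹ ≠ ∞ := by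
    refine ENNReal.mul_ne_top (ENNReal.mul_ne_top (ENNReal.rpow_ne_top_of_nonneg (by positivity)
      ENNReal.ofNat_ne_top) (ENNReal.inv_ne_top.2 (h.boxMass_ne_zero one_pos)))
      (ENNReal.inv_ne_top.2 (ENNReal.rpow_pos (ENNReal.ofReal_pos.2 hd) ENNReal.ofReal_ne_top).ne')
  have h1 : Tendsto (fun n => ‖testFun ω p N (ξ n) (ℓ n) z‖ₑ ^ p) atTop (𝓝 0) := by
    have h2 := ENNReal.Tendsto.const_mul (ENNReal.tendsto_ofReal hℓ0) (Or.inr hC)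
    rw [ENNReal.ofReal_zero, mul_zero] at h2
    refine tendsto_of_tendsto_of_tendsto_of_le_of_le' tendsto_const_nhds h2
      (Eventually.of_forall fun _ => zero_le) ?_
    filter_upwards [hℓ0.eventually (Iic_mem_nhds one_pos)] with n hn
    exact enorm_testFun_rpow_le h hp hN0 hN (hξ n) (hℓ n) hn hz
  have h3 := h1.ennrpow_const p⁻¹
  simp only [ENNReal.rpow_rpow_inv hp.ne', ENNReal.zero_rpow_of_pos (inv_pos.2 hp)] at h3
  exact tendsto_zero_iff_enorm_tendsto_zero.2 h3

/-- Compactness of the embedding forces the vanishing Carleson condition. -/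
theorem IsDoublingWeight.isVanishing_of_isCompactEmbedding (h : IsDoublingWeight ω D) {p q : ℝ}
    (hp : 0 < p) (hpq : p ≤ q) {μ : Measure ℂ} (hμ : μ discᶜ = 0)
    (hcomp : IsCompactEmbedding p q ω μ) : IsVanishing p q ω μ := by
  have hq := hp.trans_le hpq
  by_contra hcon
  unfold IsVanishing at hcon
  push Not at hcon
  obtain ⟨ε, hε, hcon⟩ := hcon
  choose J hJ hlen hratio using fun n : ℕ => hcon (1 / ((n : ℝ) + 1)) (by positivity)
  choose hℓ hℓ2 _ ξ hξ hsub using fun n => (hJ n).exists_center h.radial h.cont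
  obtain ⟨N, hN0, hN⟩ := exists_natCast_le_two_rpow hp (4 * D)
  replace hN : 4 * (D : ℝ≥0∞) ≤ 2 ^ (p * N) := by simpa using hN
  have hℓ0 : Tendsto (fun n => arcLength (J n)) atTop (𝓝 0) :=
    squeeze_zero (fun n => (hℓ n).le) (fun n => (hlen n).le) tendsto_one_div_add_atTop_nhds_zero_nat
  set f : ℕ → ℂ → ℂ := fun n => testFun ω p N (ξ n) (arcLength (J n)) with hf
  have hf1 : ∀ n, bergmanNorm p ω (f n) ≤ 1 := fun n =>
    bergmanNorm_testFun_le_one h hp hN0 hN (hξ n) (hℓ n) (by linarith [hℓ2 n, Real.pi_lt_d2])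
  have hfd : ∀ n, DifferentiableOn ℂ (f n) disc := fun n => differentiableOn_testFun (hξ n) (hℓ n)
  obtain ⟨φ, g, hφ, hg, hlim⟩ := hcomp.2 f
    (fun n => ⟨hfd n, (hf1 n).trans_lt ENNReal.one_lt_top⟩) ⟨1, fun n => by simpa using hf1 n⟩
  have hmeas := tendstoInMeasure_of_tendsto_eLpNorm (ENNReal.ofReal_pos.2 hq).ne'
    (fun k => (aemeasurable_of_continuousOn_disc hμ (hfd (φ k)).continuousOn).aestronglyMeasurable)
    hg.1 hlim
  obtain ⟨ns, hns, hae⟩ := hmeas.exists_seq_tendsto_ae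
  -- Convergence in `L^q(μ)` gives almost everywhere convergence along a further subsequence, and
  -- the pointwise limit is already known to be 0.
  have hg0 : g =ᵐ[μ] 0 := by
    filter_upwards [hae, ae_mem_disc hμ] with z hz hzd
    exact tendsto_nhds_unique hz
      ((tendsto_testFun h hp hN0 hN hξ hℓ hℓ0 hzd).comp (hφ.comp hns).tendsto_atTop)
  have hlim0 : Tendsto (fun k => eLpNorm (f (φ k)) (ENNReal.ofReal q) μ) atTop (𝓝 0) := by
    refine hlim.congr fun k => eLpNorm_congr_ae ?_
    filter_upwards [hg0] with z hz
    simp [hz]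
  set C : ℝ≥0∞ := (4 * 2 ^ (p * N) * ENNReal.ofReal Real.pi) ^ (q / p) * 3 ^ (q * N) with hC
  have hCt : C ≠ ∞ := by
    refine ENNReal.mul_ne_top (ENNReal.rpow_ne_top_of_nonneg (by positivity)
      (ENNReal.mul_ne_top (ENNReal.mul_ne_top ENNReal.ofNat_ne_top ?_) ENNReal.ofReal_ne_top)) ?_
    · exact ENNReal.rpow_ne_top_of_nonneg (by positivity) ENNReal.ofNat_ne_top
    · exact ENNReal.rpow_ne_top_of_nonneg (by positivity) ENNReal.ofNat_ne_top
  have hlim1 := ENNReal.Tendsto.const_mul (hlim0.ennrpow_const q) (Or.inr hCt)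
  rw [ENNReal.zero_rpow_of_pos hq, mul_zero] at hlim1
  refine hε.not_ge (ge_of_tendsto' hlim1 fun k => (hratio (φ k)).le.trans ?_)
  exact carlesonRatio_le_eLpNorm_testFun h hp hpq N (hJ _) (hξ _) (hsub _) hμ

/-! ### The vanishing condition implies compactness. -/

/-- Montel's theorem on the disc, in terms of pointwise convergence. -/
theorem exists_subseq_tendsto_of_locally_bounded {f : ℕ → ℂ → ℂ}
    (hf : ∀ n, DifferentiableOn ℂ (f n) disc) {M : ℝ → ℝ}
    (hM : ∀ n, ∀ r < 1, ∀ z, ‖z‖ ≤ r → ‖f n z‖ ≤ M r) :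
    ∃ (φ : ℕ → ℕ) (g : ℂ → ℂ), StrictMono φ ∧ DifferentiableOn ℂ g disc ∧
      ∀ z ∈ disc, Tendsto (fun j => f (φ j) z) atTop (𝓝 (g z)) := by
  set a : ℕ → ℕ → ℂ := fun n k => (k.factorial : ℂ)⁻¹ * iteratedDeriv k (f n) 0 with ha
  have hbound : ∀ R, 0 < R → R < 1 → ∀ n k, ‖a n k‖ ≤ M R / R ^ k := by
    intro R hR hR1 n k
    have hcl : Metric.closedBall (0 : ℂ) R ⊆ disc := Metric.closedBall_subset_ball hR1
    have h1 := Complex.norm_iteratedDeriv_le_of_forall_mem_sphere_norm_le (f := f n) (c := 0) k hR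
      ((hf n).diffContOnCl_ball hcl)
      (fun z hz => hM n R hR1 z (mem_sphere_zero_iff_norm.1 hz).le)
    have h2 : (0 : ℝ) < k.factorial := by exact_mod_cast k.factorial_pos
    rw [ha, norm_mul, norm_inv, Complex.norm_natCast, inv_mul_le_iff₀ h2]
    exact h1.trans (le_of_eq (by ring))
  -- Tychonoff on the sequence of Taylor coefficients replaces the diagonal argument; the Cauchy
  -- bounds at radius `1/2` suffice to extract, and those at every other radius pass to the limit.
  have hcpt : IsCompact (univ.pi fun k : ℕ => Metric.closedBall (0 : ℂ) (M 2⁻¹ / 2⁻¹ ^ k)) :=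
    isCompact_univ_pi fun k => isCompact_closedBall _ _
  obtain ⟨b, -, φ, hφ, hlim⟩ := hcpt.tendsto_subseq (x := a) fun n k _ =>
    mem_closedBall_zero_iff.2 (hbound 2⁻¹ (by norm_num) (by norm_num) n k)
  have hlimk : ∀ k, Tendsto (fun j => a (φ j) k) atTop (𝓝 (b k)) := tendsto_pi_nhds.1 hlim
  have hb : ∀ R, 0 < R → R < 1 → ∀ k, ‖b k‖ ≤ M R / R ^ k := fun R hR hR1 k =>
    le_of_tendsto' (hlimk k).norm fun j => hbound R hR hR1 _ k
  have hterm : ∀ (c : ℕ → ℂ) (r R : ℝ) (z : ℂ), 0 < R → ‖z‖ ≤ r → (∀ k, ‖c k‖ ≤ M R / R ^ k) →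
      ∀ k, ‖c k * z ^ k‖ ≤ M R * (r / R) ^ k := by
    intro c r R z hR hz hc k
    rw [norm_mul, norm_pow]
    calc ‖c k‖ * ‖z‖ ^ k ≤ M R / R ^ k * r ^ k := by
          have := (norm_nonneg _).trans (hc k)
          gcongr; exact hc k
      _ = _ := by rw [div_pow]; ring
  have hsum : ∀ r R : ℝ, 0 ≤ r → r < R → Summable fun k : ℕ => M R * (r / R) ^ k := by
    intro r R hr hrR
    have hR : 0 < R := hr.trans_lt hrR
    exact (summable_geometric_of_lt_one (div_nonneg hr hR.le) ((div_lt_one hR).2 hrR)).mul_left _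
  refine ⟨φ, fun z => ∑' k, b k * z ^ k, hφ, ?_, fun z hz => ?_⟩
  · intro z hz
    obtain ⟨r, hzr, hr1⟩ := exists_between (mem_disc.1 hz)
    obtain ⟨R, hrR, hR1⟩ := exists_between hr1
    have hr0 : 0 ≤ r := (norm_nonneg z).trans hzr.le
    have hd := Complex.differentiableOn_tsum_of_summable_norm (F := fun k z => b k * z ^ k)
      (U := Metric.ball (0 : ℂ) r) (hsum r R hr0 hrR) (fun k => by fun_prop) Metric.isOpen_ball
      fun k w hw => hterm b r R w (hr0.trans_lt hrR) (mem_ball_zero_iff.1 hw).le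
        (hb R (hr0.trans_lt hrR) hR1) k
    exact (hd.differentiableAt (Metric.isOpen_ball.mem_nhds
      (mem_ball_zero_iff.2 hzr))).differentiableWithinAt
  · obtain ⟨R, hzR, hR1⟩ := exists_between (mem_disc.1 hz)
    have hR : 0 < R := (norm_nonneg z).trans_lt hzR
    have hts : ∀ n, f n z = ∑' k, a n k * z ^ k := fun n => by
      rw [← (Complex.hasSum_taylorSeries_on_ball (hf n) hz).tsum_eq]
      refine tsum_congr fun k => ?_
      simp only [ha, smul_eq_mul, sub_zero]; ring
    simp only [hts]
    refine tendsto_tsum_of_dominated_convergence (hsum ‖z‖ R (norm_nonneg z) hzR)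
      (fun k => (hlimk k).mul_const _) (Eventually.of_forall fun j k => ?_)
    exact hterm _ _ _ z hR le_rfl (hbound R hR hR1 _) k

/-- Functions in a bounded subset of `A^p_ω` are uniformly bounded on smaller discs. -/
theorem IsDoublingWeight.exists_norm_le (h : IsDoublingWeight ω D) {p : ℝ} (hp : 0 < p) (B : ℝ≥0) :
    ∃ M : ℝ → ℝ, ∀ f : ℂ → ℂ, DifferentiableOn ℂ f disc → bergmanNorm p ω f ≤ B →
      ∀ r < 1, ∀ z, ‖z‖ ≤ r → ‖f z‖ ≤ M r := by
  obtain ⟨C, -, hC⟩ := exists_enorm_rpow_le h hp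
  refine ⟨fun r => ((C * ((B : ℝ≥0∞) ^ p / boxMass ω (1 - r))) ^ p⁻¹).toReal,
    fun f hf hB r hr z hz => ?_⟩
  have hzd : z ∈ disc := mem_disc.2 (hz.trans_lt hr)
  have hr1 : 0 < 1 - r := by linarith
  have hV0 := h.boxMass_ne_zero hr1
  have hVt := h.boxMass_ne_top (1 - r)
  obtain ⟨ξ, hξ, hzξ⟩ := exists_nearest_boundary_point z hzd
  have h1 := hC f hf z hzd ξ hξ hzξ ((B : ℝ≥0∞) ^ p / boxMass ω (1 - r)) fun k _ => by
    calc ∫⁻ ζ in Metric.closedBall ξ (2 ^ k * (1 - ‖z‖)), ‖f ζ‖ₑ ^ p ∂weightedMeasure ω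
        ≤ bergmanNorm p ω f ^ p := by
          rw [bergmanNorm_rpow h.radial hp]; exact setLIntegral_le_lintegral _ _
      _ ≤ (B : ℝ≥0∞) ^ p := by gcongr
      _ = (B : ℝ≥0∞) ^ p / boxMass ω (1 - r) * boxMass ω (1 - r) :=
          (ENNReal.div_mul_cancel hV0 hVt).symm
      _ ≤ _ := by
          gcongr
          refine boxMass_mono ω ?_
          have := one_le_pow₀ (one_le_two (α := ℝ)) (n := k)
          nlinarith
  have ht : (C * ((B : ℝ≥0∞) ^ p / boxMass ω (1 - r))) ^ p⁻¹ ≠ ∞ :=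
    ENNReal.rpow_ne_top_of_nonneg (inv_nonneg.2 hp.le) (ENNReal.mul_ne_top ENNReal.coe_ne_top
      (ENNReal.div_ne_top (ENNReal.rpow_ne_top_of_nonneg hp.le ENNReal.coe_ne_top) hV0))
  rw [← toReal_enorm]
  exact ENNReal.toReal_mono ht ((ENNReal.le_rpow_inv_iff hp).2 h1)

/-- Fatou's lemma for the Bergman norm. -/
theorem bergmanNorm_le_of_tendsto (hω : IsRadialWeight ω) {p : ℝ} (hp : 0 < p) {f : ℕ → ℂ → ℂ}
    (hf : ∀ n, ContinuousOn (f n) disc) {g : ℂ → ℂ} {B : ℝ≥0∞}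
    (hB : ∀ n, bergmanNorm p ω (f n) ≤ B)
    (hlim : ∀ z ∈ disc, Tendsto (fun n => f n z) atTop (𝓝 (g z))) : bergmanNorm p ω g ≤ B := by
  have hν := weightedMeasure_disc_compl ω
  rw [← ENNReal.rpow_le_rpow_iff hp, bergmanNorm_rpow hω hp]
  calc ∫⁻ z, ‖g z‖ₑ ^ p ∂weightedMeasure ω
      = ∫⁻ z, liminf (fun n => ‖f n z‖ₑ ^ p) atTop ∂weightedMeasure ω :=
        lintegral_congr_ae ((ae_mem_disc hν).mono fun z hz =>
          (((hlim z hz).enorm.ennrpow_const p).liminf_eq).symm)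
    _ ≤ liminf (fun n => ∫⁻ z, ‖f n z‖ₑ ^ p ∂weightedMeasure ω) atTop :=
        lintegral_liminf_le' fun n => aemeasurable_enorm_rpow hν (hf n) p
    _ ≤ B ^ p := by
        refine liminf_le_of_le (by isBoundedDefault) fun b hb => ?_
        obtain ⟨n, hn⟩ := hb.exists
        refine hn.trans ?_
        rw [← bergmanNorm_rpow hω hp]
        exact ENNReal.rpow_le_rpow (hB n) hp.le

/-- Only small radii need a local hypothesis; for larger ones the total mass is compared with the
box at `ρ₀`. -/
theorem ballCondition_of_small {τ : ℝ} (hτ : 0 ≤ τ) {μ : Measure ℂ} {K : ℝ≥0∞} {ρ₀ : ℝ}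
    (hsmall : ∀ ξ : ℂ, ‖ξ‖ = 1 → ∀ ρ : ℝ, 0 < ρ → ρ ≤ ρ₀ →
      μ (Metric.closedBall ξ (5 * ρ)) ≤ K * boxMass ω ρ ^ τ)
    (huniv : μ univ ≤ K * boxMass ω ρ₀ ^ τ) : BallCondition ω τ μ K := by
  intro ξ hξ ρ hρ _
  rcases le_total ρ ρ₀ with hle | hle
  · exact hsmall ξ hξ ρ hρ hle
  · refine (measure_mono (subset_univ _)).trans (huniv.trans ?_)
    gcongr
    exact boxMass_mono ω hle

namespace IsDoublingWeight

variable {p q : ℝ} {μ : Measure ℂ}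

theorem exists_measure_closedBall_le (h : IsDoublingWeight ω D) (hp : 0 < p) (hpq : p ≤ q)
    (hμ : μ discᶜ = 0) (hv : IsVanishing p q ω μ) {ε : ℝ≥0∞} (hε : ε ≠ 0) :
    ∃ ρ₀ : ℝ, 0 < ρ₀ ∧ ∀ ξ : ℂ, ‖ξ‖ = 1 → ∀ ρ : ℝ, 0 < ρ → ρ ≤ ρ₀ →
      μ (Metric.closedBall ξ (5 * ρ)) ≤ ε * boxMass ω ρ ^ (q / p) := by
  have hτ : 0 ≤ q / p := div_nonneg (hp.le.trans hpq) hp.le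
  have hpi := Real.pi_pos
  set A : ℝ≥0∞ := (4 * D * (2 * D) ^ 5) ^ (q / p) with hA
  have hAt : A ≠ ∞ := ENNReal.rpow_ne_top_of_nonneg hτ (by finiteness)
  obtain ⟨δ, hδ, hvδ⟩ := hv (ε / A) (ENNReal.div_pos hε hAt)
  -- The covering arc has length at most `10πρ ≤ δ/2`, strictly below `δ`.
  refine ⟨δ / (20 * Real.pi), by positivity, fun ξ hξ ρ hρ hρδ => ?_⟩
  refine (h.measure_closedBall_le hp hpq hμ hξ hρ (K := ε / A) fun J hJ hlen =>
    hvδ J hJ (hlen.trans_lt ?_)).trans ?_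
  · rw [le_div_iff₀ (by positivity)] at hρδ
    nlinarith
  · gcongr
    exact ENNReal.mul_div_le

/-- Compactness of the closed disc: interior points have neighbourhoods of finite measure by `hK`,
boundary points by the vanishing condition. -/
theorem isFiniteMeasure_of_isVanishing (h : IsDoublingWeight ω D) (hp : 0 < p) (hpq : p ≤ q)
    (hμ : μ discᶜ = 0) (hv : IsVanishing p q ω μ)
    (hK : ∀ K : Set ℂ, K ⊆ disc → IsCompact K → μ K < ∞) : IsFiniteMeasure μ := by
  have hτ : 0 ≤ q / p := div_nonneg (hp.le.trans hpq) hp.le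
  obtain ⟨ρ₀, hρ₀, hball⟩ := h.exists_measure_closedBall_le hp hpq hμ hv one_ne_zero
  have h1 : μ (Metric.closedBall (0 : ℂ) 1) < ∞ := by
    refine (isCompact_closedBall (0 : ℂ) 1).measure_lt_top_of_nhdsWithin fun z hz => ?_
    rcases (mem_closedBall_zero_iff.1 hz).lt_or_eq with hlt | heq
    · obtain ⟨ε, hε, hsub⟩ := Metric.nhds_basis_closedBall.mem_iff.1
        (isOpen_disc.mem_nhds (mem_disc.2 hlt))
      exact ⟨_, mem_nhdsWithin_of_mem_nhds (Metric.closedBall_mem_nhds z hε),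
        hK _ hsub (isCompact_closedBall z ε)⟩
    · refine ⟨_, mem_nhdsWithin_of_mem_nhds (Metric.closedBall_mem_nhds z
        (by positivity : 0 < 5 * ρ₀)), (hball z heq ρ₀ hρ₀ le_rfl).trans_lt ?_⟩
      rw [one_mul]
      exact (ENNReal.rpow_ne_top_of_nonneg hτ (h.boxMass_ne_top _)).lt_top
  refine ⟨?_⟩
  rw [← restrict_disc hμ, Measure.restrict_apply_univ]
  exact (measure_mono Metric.ball_subset_closedBall).trans_lt h1

theorem exists_ballCondition (h : IsDoublingWeight ω D) (hp : 0 < p) (hpq : p ≤ q)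
    (hμ : μ discᶜ = 0) (hv : IsVanishing p q ω μ) [IsFiniteMeasure μ] :
    ∃ K : ℝ≥0∞, K ≠ ∞ ∧ BallCondition ω (q / p) μ K := by
  have hτ : 0 ≤ q / p := div_nonneg (hp.le.trans hpq) hp.le
  obtain ⟨ρ₀, hρ₀, hball⟩ := h.exists_measure_closedBall_le hp hpq hμ hv one_ne_zero
  have hV0 : boxMass ω ρ₀ ^ (q / p) ≠ 0 :=
    (ENNReal.rpow_pos (pos_iff_ne_zero.2 (h.boxMass_ne_zero hρ₀)) (h.boxMass_ne_top _)).ne'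
  have hVt := ENNReal.rpow_ne_top_of_nonneg hτ (h.boxMass_ne_top ρ₀)
  refine ⟨max 1 (μ univ / boxMass ω ρ₀ ^ (q / p)), ?_, ballCondition_of_small hτ (ρ₀ := ρ₀) ?_ ?_⟩
  · exact max_ne_top ENNReal.one_ne_top (ENNReal.div_ne_top (measure_ne_top μ _) hV0)
  · intro ξ hξ ρ hρ hρle
    exact (hball ξ hξ ρ hρ hρle).trans (by gcongr; exact le_max_left _ _)
  · rw [← ENNReal.div_le_iff hV0 hVt]
    exact le_max_right _ _

/-- Near the boundary, a vanishing Carleson measure has a small Carleson constant. -/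
theorem exists_ballCondition_restrict (h : IsDoublingWeight ω D) (hp : 0 < p) (hpq : p ≤ q)
    (hμ : μ discᶜ = 0) (hv : IsVanishing p q ω μ) [IsFiniteMeasure μ] {ε : ℝ≥0∞} (hε : ε ≠ 0) :
    ∃ r < 1, BallCondition ω (q / p) (μ.restrict (Metric.closedBall 0 r)ᶜ) ε := by
  have hτ : 0 ≤ q / p := div_nonneg (hp.le.trans hpq) hp.le
  obtain ⟨ρ₀, hρ₀, hball⟩ := h.exists_measure_closedBall_le hp hpq hμ hv hε
  have hV0 : boxMass ω ρ₀ ^ (q / p) ≠ 0 :=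
    (ENNReal.rpow_pos (pos_iff_ne_zero.2 (h.boxMass_ne_zero hρ₀)) (h.boxMass_ne_top _)).ne'
  have hu : Tendsto (fun n : ℕ => 1 - 1 / ((n : ℝ) + 1)) atTop (𝓝 1) := by
    simpa using tendsto_one_div_add_atTop_nhds_zero_nat.const_sub (1 : ℝ)
  have hlim : Tendsto (fun n : ℕ => μ (Metric.closedBall 0 (1 - 1 / ((n : ℝ) + 1)))ᶜ) atTop (𝓝 0) := by
    have h1 := tendsto_measure_iInter_atTop (μ := μ)
      (s := fun n : ℕ => (Metric.closedBall (0 : ℂ) (1 - 1 / ((n : ℝ) + 1)))ᶜ)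
      (fun n => measurableSet_closedBall.compl.nullMeasurableSet)
      (fun m n hmn => compl_subset_compl.2 (Metric.closedBall_subset_closedBall
        (sub_le_sub_left (Nat.one_div_le_one_div hmn) 1))) ⟨0, measure_ne_top μ _⟩
    have h2 : (⋂ n : ℕ, (Metric.closedBall (0 : ℂ) (1 - 1 / ((n : ℝ) + 1)))ᶜ) ⊆ discᶜ := by
      intro z hz hzd
      obtain ⟨n, hn⟩ := (hu.eventually (lt_mem_nhds (mem_disc.1 hzd))).exists
      exact mem_iInter.1 hz n (mem_closedBall_zero_iff.2 hn.le)
    rwa [measure_mono_null h2 hμ] at h1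
  obtain ⟨n, hn⟩ := (hlim.eventually (Iic_mem_nhds
    (pos_iff_ne_zero.2 (mul_ne_zero hε hV0)))).exists
  refine ⟨1 - 1 / ((n : ℝ) + 1), by linarith [Nat.one_div_pos_of_nat (α := ℝ) (n := n)],
    ballCondition_of_small hτ (ρ₀ := ρ₀) (fun ξ hξ ρ hρ hle => ?_) ?_⟩
  · exact (Measure.restrict_apply_le _ _).trans (hball ξ hξ ρ hρ hle)
  · rw [Measure.restrict_apply_univ]
    exact hn

/-- Bounded sequences of `A^p_ω` converging to zero pointwise converge to zero in `L^q(μ)`. -/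
theorem tendsto_eLpNorm_zero (h : IsDoublingWeight ω D) (hp : 0 < p) (hpq : p ≤ q)
    (hμ : μ discᶜ = 0) (hv : IsVanishing p q ω μ) [IsFiniteMeasure μ] {u : ℕ → ℂ → ℂ}
    (hu : ∀ n, DifferentiableOn ℂ (u n) disc) {B : ℝ≥0} (hB : ∀ n, bergmanNorm p ω (u n) ≤ B)
    (hlim : ∀ z ∈ disc, Tendsto (fun n => u n z) atTop (𝓝 0)) :
    Tendsto (fun n => eLpNorm (u n) (ENNReal.ofReal q) μ) atTop (𝓝 0) := by
  have hq := hp.trans_le hpq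
  obtain ⟨C, hC⟩ := h.exists_eLpNorm_rpow_le hp hpq
  obtain ⟨M, hM⟩ := h.exists_norm_le hp B
  have hlimq : Tendsto (fun n => ∫⁻ z, ‖u n z‖ₑ ^ q ∂μ) atTop (𝓝 0) := by
    rw [ENNReal.tendsto_nhds_zero]
    intro η hη
    have hη2 : η / 2 ≠ 0 := (ENNReal.half_pos hη.ne').ne'
    have hCB : (C : ℝ≥0∞) * (B : ℝ≥0∞) ^ q ≠ ∞ := ENNReal.mul_ne_top ENNReal.coe_ne_top
      (ENNReal.rpow_ne_top_of_nonneg hq.le ENNReal.coe_ne_top)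
    -- The Carleson constant outside radius `r` is chosen so that the boundedness estimate
    -- contributes at most `η/2` uniformly in `n`.
    obtain ⟨r, hr, hK⟩ := h.exists_ballCondition_restrict hp hpq hμ hv
      (ENNReal.div_pos hη2 hCB).ne'
    have hrestr : ∀ s : Set ℂ, μ.restrict s discᶜ = 0 := fun s =>
      le_antisymm ((Measure.restrict_apply_le _ _).trans hμ.le) zero_le
    have houter : ∀ n, ∫⁻ z in (Metric.closedBall 0 r)ᶜ, ‖u n z‖ₑ ^ q ∂μ ≤ η / 2 := fun n => by
      rw [← eLpNorm_ofReal_rpow hq]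
      calc _ ≤ C * (η / 2 / (C * (B : ℝ≥0∞) ^ q)) * bergmanNorm p ω (u n) ^ q :=
            hC _ _ (hrestr _) hK (u n) (hu n)
        _ ≤ C * (η / 2 / (C * (B : ℝ≥0∞) ^ q)) * (B : ℝ≥0∞) ^ q := by gcongr; exact hB n
        _ = C * (B : ℝ≥0∞) ^ q * (η / 2 / (C * (B : ℝ≥0∞) ^ q)) := by ring
        _ ≤ η / 2 := ENNReal.mul_div_le
    have hinner : Tendsto (fun n => ∫⁻ z in Metric.closedBall 0 r, ‖u n z‖ₑ ^ q ∂μ) atTop (𝓝 0) := by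
      have h1 := tendsto_lintegral_of_dominated_convergence' (μ := μ.restrict (Metric.closedBall 0 r))
        (F := fun n z => ‖u n z‖ₑ ^ q) (f := fun _ => 0) (fun _ => ENNReal.ofReal (M r) ^ q)
        (fun n => aemeasurable_enorm_rpow (hrestr _) (hu n).continuousOn q)
        (fun n => (ae_restrict_mem measurableSet_closedBall).mono fun z hz => by
          simp only [← ofReal_norm]
          gcongr
          exact hM (u n) (hu n) (hB n) r hr z (mem_closedBall_zero_iff.1 hz))
        (by
          rw [lintegral_const]
          exact ENNReal.mul_ne_top (ENNReal.rpow_ne_top_of_nonneg hq.le ENNReal.ofReal_ne_top)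
            (measure_ne_top _ _))
        ((ae_mem_disc (hrestr _)).mono fun z hz => by
          simpa [ENNReal.zero_rpow_of_pos hq] using (hlim z hz).enorm.ennrpow_const q)
      simpa using h1
    filter_upwards [hinner.eventually (Iic_mem_nhds (pos_iff_ne_zero.2 hη2))] with n hn
    rw [← lintegral_add_compl _ (measurableSet_closedBall (x := (0 : ℂ)) (ε := r)),
      ← ENNReal.add_halves η]
    exact add_le_add hn (houter n)
  have h2 := hlimq.ennrpow_const q⁻¹
  simp only [← eLpNorm_ofReal_rpow hq, ENNReal.rpow_rpow_inv hq.ne',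
    ENNReal.zero_rpow_of_pos (inv_pos.2 hq)] at h2
  exact h2

/-- A substitute for the triangle inequality that is valid for all `p > 0`, including `p < 1`. -/
theorem bergmanNorm_sub_rpow_le (h : IsDoublingWeight ω D) (hp : 0 < p) {f g : ℂ → ℂ}
    (hf : DifferentiableOn ℂ f disc) :
    bergmanNorm p ω (f - g) ^ p ≤ 2 ^ p * (bergmanNorm p ω f ^ p + bergmanNorm p ω g ^ p) := by
  simp only [bergmanNorm_rpow h.radial hp]
  rw [← lintegral_add_left' (aemeasurable_enorm_rpow (weightedMeasure_disc_compl ω)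
    hf.continuousOn p), ← lintegral_const_mul' _ _
    (ENNReal.rpow_ne_top_of_nonneg hp.le ENNReal.ofNat_ne_top)]
  refine lintegral_mono fun z => ?_
  have h1 : ‖(f - g) z‖ₑ ≤ 2 * max ‖f z‖ₑ ‖g z‖ₑ := by
    refine enorm_sub_le.trans ?_
    rw [two_mul]
    exact add_le_add (le_max_left _ _) (le_max_right _ _)
  calc ‖(f - g) z‖ₑ ^ p ≤ (2 * max ‖f z‖ₑ ‖g z‖ₑ) ^ p := by gcongr
    _ = 2 ^ p * max (‖f z‖ₑ ^ p) (‖g z‖ₑ ^ p) := by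
        rw [ENNReal.mul_rpow_of_nonneg _ _ hp.le, (ENNReal.monotone_rpow_of_nonneg hp.le).map_max]
    _ ≤ 2 ^ p * (‖f z‖ₑ ^ p + ‖g z‖ₑ ^ p) := by
        gcongr
        exact max_le_add_of_nonneg zero_le zero_le

/-- The vanishing Carleson condition implies compactness of the embedding. -/
theorem isCompactEmbedding_of_isVanishing (h : IsDoublingWeight ω D) (hp : 0 < p) (hpq : p ≤ q)
    (hμ : μ discᶜ = 0) (hv : IsVanishing p q ω μ)
    (hK : ∀ K : Set ℂ, K ⊆ disc → IsCompact K → μ K < ∞) : IsCompactEmbedding p q ω μ := by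
  have hq := hp.trans_le hpq
  have := h.isFiniteMeasure_of_isVanishing hp hpq hμ hv hK
  have hmem : ∀ f ∈ bergmanSpace p ω, MemLp f (ENNReal.ofReal q) μ := by
    intro f hf
    obtain ⟨K, hKt, hball⟩ := h.exists_ballCondition hp hpq hμ hv
    obtain ⟨C, hC⟩ := h.exists_eLpNorm_rpow_le hp hpq
    refine memLp_of_lt_top hμ hf.1.continuousOn ?_
    rw [← ENNReal.rpow_lt_top_iff_of_pos hq]
    exact (hC μ K hμ hball f hf.1).trans_lt (ENNReal.mul_lt_top (ENNReal.mul_lt_top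
      ENNReal.coe_lt_top hKt.lt_top) (ENNReal.rpow_lt_top_of_nonneg hq.le hf.2.ne))
  refine ⟨hmem, fun f hf ⟨B, hB⟩ => ?_⟩
  obtain ⟨M, hM⟩ := h.exists_norm_le hp B
  obtain ⟨φ, g, hφ, hg, hlim⟩ := exists_subseq_tendsto_of_locally_bounded (fun n => (hf n).1)
    fun n => hM (f n) (hf n).1 (hB n)
  have hgB : bergmanNorm p ω g ≤ B := bergmanNorm_le_of_tendsto h.radial hp
    (fun n => (hf (φ n)).1.continuousOn) (fun n => hB (φ n)) hlim
  refine ⟨φ, g, hφ, hmem g ⟨hg, hgB.trans_lt ENNReal.coe_lt_top⟩, ?_⟩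
  set B' : ℝ≥0∞ := (2 ^ p * ((B : ℝ≥0∞) ^ p + (B : ℝ≥0∞) ^ p)) ^ p⁻¹ with hB'
  have hB't : B' ≠ ∞ := by
    have := ENNReal.rpow_ne_top_of_nonneg hp.le (ENNReal.coe_ne_top (r := B))
    exact ENNReal.rpow_ne_top_of_nonneg (inv_nonneg.2 hp.le) (ENNReal.mul_ne_top
      (ENNReal.rpow_ne_top_of_nonneg hp.le ENNReal.ofNat_ne_top) (ENNReal.add_ne_top.2 ⟨this, this⟩))
  -- Applied directly to the differences `f (φ n) - g`, so no triangle inequality in `L^q(μ)` is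
  -- needed when `q < 1`.
  refine h.tendsto_eLpNorm_zero hp hpq hμ hv (fun n => (hf (φ n)).1.sub hg) (B := B'.toNNReal)
    (fun n => ?_) fun z hz => ?_
  · rw [ENNReal.coe_toNNReal hB't, hB', ENNReal.le_rpow_inv_iff hp]
    refine (h.bergmanNorm_sub_rpow_le hp (hf (φ n)).1).trans ?_
    gcongr
    exact hB _
  · simpa using (hlim z hz).sub_const (g z)

end IsDoublingWeight

end BergmanCarleson

/-! ### Assembly of the theorem. -/

theorem mainTheorem1 (p q : ℝ) (hp : 0 < p) (hpq : p ≤ q) (ω : ℂ → ℝ)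
    (hω : BergmanCarleson.IsRapidlyIncreasing ω ∨ BergmanCarleson.IsRegular ω) :
    -- (i) boundedness, for every positive Borel measure on the disc
    (∀ μ : Measure ℂ, μ BergmanCarleson.discᶜ = 0 →
      (BergmanCarleson.IsCarlesonMeasure p q ω μ ↔
        BergmanCarleson.carlesonSup p q ω μ < ∞)) ∧
    -- comparability of the norm, with a constant independent of the measure
    (∃ C : ℝ≥0, 0 < C ∧ ∀ μ : Measure ℂ, μ BergmanCarleson.discᶜ = 0 →
      BergmanCarleson.IsCarlesonMeasure p q ω μ →
        BergmanCarleson.embeddingNorm p q ω μ ^ q ≤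
            C * BergmanCarleson.carlesonSup p q ω μ ∧
          BergmanCarleson.carlesonSup p q ω μ ≤
            C * BergmanCarleson.embeddingNorm p q ω μ ^ q) ∧
    -- (ii) compactness; the converse is for measures that are finite on compact subsets of the disc
    (∀ μ : Measure ℂ, μ BergmanCarleson.discᶜ = 0 →
      (BergmanCarleson.IsCompactEmbedding p q ω μ → BergmanCarleson.IsVanishing p q ω μ) ∧
      ((∀ K : Set ℂ, K ⊆ BergmanCarleson.disc → IsCompact K → μ K < ∞) →
        BergmanCarleson.IsVanishing p q ω μ → BergmanCarleson.IsCompactEmbedding p q ω μ)) := by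
  obtain ⟨D, h⟩ := BergmanCarleson.exists_isDoublingWeight hω
  obtain ⟨C₁, hC₁⟩ := h.exists_embeddingNorm_le hp hpq
  obtain ⟨C₂, hC₂⟩ := h.exists_carlesonSup_le hp hpq
  refine ⟨fun μ hμ => ⟨h.carlesonSup_lt_top_of_isCarlesonMeasure hp hpq hμ,
    h.isCarlesonMeasure_of_carlesonSup_lt_top hp hpq hμ⟩,
    ⟨C₁ + C₂ + 1, by positivity, fun μ hμ _ => ⟨?_, ?_⟩⟩,
    fun μ hμ => ⟨h.isVanishing_of_isCompactEmbedding hp hpq hμ,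
      fun hK hv => h.isCompactEmbedding_of_isVanishing hp hpq hμ hv hK⟩⟩
  · refine (BergmanCarleson.embeddingNorm_rpow_le hp hpq (hC₁ μ hμ)).trans ?_
    gcongr
    exact (le_self_add (a := C₁) (b := C₂)).trans le_self_add
  · refine (hC₂ μ hμ).trans ?_
    gcongr
    exact (le_add_self (a := C₂) (b := C₁)).trans le_self_add
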